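/- Let $\mathbb{T}$ be the unit circle with normalized Lebesgue measure $m$ and let $L^0$ be the space of (classes of a.e. equal) measurable a.e. finite functions $f\colon\mathbb{T}\to\mathbb{C}$. A Banach function space is a complex Banach space $X\subset L^0$ such that (a) if $f\in X$, $g\in L^0$ and $|g|\le|f|$ a.e., then $g\in X$ and $\|g\|_X\le\|f\|_X$; (b) $L^\infty\subset X$; (c) if $f_n,f\in X$ and $0\le f_n\uparrow f$ a.e., then $\|f\|_X=\sup_n\|f_n\|_X$. It has the Fatou property if $f_n\in X$, $f\in L^0$, $0\le f_n\uparrow f$ a.e. and $\sup_n\|f_n\|_X<\infty$ imply $f\in X$ and $\|f\|_X=\sup_n\|f_n\|_X$. It is rearrangement invariant (r.i.) if $f\in X$, $g\in L^0$ and $m\{|f|>\lambda\}=m\{|g|>\lambda\}$ for all $\lambda\ge0$ imply $g\in X$ and $\|g\|_X=\|f\|_X$; an r.i. Banach function space is contained in $L^1$. For $s>0$ and $\theta\in[0,2\pi)$ let $(D_sf)(e^{i\theta})=f(e^{is\theta})$ if $s\theta\in[0,2\pi)$ and $0$ otherwise. The Boyd indices of $X$ are $$\alpha_X=\lim_{s\to0^+}\frac{\log\|D_{1/s}\|_{X\to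 X}}{\log s},\qquad \beta_X=\lim_{s\to\infty}\frac{\log\|D_{1/s}\|_{X\to X}}{\log s},$$ and they are called nontrivial if $\alpha_X,\beta_X\in(0,1)$. Let $\chi_n(t)=t^n$, $\langle f,g\rangle=\int_{\mathbb{T}}f\bar g\,dm$ and $\widehat f(n)=\langle f,\chi_n\rangle$. Let $H[X]=\{f\in X:\widehat f(n)=0\text{ for all }n<0\}$ with the norm of $X$. The space of pointwise multipliers is $M(X,Y)=\{a\in L^0: ag\in Y\text{ for all }g\in X\}$ with $\|a\|_{M(X,Y)}=\sup_{\|g\|_X\le1}\|ag\|_Y$. The Riesz projection $P$ sends $f$ to the function $Pf\in L^1$ with $\widehat{Pf}(n)=\widehat f(n)$ for $n\ge0$ and $\widehat{Pf}(n)=0$ for $n<0$, and the Toeplitz operator with symbol $a$ is $T_af=P(af)$. **Theorem (general Brown–Halmos theorem).** Let $X,Y$ be separable r.i. Banach function spaces on $\mathbb{T}$ with $X\subset Y$, and suppose that $Y$ has nontrivial Boyd indices and the Fatou property; then $P$ is a bounded operator on $Y$. Let $A\colon H[X]\to H[Y]$ be a continuous linear operator and $(a_n)_{n\in\mathbb{Z}}$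 a sequence of complex numbers. Then $$\langle A\chi_j,\chi_k\rangle=a_{k-j}\qquad\text{for all } j,k\ge0$$ if and only if there exists $a\in M(X,Y)$ such that $A=T_a$ and $\widehat a(n)=a_n$ for all $n\in\mathbb{Z}$. Moreover, for every $a\in M(X,Y)$ the operator $T_a\colon H[X]\to H[Y]$ is well defined and bounded, and $$\|a\|_{M(X,Y)}\le\|T_a\|_{H[X]\to H[Y]}\le\|P\|_{Y\to Y}\,\|a\|_{M(X,Y)}.$$ -/

import Mathlib

open MeasureTheory Filter Topology
open scoped ENNReal ComplexOrder ComplexConjugate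

noncomputable section

namespace BrownHalmos

instance factTwoPiPos : Fact (0 < 2 * Real.pi) := ⟨Real.two_pi_pos⟩

/-- The unit circle, parametrised by the angle `θ ∈ ℝ / 2πℤ`; the point is `t = e^{iθ}`. -/
abbrev 𝕋 : Type := AddCircle (2 * Real.pi)

/-- Normalised Lebesgue measure `|dt| / 2π` on the circle. -/
abbrev m : Measure 𝕋 := AddCircle.haarAddCircle

/-- Complex measurable functions on the circle modulo equality almost everywhere. -/
abbrev L0 : Type := 𝕋 →ₘ[m] ℂ

/-! ### Banach function spaces -/

/-- A normed space `X ⊆ L⁰`, encoded by its norm extended by `∞` outside of `X`;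
thus `X = {f | nrm f < ∞}`. -/
structure FunctionSpace where
  nrm : L0 → ℝ≥0∞
  nrm_add_le : ∀ f g, nrm (f + g) ≤ nrm f + nrm g
  nrm_smul : ∀ (c : ℂ) f, nrm (c • f) = ‖c‖ₑ * nrm f
  eq_zero_of_nrm : ∀ f, nrm f = 0 → f = 0

namespace FunctionSpace

variable (X Y : FunctionSpace)

theorem nrm_zero : X.nrm 0 = 0 := by
  have h := X.nrm_smul 0 0
  have h0 : (0 : ℂ) • (0 : L0) = 0 := zero_smul ℂ (0 : L0)
  rwa [h0, enorm_zero, zero_mul] at h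

/-- The underlying linear subspace of `L⁰`. -/
def space : Submodule ℂ L0 where
  carrier := {f | X.nrm f < ∞}
  add_mem' {f g} hf hg := (X.nrm_add_le f g).trans_lt (ENNReal.add_lt_top.2 ⟨hf, hg⟩)
  zero_mem' := by simp [X.nrm_zero]
  smul_mem' c f hf := by
    simpa [X.nrm_smul] using ENNReal.mul_lt_top enorm_lt_top hf

instance instNorm : Norm X.space := ⟨fun f => (X.nrm f).toReal⟩

theorem normedSpaceCore : NormedSpace.Core ℂ X.space where
  norm_nonneg _ := ENNReal.toReal_nonneg
  norm_smul c f := by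
    change (X.nrm (c • (f : L0))).toReal = ‖c‖ * (X.nrm f).toReal
    simp [X.nrm_smul, ENNReal.toReal_mul]
  norm_triangle f g := by
    have hf : X.nrm f < ∞ := f.2
    have hg : X.nrm g < ∞ := g.2
    change (X.nrm (f + g : L0)).toReal ≤ (X.nrm f).toReal + (X.nrm g).toReal
    rw [← ENNReal.toReal_add hf.ne hg.ne]
    exact ENNReal.toReal_mono (ENNReal.add_lt_top.2 ⟨hf, hg⟩).ne (X.nrm_add_le _ _)
  norm_eq_zero_iff f := by
    have hf : X.nrm f < ∞ := f.2
    change (X.nrm f).toReal = 0 ↔ f = 0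
    rw [ENNReal.toReal_eq_zero_iff]
    constructor
    · rintro (h | h)
      · exact Subtype.ext (X.eq_zero_of_nrm _ h)
      · exact absurd h hf.ne
    · rintro rfl
      exact Or.inl X.nrm_zero

instance instNormedAddCommGroup : NormedAddCommGroup X.space :=
  NormedAddCommGroup.ofCore X.normedSpaceCore

instance instNormedSpace : NormedSpace ℂ X.space :=
  NormedSpace.ofCore X.normedSpaceCore

end FunctionSpace

/-- `0 ≤ fₙ ↑ g` almost everywhere. -/
def IncreasesTo (f : ℕ → L0) (g : L0) : Prop :=
  ∀ᵐ t ∂m, (∀ n, 0 ≤ f n t) ∧ Monotone (fun n => f n t) ∧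
    Tendsto (fun n => f n t) atTop (𝓝 (g t))

/-- Banach function spaces: complete, with the ideal property, containing `L^∞`, and with the
semi-Fatou property. -/
structure IsBanachFunctionSpace (X : FunctionSpace) : Prop where
  complete : CompleteSpace X.space
  ideal : ∀ f g : L0, f ∈ X.space → (∀ᵐ t ∂m, ‖g t‖ ≤ ‖f t‖) →
    g ∈ X.space ∧ X.nrm g ≤ X.nrm f
  linfty_subset : ∀ f : L0, (∃ C : ℝ, ∀ᵐ t ∂m, ‖f t‖ ≤ C) → f ∈ X.space
  semiFatou : ∀ (f : ℕ → L0) (g : L0), (∀ n, f n ∈ X.space) → g ∈ X.space →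
    IncreasesTo f g → X.nrm g = ⨆ n, X.nrm (f n)

/-- The Fatou property. -/
def HasFatouProperty (X : FunctionSpace) : Prop :=
  ∀ (f : ℕ → L0) (g : L0), (∀ n, f n ∈ X.space) → IncreasesTo f g →
    (⨆ n, X.nrm (f n)) < ∞ → g ∈ X.space ∧ X.nrm g = ⨆ n, X.nrm (f n)

/-- The distribution function of `|f|`. -/
def distribution (f : L0) (r : ℝ) : ℝ≥0∞ := m {t | r < ‖f t‖}

def Equimeasurable (f g : L0) : Prop := ∀ r : ℝ, 0 ≤ r → distribution f r = distribution g r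

def IsRearrangementInvariant (X : FunctionSpace) : Prop :=
  ∀ f g : L0, Equimeasurable f g → f ∈ X.space → g ∈ X.space ∧ X.nrm f = X.nrm g

/-! ### Boyd indices -/

/-- The angle in `[0, 2π)` of a point of the circle. -/
def angle (t : 𝕋) : ℝ := AddCircle.equivIco (2 * Real.pi) 0 t

theorem measurable_angle : Measurable angle :=
  measurable_subtype_coe.comp (AddCircle.measurableEquivIco (2 * Real.pi) 0).measurable

open Classical in
/-- `(D_s f)(e^{iθ}) = f(e^{isθ})` if `sθ ∈ [0, 2π)`, and `0` otherwise (`θ ∈ [0, 2π)`). -/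
def dilationFun (s : ℝ) (f : 𝕋 → ℂ) (t : 𝕋) : ℂ :=
  if s * angle t ∈ Set.Ico 0 (2 * Real.pi) then f ((s * angle t : ℝ) : 𝕋) else 0

theorem measurable_dilationFun (s : ℝ) {f : 𝕋 → ℂ} (hf : Measurable f) :
    Measurable (dilationFun s f) := by
  have h : Measurable fun t : 𝕋 => s * angle t := measurable_angle.const_mul s
  exact Measurable.ite (h measurableSet_Ico)
    (hf.comp ((AddCircle.measurable_mk' (a := 2 * Real.pi)).comp h)) measurable_const

/-- The dilation operator `D_s`. -/
def dilation (s : ℝ) (f : L0) : L0 :=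
  AEEqFun.mk (dilationFun s f)
    (measurable_dilationFun s f.stronglyMeasurable.measurable).aestronglyMeasurable

/-- The operator norm of `D_s` on `X`. -/
def dilationNorm (X : FunctionSpace) (s : ℝ) : ℝ≥0∞ :=
  ⨆ (f : L0) (_ : X.nrm f ≤ 1), X.nrm (dilation s f)

def HasLowerBoydIndex (X : FunctionSpace) (α : ℝ) : Prop :=
  Tendsto (fun s : ℝ => Real.log (dilationNorm X (1 / s)).toReal / Real.log s) (𝓝[>] 0) (𝓝 α)

def HasUpperBoydIndex (X : FunctionSpace) (β : ℝ) : Prop :=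
  Tendsto (fun s : ℝ => Real.log (dilationNorm X (1 / s)).toReal / Real.log s) atTop (𝓝 β)

def HasNontrivialBoydIndices (X : FunctionSpace) : Prop :=
  ∃ α ∈ Set.Ioo (0 : ℝ) 1, ∃ β ∈ Set.Ioo (0 : ℝ) 1,
    HasLowerBoydIndex X α ∧ HasUpperBoydIndex X β

/-! ### Multipliers -/

/-- The pointwise multipliers from `X` to `Y`. -/
def multipliers (X Y : FunctionSpace) : Set L0 := {a | ∀ g ∈ X.space, a * g ∈ Y.space}

/-- The norm of the multiplier space `M(X, Y)`. -/
def multiplierNorm (X Y : FunctionSpace) (a : L0) : ℝ≥0∞ :=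
  ⨆ (g : L0) (_ : X.nrm g ≤ 1), Y.nrm (a * g)

/-! ### Fourier coefficients, Hardy spaces, Riesz projection, Toeplitz operators -/

/-- `⟨f, g⟩ = ∫ f ḡ dm`. -/
def pairing (f g : L0) : ℂ := ∫ t, f t * conj (g t) ∂m

/-- The function `t ↦ tⁿ` on the circle. -/
def χ (n : ℤ) : L0 := (fourier n : C(𝕋, ℂ)).toAEEqFun m

/-- The Hardy space `H[X]` of integrable functions in `X` with vanishing negative Fourier
coefficients, normed as a subspace of `X`. -/
def hardy (X : FunctionSpace) : Submodule ℂ X.space where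
  carrier := {f | Integrable (f : L0) m ∧ ∀ n : ℤ, n < 0 → fourierCoeff (f : L0) n = 0}
  add_mem' {f g} hf hg := by
    have h : ((f + g : X.space) : L0) =ᵐ[m] ((f : L0) : 𝕋 → ℂ) + ((g : L0) : 𝕋 → ℂ) :=
      AEEqFun.coeFn_add _ _
    refine ⟨(hf.1.add hg.1).congr h.symm, fun n hn => ?_⟩
    rw [fourierCoeff_congr_ae h, fourierCoeff.add hf.1 hg.1]
    simp [hf.2 n hn, hg.2 n hn]
  zero_mem' := by
    have h : ((0 : X.space) : L0) =ᵐ[m] (0 : 𝕋 → ℂ) := AEEqFun.coeFn_zero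
    refine ⟨(integrable_zero _ _ _).congr h.symm, fun n hn => ?_⟩
    rw [fourierCoeff_congr_ae h]
    simp [fourierCoeff]
  smul_mem' c f hf := by
    have h : ((c • f : X.space) : L0) =ᵐ[m] c • ((f : L0) : 𝕋 → ℂ) := AEEqFun.coeFn_smul _ _
    refine ⟨(hf.1.smul c).congr h.symm, fun n hn => ?_⟩
    rw [fourierCoeff_congr_ae h, fourierCoeff.const_smul, hf.2 n hn, smul_zero]

theorem coeFn_χ (n : ℤ) : (χ n : 𝕋 → ℂ) =ᵐ[m] fourier n :=
  ContinuousMap.coeFn_toAEEqFun m _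

theorem χ_mem_space {X : FunctionSpace} (hX : IsBanachFunctionSpace X) (n : ℤ) :
    χ n ∈ X.space := by
  refine hX.linfty_subset _ ⟨1, ?_⟩
  filter_upwards [coeFn_χ n] with t ht
  rw [ht, fourier_apply, Circle.norm_coe]

theorem χ_mem_hardy {X : FunctionSpace} (hX : IsBanachFunctionSpace X) (j : ℕ) :
    (⟨χ j, χ_mem_space hX j⟩ : X.space) ∈ hardy X := by
  refine ⟨?_, fun n hn => ?_⟩
  · exact ((fourier (j : ℤ) : C(𝕋, ℂ)).continuous.integrable_of_hasCompactSupport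
      (HasCompactSupport.of_compactSpace _)).congr (coeFn_χ j).symm
  · have hne : -n + (j : ℤ) ≠ 0 := by omega
    rw [fourierCoeff_congr_ae (coeFn_χ j)]
    simp only [fourierCoeff, smul_eq_mul, ← fourier_add]
    exact integral_eq_zero_of_add_right_eq_neg (μ := m)
      (fourier_add_half_inv_index hne Real.two_pi_pos)

/-- The element `χ_j` of `H[X]`, for `j ≥ 0`. -/
def hardyχ {X : FunctionSpace} (hX : IsBanachFunctionSpace X) (j : ℕ) : hardy X :=
  ⟨⟨χ j, χ_mem_space hX j⟩, χ_mem_hardy hX j⟩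

/-- `h` is the Riesz projection of `f`, that is, `∑ f̂(n) tⁿ ↦ ∑_{n ≥ 0} f̂(n) tⁿ`. -/
def IsRieszProjectionOf (f h : L0) : Prop :=
  Integrable f m ∧ Integrable h m ∧
    ∀ n : ℤ, fourierCoeff h n = if 0 ≤ n then fourierCoeff f n else 0

/-- The bounded operator `P` is the Riesz projection on `Y`. -/
def IsRieszProjection {Y : FunctionSpace} (P : Y.space →L[ℂ] Y.space) : Prop :=
  ∀ f : Y.space, IsRieszProjectionOf f (P f)

/-- `A = T_a`, that is, `A f = P (a f)` for all `f ∈ H[X]`. -/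
def IsToeplitz {X Y : FunctionSpace} (a : L0) (A : hardy X →L[ℂ] hardy Y) : Prop :=
  ∀ f : hardy X, IsRieszProjectionOf (a * ((f : X.space) : L0)) ((A f : Y.space) : L0)

end BrownHalmos

end

/-! A Toeplitz matrix is a corner of a Laurent matrix, and moving the corner away recovers the
whole. For a trigonometric polynomial `f` the product `χₙ f` is analytic once `n` is large. The
functions `χ₋ₙ A(χₙ f)` have norm at most `‖A‖ ‖f‖`, because unimodular factors do not change the
norm, and each of their Fourier coefficients is eventually `∑ⱼ f̂(j) a_{k-j}`. A limit `g ∈ Y` with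
these coefficients and `‖g‖ ≤ ‖A‖ ‖f‖` therefore exists (`exists_laurent`). The choice `f = 1` gives
the symbol `a`; uniqueness of Fourier coefficients gives `g = a f`; density of trigonometric
polynomials in `X` and the Fatou property of `Y` give `‖a‖ ≤ ‖A‖` in `M(X, Y)` (`exists_symbol`).
Applied to `A = T_a` this is the lower norm estimate; the upper one is `T_a = P ∘ M_a`, where `M_a`
is bounded by the closed graph theorem.

The limit comes from `exists_of_bounded_fourierCoeff`. Nontrivial Boyd indices embed `Y` in weak
`Lʳ` for some `r > 1`, so bounded sets of `Y` are uniformly integrable. Truncations then have weak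
limits in `L²`, these limits are Cauchy in `L¹` as the truncation level grows, and the Fatou
property keeps the norm bound.

That `A` equals `T_a` once they agree on every `χⱼ` is `eq_zero_of_hardyχ`. For a functional `φ` on
`X` and `f ∈ X`, the function `s ↦ φ(f(· + s))` is continuous with coefficients `f̂(n) φ(χₙ)`; if
`f` is analytic and `φ` kills all `χⱼ` with `j ≥ 0`, it vanishes identically.

Boundedness of `P` on `Y` is Boyd's interpolation argument. M. Riesz's theorem for exponent `2k`
follows from the mean value property of `p^{2k}` for an analytic polynomial `p`, and duality gives a
weak type estimate for the conjugate exponent. Splitting `f` at the height `f*(x)` bounds `(Pf)*(x)`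
by a series of dilates of `f*`, and the Boyd indices make the norms of its terms geometric
(`exists_fnrm_analyticPart_le`).

Separability enters through order continuity of the norm (`tendsto_fnrm_indicator`), which yields
dominated convergence and density of trigonometric polynomials. -/

noncomputable section

namespace BrownHalmos

/-! ### The norm of a function space on functions -/

namespace FunctionSpace

open Classical in
/-- The extended norm of a function, `∞` if the function is not measurable. -/
def fnrm (X : FunctionSpace) (f : 𝕋 → ℂ) : ℝ≥0∞ :=
  if h : AEStronglyMeasurable f m then X.nrm (AEEqFun.mk f h) else ∞

variable {X : FunctionSpace}

theorem fnrm_eq {f : 𝕋 → ℂ} (h : AEStronglyMeasurable f m) :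
    X.fnrm f = X.nrm (AEEqFun.mk f h) := dif_pos h

theorem fnrm_coe (f : L0) : X.fnrm f = X.nrm f := by
  rw [fnrm_eq f.aestronglyMeasurable, AEEqFun.mk_coeFn]

theorem fnrm_congr {f g : 𝕋 → ℂ} (h : f =ᵐ[m] g) : X.fnrm f = X.fnrm g := by
  by_cases hf : AEStronglyMeasurable f m
  · have hg := hf.congr h
    rw [fnrm_eq hf, fnrm_eq hg, AEEqFun.mk_eq_mk.2 h]
  · have hg : ¬ AEStronglyMeasurable g m := fun hg => hf (hg.congr h.symm)
    simp [fnrm, hf, hg]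

theorem aestronglyMeasurable_of_fnrm_lt_top {f : 𝕋 → ℂ} (h : X.fnrm f < ∞) :
    AEStronglyMeasurable f m := by
  by_contra hf
  simp [fnrm, hf] at h

theorem mem_space_iff {f : L0} : f ∈ X.space ↔ X.nrm f < ∞ := Iff.rfl

theorem fnrm_add_le (f g : 𝕋 → ℂ) : X.fnrm (f + g) ≤ X.fnrm f + X.fnrm g := by
  by_cases hf : AEStronglyMeasurable f m
  · by_cases hg : AEStronglyMeasurable g m
    · rw [fnrm_eq hf, fnrm_eq hg, fnrm_eq (hf.add hg), ← AEEqFun.mk_add_mk]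
      exact X.nrm_add_le _ _
    · simp [fnrm, hg]
  · simp [fnrm, hf]

theorem fnrm_const_mul (c : ℂ) {f : 𝕋 → ℂ} (hf : AEStronglyMeasurable f m) :
    X.fnrm (fun t => c * f t) = ‖c‖ₑ * X.fnrm f := by
  have h : AEStronglyMeasurable (c • f) m := hf.const_smul c
  change X.fnrm (c • f) = _
  rw [fnrm_eq hf, fnrm_eq h, ← X.nrm_smul, AEEqFun.smul_mk]

theorem fnrm_zero : X.fnrm (fun _ => 0) = 0 := by
  have := fnrm_const_mul (X := X) 0 (f := fun _ => 0) aestronglyMeasurable_const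
  simpa using this

theorem ae_eq_zero_of_fnrm {f : 𝕋 → ℂ} (h : X.fnrm f = 0) : f =ᵐ[m] 0 := by
  have hf : AEStronglyMeasurable f m := aestronglyMeasurable_of_fnrm_lt_top (h ▸ ENNReal.zero_lt_top)
  rw [fnrm_eq hf] at h
  have := X.eq_zero_of_nrm _ h
  rw [AEEqFun.zero_def, AEEqFun.mk_eq_mk] at this
  exact this

end FunctionSpace

open FunctionSpace

variable {X Y : FunctionSpace}

theorem IsBanachFunctionSpace.fnrm_mono (hX : IsBanachFunctionSpace X) {f g : 𝕋 → ℂ}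
    (hg : AEStronglyMeasurable g m) (h : ∀ᵐ t ∂m, ‖g t‖ ≤ ‖f t‖) : X.fnrm g ≤ X.fnrm f := by
  rcases eq_or_ne (X.fnrm f) ∞ with h' | h'
  · simp [h']
  have hf := aestronglyMeasurable_of_fnrm_lt_top (lt_top_iff_ne_top.2 h')
  rw [fnrm_eq hf] at h' ⊢
  rw [fnrm_eq hg]
  refine (hX.ideal _ _ (lt_top_iff_ne_top.2 h') ?_).2
  filter_upwards [h, AEEqFun.coeFn_mk f hf, AEEqFun.coeFn_mk g hg] with t h1 h2 h3
  rwa [h2, h3]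

theorem IsBanachFunctionSpace.fnrm_congr_norm (hX : IsBanachFunctionSpace X) {f g : 𝕋 → ℂ}
    (hf : AEStronglyMeasurable f m)
    (hg : AEStronglyMeasurable g m) (h : ∀ᵐ t ∂m, ‖g t‖ = ‖f t‖) : X.fnrm g = X.fnrm f :=
  le_antisymm (hX.fnrm_mono hg (h.mono fun _ h => h.le))
    (hX.fnrm_mono hf (h.mono fun _ h => h.ge))

theorem IsBanachFunctionSpace.fnrm_bounded (hX : IsBanachFunctionSpace X) {f : 𝕋 → ℂ}
    (hf : AEStronglyMeasurable f m) {C : ℝ} (hC : ∀ᵐ t ∂m, ‖f t‖ ≤ C) : X.fnrm f < ∞ := by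
  rw [fnrm_eq hf]
  refine hX.linfty_subset _ ⟨C, ?_⟩
  filter_upwards [hC, AEEqFun.coeFn_mk f hf] with t h1 h2
  rwa [h2]

theorem IsBanachFunctionSpace.fnrm_one_lt_top (hX : IsBanachFunctionSpace X) :
    X.fnrm (fun _ => 1) < ∞ :=
  hX.fnrm_bounded aestronglyMeasurable_const (C := 1) (by simp)

theorem IsBanachFunctionSpace.fnrm_le_of_bound (hX : IsBanachFunctionSpace X) {f : 𝕋 → ℂ}
    (hf : AEStronglyMeasurable f m) {C : ℝ} (hC : ∀ᵐ t ∂m, ‖f t‖ ≤ C) :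
    X.fnrm f ≤ ENNReal.ofReal C * X.fnrm (fun _ => 1) := by
  have h : X.fnrm f ≤ X.fnrm (fun _ => (C : ℂ) * 1) := by
    refine hX.fnrm_mono hf (hC.mono fun t ht => ht.trans ?_)
    simpa using le_abs_self C
  have hC0 : 0 ≤ C := by
    obtain ⟨t, ht⟩ := hC.exists
    exact (norm_nonneg _).trans ht
  rw [fnrm_const_mul (C : ℂ) aestronglyMeasurable_const] at h
  have hC1 : ‖(C : ℂ)‖ₑ = ENNReal.ofReal C := by
    rw [← ofReal_norm]; simp [abs_of_nonneg hC0]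
  rwa [hC1] at h

/-- The functions `min (v k) |g|` are finite and increase to `|g|`, so the monotone limit axiom
applies to them. The Fatou property is needed only when `g` is not already known to lie in `X`. This
is the only place where either axiom is used; Fatou's lemma and countable subadditivity below are
special choices of `v`. -/
theorem fnrm_le_of_iSup (hX : IsBanachFunctionSpace X) {g : 𝕋 → ℂ}
    (hg : AEStronglyMeasurable g m) (hF : HasFatouProperty X ∨ X.fnrm g < ∞)
    {v : ℕ → 𝕋 → ℝ≥0∞} (hv : ∀ k, AEMeasurable (v k) m)
    (hmono : ∀ᵐ t ∂m, Monotone fun k => v k t) (hsup : ∀ᵐ t ∂m, ‖g t‖ₑ ≤ ⨆ k, v k t)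
    {K : ℝ≥0∞}
    (hK : ∀ k, ∀ w : 𝕋 → ℂ, AEStronglyMeasurable w m → (∀ᵐ t ∂m, ‖w t‖ₑ ≤ v k t) →
      X.fnrm w ≤ K) : X.fnrm g ≤ K := by
  rcases eq_or_ne K ∞ with rfl | hKtop
  · exact le_top
  let u : ℕ → 𝕋 → ℝ := fun k t => (min (v k t) ‖g t‖ₑ).toReal
  have hu : ∀ k, AEStronglyMeasurable (fun t => (u k t : ℂ)) m := fun k =>
    (Complex.measurable_ofReal.comp_aemeasurable
      ((hv k).min hg.enorm).ennreal_toReal).aestronglyMeasurable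
  have hgn : AEStronglyMeasurable (fun t => (‖g t‖ : ℂ)) m :=
    (Complex.measurable_ofReal.comp_aemeasurable hg.norm.aemeasurable).aestronglyMeasurable
  have htop : ∀ k t, min (v k t) ‖g t‖ₑ ≠ ∞ := fun k t =>
    ((min_le_right _ _).trans_lt enorm_lt_top).ne
  have huK : ∀ k, X.fnrm (fun t => (u k t : ℂ)) ≤ K := by
    refine fun k => hK k _ (hu k) (Eventually.of_forall fun t => ?_)
    rw [← ofReal_norm, Complex.norm_real, Real.norm_of_nonneg ENNReal.toReal_nonneg,
      ENNReal.ofReal_toReal (htop k t)]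
    exact min_le_left _ _
  have hinc : IncreasesTo (fun k => AEEqFun.mk _ (hu k)) (AEEqFun.mk _ hgn) := by
    have h1 : ∀ᵐ t ∂m, ∀ k, AEEqFun.mk _ (hu k) t = (u k t : ℂ) :=
      ae_all_iff.2 fun k => AEEqFun.coeFn_mk _ (hu k)
    filter_upwards [h1, AEEqFun.coeFn_mk _ hgn, hmono, hsup] with t h1 h2 h3 h4
    simp only [h1, h2]
    refine ⟨fun n => ?_, fun i j hij => ?_, ?_⟩
    · exact Complex.zero_le_real.2 ENNReal.toReal_nonneg
    · exact Complex.real_le_real.2 (ENNReal.toReal_mono (htop j t) (min_le_min_right _ (h3 hij)))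
    · refine (Complex.continuous_ofReal.tendsto _).comp ?_
      have h5 : Tendsto (fun k => min (v k t) ‖g t‖ₑ) atTop (𝓝 ‖g t‖ₑ) := by
        have := (tendsto_atTop_iSup h3).min (tendsto_const_nhds (x := ‖g t‖ₑ))
        rwa [min_eq_right h4] at this
      have := (ENNReal.tendsto_toReal (enorm_ne_top (x := g t))).comp h5
      simpa [u, Function.comp_def] using this
  have hmem : ∀ k, AEEqFun.mk _ (hu k) ∈ X.space := fun k => by
    rw [mem_space_iff, ← fnrm_eq]; exact (huK k).trans_lt (lt_top_iff_ne_top.2 hKtop)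
  have hle : (⨆ k, X.nrm (AEEqFun.mk _ (hu k))) ≤ K := iSup_le fun k => by
    rw [← fnrm_eq]; exact huK k
  have hgg : X.fnrm (fun t => (‖g t‖ : ℂ)) = X.fnrm g :=
    hX.fnrm_congr_norm hg hgn (Eventually.of_forall fun t => by simp)
  rw [← hgg, fnrm_eq hgn]
  rcases hF with hF | hF
  · rw [(hF _ _ hmem hinc (hle.trans_lt (lt_top_iff_ne_top.2 hKtop))).2]
    exact hle
  · rw [hX.semiFatou _ _ hmem (by rwa [mem_space_iff, ← fnrm_eq hgn, hgg]) hinc]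
    exact hle

theorem fnrm_le_of_liminf (hX : IsBanachFunctionSpace X) (hF : HasFatouProperty X) {g : 𝕋 → ℂ}
    (hg : AEStronglyMeasurable g m) {f : ℕ → 𝕋 → ℂ} (hf : ∀ n, AEStronglyMeasurable (f n) m)
    (hlim : ∀ᵐ t ∂m, Tendsto (fun n => f n t) atTop (𝓝 (g t))) {K : ℝ≥0∞}
    (hK : ∀ n, X.fnrm (f n) ≤ K) : X.fnrm g ≤ K := by
  -- As in the classical Fatou lemma, the tail infima increase to the limit, and the `k`-th one is
  -- dominated by `f k`.
  refine fnrm_le_of_iSup hX hg (Or.inl hF) (v := fun k t => ⨅ n ≥ k, ‖f n t‖ₑ)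
    (fun k => ?_) ?_ ?_ fun k w hw hwk => ?_
  · exact AEMeasurable.biInf _ (Set.to_countable _) fun n _ => (hf n).enorm
  · exact Eventually.of_forall fun t i j hij =>
      le_iInf₂ fun n hn => iInf₂_le n (hij.trans hn)
  · filter_upwards [hlim] with t ht
    rw [← liminf_eq_iSup_iInf_of_nat]
    exact ht.enorm.liminf_eq.ge
  · refine (hX.fnrm_mono hw (f := f k) (hwk.mono fun t ht => ?_)).trans (hK k)
    exact enorm_le_iff_norm_le.1 (ht.trans (iInf₂_le k le_rfl))

theorem fnrm_sum_norm_le (hX : IsBanachFunctionSpace X) {f : ℕ → 𝕋 → ℂ}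
    (hf : ∀ n, AEStronglyMeasurable (f n) m) (k : ℕ) :
    X.fnrm (fun t => ((∑ j ∈ Finset.range k, ‖f j t‖ : ℝ) : ℂ)) ≤
      ∑ j ∈ Finset.range k, X.fnrm (f j) := by
  induction k with
  | zero => simpa using fnrm_zero.le
  | succ k ih =>
    rw [Finset.sum_range_succ]
    have hk : X.fnrm (fun t => (‖f k t‖ : ℂ)) = X.fnrm (f k) :=
      hX.fnrm_congr_norm (hf k) (Complex.measurable_ofReal.comp_aemeasurable
        (hf k).norm.aemeasurable).aestronglyMeasurable (Eventually.of_forall fun t => by simp)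
    rw [← hk]
    refine le_trans (le_of_eq ?_) ((fnrm_add_le _ _).trans (add_le_add_left ih _))
    congr 1
    ext t
    simp [Finset.sum_range_succ]

theorem fnrm_le_tsum (hX : IsBanachFunctionSpace X) (hF : HasFatouProperty X) {g : 𝕋 → ℂ}
    (hg : AEStronglyMeasurable g m) {f : ℕ → 𝕋 → ℂ} (hf : ∀ n, AEStronglyMeasurable (f n) m)
    (hle : ∀ᵐ t ∂m, ‖g t‖ₑ ≤ ∑' n, ‖f n t‖ₑ) : X.fnrm g ≤ ∑' n, X.fnrm (f n) := by
  refine fnrm_le_of_iSup hX hg (Or.inl hF) (v := fun k t => ∑ j ∈ Finset.range k, ‖f j t‖ₑ)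
    (fun k => ?_) ?_ ?_ fun k w hw hwk => ?_
  · exact Finset.aemeasurable_fun_sum _ fun n _ => (hf n).enorm
  · exact Eventually.of_forall fun t i j hij =>
      Finset.sum_le_sum_of_subset (Finset.range_mono hij)
  · filter_upwards [hle] with t ht
    rwa [ENNReal.tsum_eq_iSup_nat] at ht
  · refine le_trans ?_ ((fnrm_sum_norm_le hX hf k).trans (ENNReal.sum_le_tsum _))
    refine hX.fnrm_mono hw (hwk.mono fun t ht => ?_)
    rw [← enorm_le_iff_norm_le]
    refine ht.trans (le_of_eq ?_)
    rw [← ofReal_norm, Complex.norm_real, Real.norm_of_nonneg (by positivity),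
      ENNReal.ofReal_sum_of_nonneg (fun _ _ => norm_nonneg _)]
    simp

/-! ### Elements of the space defined by functions -/

/-- The element of `X` defined by a function of finite norm. -/
def FunctionSpace.toSpace (X : FunctionSpace) (f : 𝕋 → ℂ) (h : X.fnrm f < ∞) : X.space :=
  ⟨AEEqFun.mk f (aestronglyMeasurable_of_fnrm_lt_top h), by
    rw [mem_space_iff, ← fnrm_eq]; exact h⟩

theorem coeFn_toSpace {f : 𝕋 → ℂ} (h : X.fnrm f < ∞) :
    ((X.toSpace f h : L0) : 𝕋 → ℂ) =ᵐ[m] f := AEEqFun.coeFn_mk _ _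

theorem FunctionSpace.norm_def (f : X.space) : ‖f‖ = (X.nrm f).toReal := rfl

theorem FunctionSpace.enorm_def (f : X.space) : ‖f‖ₑ = X.nrm f := by
  rw [← ofReal_norm, norm_def, ENNReal.ofReal_toReal (ne_of_lt f.2)]

theorem FunctionSpace.enorm_eq_fnrm (f : X.space) {g : 𝕋 → ℂ}
    (h : ((f : L0) : 𝕋 → ℂ) =ᵐ[m] g) : ‖f‖ₑ = X.fnrm g := by
  rw [enorm_def, ← fnrm_coe, fnrm_congr h]

theorem FunctionSpace.enorm_toSpace {f : 𝕋 → ℂ} (h : X.fnrm f < ∞) :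
    ‖X.toSpace f h‖ₑ = X.fnrm f := enorm_eq_fnrm _ (coeFn_toSpace h)

theorem FunctionSpace.coeFn_sub (f g : X.space) :
    (((f - g : X.space) : L0) : 𝕋 → ℂ) =ᵐ[m] ((f : L0) : 𝕋 → ℂ) - ((g : L0) : 𝕋 → ℂ) :=
  AEEqFun.coeFn_sub _ _

theorem FunctionSpace.fnrm_lt_top_coe (f : X.space) : X.fnrm (f : L0) < ∞ := by
  rw [fnrm_coe]; exact f.2

theorem FunctionSpace.edist_toSpace {f g : 𝕋 → ℂ} (hf : X.fnrm f < ∞) (hg : X.fnrm g < ∞) :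
    edist (X.toSpace f hf) (X.toSpace g hg) = X.fnrm (fun t => f t - g t) := by
  rw [edist_eq_enorm_sub]
  refine enorm_eq_fnrm _ ((coeFn_sub _ _).trans ?_)
  filter_upwards [coeFn_toSpace hf, coeFn_toSpace hg] with t h1 h2
  simp [h1, h2]

/-! ### Separable spaces: dominated convergence -/

/-- As `l` grows, `f` restricted to `E n \ E l` increases in modulus to `f` restricted to `E n`, so
by the semi-Fatou property the norm already exceeds `δ` at some finite `l`. -/
theorem exists_lt_fnrm_indicator_diff (hX : IsBanachFunctionSpace X) {f : 𝕋 → ℂ}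
    (hf : X.fnrm f < ∞) {E : ℕ → Set 𝕋} (hE : ∀ n, NullMeasurableSet (E n) m)
    (hanti : Antitone E) (hnull : m (⋂ n, E n) = 0) {δ : ℝ≥0∞} (n : ℕ)
    (hδ : δ < X.fnrm ((E n).indicator f)) :
    ∃ l, n < l ∧ δ < X.fnrm ((E n \ E l).indicator f) := by
  have hfm := aestronglyMeasurable_of_fnrm_lt_top hf
  by_contra! hcon
  refine hδ.not_ge (fnrm_le_of_iSup hX (hfm.indicator₀ (hE n)) (Or.inr ?_)
    (v := fun l t => ‖(E n \ E l).indicator f t‖ₑ)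
    (fun l => (hfm.indicator₀ ((hE n).diff (hE l))).enorm) (Eventually.of_forall fun t i j hij => ?_)
    ?_ fun l w hw hwl => ?_)
  · exact (hX.fnrm_mono (hfm.indicator₀ (hE n))
      (Eventually.of_forall fun t => norm_indicator_le_norm_self _ _)).trans_lt hf
  · exact enorm_indicator_le_of_subset (Set.sdiff_subset_sdiff_right (hanti hij)) _ _
  · have : ∀ᵐ t ∂m, t ∉ ⋂ n, E n := measure_eq_zero_iff_ae_notMem.1 hnull
    filter_upwards [this] with t ht
    simp only [Set.mem_iInter, not_forall] at ht
    obtain ⟨l, hl⟩ := ht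
    refine le_trans (le_of_eq ?_) (le_iSup _ l)
    by_cases htn : t ∈ E n <;> simp [Set.indicator, htn, hl]
  -- The contradiction hypothesis speaks only of indices beyond `n`; enlarging `l` only enlarges the
  -- difference set.
  · have h1 : X.fnrm ((E n \ E (max l (n + 1))).indicator f) ≤ δ := hcon _ (by simp)
    refine le_trans (hX.fnrm_mono hw (hwl.mono fun t ht => ?_)) h1
    rw [← enorm_le_iff_norm_le]
    exact ht.trans (enorm_indicator_le_of_subset
      (Set.sdiff_subset_sdiff_right (hanti (le_max_left _ _))) _ _)

/-- Order continuity from separability. Otherwise there are disjoint sets `F j` on each of which `f`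
has norm above some `δ > 0`. The restrictions of `f` to the unions of `F j` over `j ∈ S`, for `S ⊆
ℕ`, are then uncountably many points at mutual distance at least `δ`, and the balls of radius `δ /
2` around them are disjoint. -/
theorem tendsto_fnrm_indicator (hX : IsBanachFunctionSpace X)
    (hsep : TopologicalSpace.SeparableSpace X.space) {f : 𝕋 → ℂ}
    (hf : X.fnrm f < ∞) {E : ℕ → Set 𝕋} (hE : ∀ n, NullMeasurableSet (E n) m)
    (hanti : Antitone E) (hnull : m (⋂ n, E n) = 0) :
    Tendsto (fun n => X.fnrm ((E n).indicator f)) atTop (𝓝 0) := by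
  have hfm := aestronglyMeasurable_of_fnrm_lt_top hf
  have hmono : Antitone fun n => X.fnrm ((E n).indicator f) := fun i j hij =>
    hX.fnrm_mono (hfm.indicator₀ (hE j)) (Eventually.of_forall fun t =>
      norm_indicator_le_of_subset (hanti hij) _ _)
  have hlim := tendsto_atTop_iInf hmono
  suffices h : (⨅ n, X.fnrm ((E n).indicator f)) = 0 by rwa [h] at hlim
  by_contra hne
  obtain ⟨δ, hδ0, hδ⟩ := exists_between (pos_iff_ne_zero.2 hne)
  have hlt : ∀ n, δ < X.fnrm ((E n).indicator f) := fun n => hδ.trans_le (iInf_le _ n)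
  choose l hl1 hl2 using fun n =>
    exists_lt_fnrm_indicator_diff hX hf hE hanti hnull n (hlt n)
  let k : ℕ → ℕ := fun j => l^[j] 0
  have hk : ∀ j, k (j + 1) = l (k j) := fun j => Function.iterate_succ_apply' l j 0
  have hkmono : StrictMono k := strictMono_nat_of_lt_succ fun j => by rw [hk]; exact hl1 _
  let F : ℕ → Set 𝕋 := fun j => E (k j) \ E (k (j + 1))
  have hFδ : ∀ j, δ < X.fnrm ((F j).indicator f) := fun j => by
    simp only [F, hk]; exact hl2 (k j)
  have hdisj : ∀ i j t, t ∈ F i → t ∈ F j → i = j := by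
    have key : ∀ i j t, i < j → t ∈ F i → t ∈ F j → False := fun i j t hij hi hj =>
      hi.2 (hanti (hkmono.monotone (Nat.succ_le_of_lt hij)) hj.1)
    intro i j t hi hj
    rcases lt_trichotomy i j with h | h | h
    · exact (key i j t h hi hj).elim
    · exact h
    · exact (key j i t h hj hi).elim
  let U : Set ℕ → Set 𝕋 := fun S => ⋃ j ∈ S, F j
  have hF : ∀ j, NullMeasurableSet (F j) m := fun j => (hE _).diff (hE _)
  have hU : ∀ S, NullMeasurableSet (U S) m := fun S =>
    NullMeasurableSet.biUnion S.to_countable fun j _ => hF j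
  have hUf : ∀ S, X.fnrm ((U S).indicator f) < ∞ := fun S =>
    (hX.fnrm_mono (hfm.indicator₀ (hU S))
      (Eventually.of_forall fun t => norm_indicator_le_norm_self _ _)).trans_lt hf
  have hmemU : ∀ S j t, t ∈ F j → (t ∈ U S ↔ j ∈ S) := by
    intro S j t ht
    simp only [U, Set.mem_iUnion, exists_prop]
    exact ⟨fun ⟨i, hi, hti⟩ => hdisj i j t hti ht ▸ hi, fun h => ⟨j, h, ht⟩⟩
  let x : Set ℕ → X.space := fun S => X.toSpace _ (hUf S)
  have hx : ∀ S S', S ≠ S' → δ ≤ edist (x S) (x S') := by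
    intro S S' hSS
    obtain ⟨j, hj⟩ : ∃ j, ¬ (j ∈ S ↔ j ∈ S') := by
      by_contra! h; exact hSS (Set.ext h)
    rw [edist_toSpace]
    refine (hFδ j).le.trans (hX.fnrm_mono (hfm.indicator₀ (hF j)) (Eventually.of_forall fun t => ?_))
    by_cases ht : t ∈ F j
    · have h1 := hmemU S j t ht
      have h2 := hmemU S' j t ht
      by_cases hS : j ∈ S
      · have hS' : j ∉ S' := fun h => hj ⟨fun _ => h, fun _ => hS⟩
        simp [Set.indicator, ht, h1.2 hS, mt h2.1 hS']
      · have hS' : j ∈ S' := by_contra fun h => hj ⟨fun h' => (hS h').elim, fun h' => (h h').elim⟩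
        simp [Set.indicator, ht, mt h1.1 hS, h2.2 hS']
    · simp [ht]
  have hcount : Countable (Set ℕ) := by
    refine Pairwise.countable_of_isOpen_disjoint (s := fun S => Metric.eball (x S) (δ / 2))
      (fun S S' hSS => ?_) (fun S => Metric.isOpen_eball)
      (fun S => ⟨x S, Metric.mem_eball_self (ENNReal.half_pos hδ0.ne')⟩)
    refine Metric.eball_disjoint ?_
    rw [ENNReal.add_halves]
    exact hx S S' hSS
  obtain ⟨φ, hφ⟩ := exists_injective_nat (Set ℕ)
  exact Function.cantor_injective φ hφ

theorem exists_ofReal_mul_le {K ε : ℝ≥0∞} (hK : K < ∞) (hε : 0 < ε) :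
    ∃ η : ℝ, 0 < η ∧ ENNReal.ofReal η * K ≤ ε := by
  rcases eq_or_ne ε ∞ with rfl | hεt
  · exact ⟨1, one_pos, le_top⟩
  refine ⟨ε.toReal / (K.toReal + 1), div_pos (ENNReal.toReal_pos hε.ne' hεt) (by positivity), ?_⟩
  rw [← ENNReal.ofReal_toReal hK.ne, ← ENNReal.ofReal_mul (by positivity)]
  refine ENNReal.ofReal_le_of_le_toReal ?_
  rw [ENNReal.toReal_ofReal ENNReal.toReal_nonneg, div_mul_eq_mul_div, div_le_iff₀ (by positivity)]
  nlinarith [ENNReal.toReal_nonneg (a := ε), ENNReal.toReal_nonneg (a := K)]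

theorem tendsto_fnrm_of_dominated (hX : IsBanachFunctionSpace X)
    (hsep : TopologicalSpace.SeparableSpace X.space) {f : 𝕋 → ℂ}
    (hf : X.fnrm f < ∞) {h : ℕ → 𝕋 → ℂ} (hh : ∀ n, AEStronglyMeasurable (h n) m)
    (hle : ∀ n, ∀ᵐ t ∂m, ‖h n t‖ ≤ ‖f t‖)
    (hlim : ∀ᵐ t ∂m, Tendsto (fun n => h n t) atTop (𝓝 0)) :
    Tendsto (fun n => X.fnrm (h n)) atTop (𝓝 0) := by
  have hfm := aestronglyMeasurable_of_fnrm_lt_top hf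
  rw [ENNReal.tendsto_nhds_zero]
  intro ε hε
  obtain ⟨η, hη, hηε⟩ := exists_ofReal_mul_le hX.fnrm_one_lt_top (ENNReal.half_pos hε.ne')
  -- An Egorov-type decomposition: `|h n| ≤ η + 1_{E n} |f|`, where `E n` decreases to a null set
  -- because `h n → 0` almost everywhere.
  let E : ℕ → Set 𝕋 := fun k => ⋃ n ≥ k, {t | η < ‖h n t‖}
  have hE : ∀ k, NullMeasurableSet (E k) m := fun k =>
    NullMeasurableSet.biUnion (Set.to_countable _) fun n _ =>
      nullMeasurableSet_lt aemeasurable_const (hh n).norm.aemeasurable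
  have hanti : Antitone E := fun i j hij =>
    Set.biUnion_subset_biUnion_left fun n hn => hij.trans hn
  have hnull : m (⋂ n, E n) = 0 := by
    rw [measure_eq_zero_iff_ae_notMem]
    filter_upwards [hlim] with t ht hmem
    have h1 : ∀ᶠ n in atTop, ‖h n t‖ < η := by
      have := ht.norm; rw [norm_zero] at this
      exact this.eventually (gt_mem_nhds hη)
    obtain ⟨k, hk⟩ := eventually_atTop.1 h1
    have := Set.mem_iInter.1 hmem k
    simp only [E, Set.mem_iUnion, Set.mem_ofPred_eq] at this
    obtain ⟨n, hn, hn'⟩ := this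
    exact (hk n hn).not_gt hn'
  have hlim' := tendsto_fnrm_indicator hX hsep hf hE hanti hnull
  filter_upwards [(ENNReal.tendsto_nhds_zero.1 hlim') (ε / 2) (ENNReal.half_pos hε.ne')] with n hn
  let g : 𝕋 → ℂ := fun t => (‖(E n).indicator f t‖ : ℂ)
  have hg : AEStronglyMeasurable g m :=
    (Complex.measurable_ofReal.comp_aemeasurable
      (hfm.indicator₀ (hE n)).norm.aemeasurable).aestronglyMeasurable
  have hgX : X.fnrm g = X.fnrm ((E n).indicator f) :=
    hX.fnrm_congr_norm (hfm.indicator₀ (hE n)) hg (Eventually.of_forall fun t => by simp [g])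
  calc X.fnrm (h n) ≤ X.fnrm ((fun _ => (η : ℂ)) + g : 𝕋 → ℂ) := by
        refine hX.fnrm_mono (hh n) ?_
        filter_upwards [hle n] with t ht
        have : ‖(((fun _ => (η : ℂ)) + g : 𝕋 → ℂ)) t‖ = η + ‖(E n).indicator f t‖ := by
          simp only [g, Pi.add_apply, ← Complex.ofReal_add, Complex.norm_real]
          exact Real.norm_of_nonneg (by positivity)
        rw [this]
        by_cases htE : t ∈ E n
        · simp only [htE, Set.indicator_of_mem]; linarith
        · have : ¬ η < ‖h n t‖ := fun hc => htE (Set.mem_biUnion (le_refl n) hc)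
          simp only [htE, not_false_eq_true, Set.indicator_of_notMem, norm_zero]; linarith
    _ ≤ X.fnrm (fun _ => (η : ℂ)) + X.fnrm g := fnrm_add_le _ _
    _ ≤ ε / 2 + ε / 2 := by
        refine add_le_add ?_ (hgX ▸ hn)
        refine (hX.fnrm_le_of_bound aestronglyMeasurable_const (C := η) ?_).trans hηε
        exact Eventually.of_forall fun t => by simp [abs_of_pos hη]
    _ = ε := ENNReal.add_halves _

/-! ### Density of trigonometric polynomials -/

theorem exists_continuous_tendsto_ae {f : 𝕋 → ℂ} (hf : AEStronglyMeasurable f m) {M : ℝ}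
    (hM : 0 < M) (hfM : ∀ᵐ t ∂m, ‖f t‖ ≤ M) :
    ∃ g : ℕ → C(𝕋, ℂ), (∀ n t, ‖g n t‖ ≤ M) ∧
      ∀ᵐ t ∂m, Tendsto (fun n => g n t) atTop (𝓝 (f t)) := by
  have hmem : MemLp f 1 m := (MemLp.of_bound hf M hfM)
  choose g hg hg' using fun n : ℕ => hmem.exists_boundedContinuous_eLpNorm_sub_le ENNReal.one_ne_top
    (ε := ((n : ℝ≥0∞) + 1)⁻¹) (by simp)
  have h1 : Tendsto (fun n => eLpNorm ((g n : 𝕋 → ℂ) - f) 1 m) atTop (𝓝 0) := by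
    have h0 : Tendsto (fun n : ℕ => ((n : ℝ≥0∞) + 1)⁻¹) atTop (𝓝 0) := by
      have := (tendsto_add_atTop_iff_nat 1).2 ENNReal.tendsto_inv_nat_nhds_zero
      simpa using this
    refine tendsto_of_tendsto_of_tendsto_of_le_of_le tendsto_const_nhds h0 (fun _ => zero_le) fun n => ?_
    rw [eLpNorm_sub_comm]; exact hg n
  obtain ⟨k, -, hk⟩ := (tendstoInMeasure_of_tendsto_eLpNorm one_ne_zero
    (fun n => (hg' n).1) hf h1).exists_seq_tendsto_ae
  -- The radial retraction onto the disc of radius `M` keeps the approximants bounded by `M` and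
  -- fixes the values of `f`.
  let ρ : ℂ → ℂ := fun z => ((M / max M ‖z‖ : ℝ) : ℂ) * z
  have hpos : ∀ z : ℂ, 0 < max M ‖z‖ := fun z => hM.trans_le (le_max_left _ _)
  have hρ : Continuous ρ :=
    (Complex.continuous_ofReal.comp (continuous_const.div (continuous_const.max continuous_norm)
      fun z => (hpos z).ne')).mul continuous_id
  refine ⟨fun n => ⟨fun t => ρ (g (k n) t), hρ.comp (g (k n)).continuous⟩, fun n t => ?_, ?_⟩
  · simp only [ContinuousMap.coe_mk, ρ, norm_mul, Complex.norm_real]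
    rw [Real.norm_of_nonneg (div_nonneg hM.le (hpos _).le), div_mul_eq_mul_div,
      div_le_iff₀ (hpos _)]
    exact mul_le_mul_of_nonneg_left (le_max_right _ _) hM.le
  · filter_upwards [hk, hfM] with t h1 h2
    have h3 : ρ (f t) = f t := by simp [ρ, max_eq_left h2, hM.ne']
    have := (hρ.tendsto (f t)).comp h1
    rwa [h3] at this

/-- The trigonometric polynomial `∑ cₙ tⁿ`. -/
def trigPoly : (ℤ →₀ ℂ) →ₗ[ℂ] C(𝕋, ℂ) := Finsupp.linearCombination ℂ fourier

@[simp] theorem trigPoly_single (n : ℤ) (a : ℂ) :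
    trigPoly (Finsupp.single n a) = a • fourier n := by
  simp [trigPoly]

theorem exists_norm_sub_trigPoly_lt (g : C(𝕋, ℂ)) {ε : ℝ} (hε : 0 < ε) :
    ∃ c, ‖g - trigPoly c‖ < ε := by
  have h : g ∈ (Submodule.span ℂ (Set.range (@fourier (2 * Real.pi)))).topologicalClosure := by
    rw [span_fourier_closure_eq_top]; trivial
  rw [← SetLike.mem_coe, Submodule.topologicalClosure_coe, Metric.mem_closure_iff] at h
  obtain ⟨p, hp, hd⟩ := h ε hε
  rw [SetLike.mem_coe, ← Finsupp.range_linearCombination] at hp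
  obtain ⟨c, rfl⟩ := hp
  exact ⟨c, by rwa [dist_eq_norm] at hd⟩

theorem aestronglyMeasurable_continuousMap (g : C(𝕋, ℂ)) : AEStronglyMeasurable g m :=
  g.continuous.aestronglyMeasurable

theorem integrable_continuousMap (g : C(𝕋, ℂ)) : Integrable g m :=
  g.continuous.integrable_of_hasCompactSupport (HasCompactSupport.of_compactSpace _)

theorem IsBanachFunctionSpace.fnrm_continuous_lt_top (hX : IsBanachFunctionSpace X) (g : C(𝕋, ℂ)) :
    X.fnrm g < ∞ :=
  hX.fnrm_bounded (aestronglyMeasurable_continuousMap g) (C := ‖g‖)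
    (Eventually.of_forall g.norm_coe_le_norm)

theorem fnrm_sub_le_add (f g h : 𝕋 → ℂ) :
    X.fnrm (fun t => f t - h t) ≤ X.fnrm (fun t => f t - g t) + X.fnrm (fun t => g t - h t) := by
  refine le_trans (le_of_eq ?_) (fnrm_add_le _ _)
  congr 1; ext t; simp

/-- Three approximations, each costing `ε / 3`: truncation of `f` and bounded a.e. approximation by
continuous functions are controlled by dominated convergence, and uniform approximation by
trigonometric polynomials is controlled by the norm of `1`. -/
theorem exists_fnrm_sub_trigPoly_le (hX : IsBanachFunctionSpace X)
    (hsep : TopologicalSpace.SeparableSpace X.space) {f : 𝕋 → ℂ} (hf : X.fnrm f < ∞)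
    {ε : ℝ≥0∞} (hε : 0 < ε) : ∃ c, X.fnrm (fun t => f t - trigPoly c t) ≤ ε := by
  have hfm := aestronglyMeasurable_of_fnrm_lt_top hf
  have hε3 : 0 < ε / 3 := ENNReal.div_pos hε.ne' (by simp)
  let E : ℕ → Set 𝕋 := fun n => {t | ‖f t‖ ≤ n}
  have hE : ∀ n, NullMeasurableSet (E n) m := fun n =>
    nullMeasurableSet_le hfm.norm.aemeasurable aemeasurable_const
  have htrunc : Tendsto (fun n => X.fnrm (fun t => f t - (E n).indicator f t)) atTop (𝓝 0) := by
    refine tendsto_fnrm_of_dominated hX hsep hf (fun n => hfm.sub (hfm.indicator₀ (hE n)))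
      (fun n => Eventually.of_forall fun t => ?_) (Eventually.of_forall fun t => ?_)
    · by_cases ht : t ∈ E n <;> simp [ht]
    · obtain ⟨k, hk⟩ := exists_nat_ge ‖f t‖
      refine tendsto_const_nhds.congr' ?_
      filter_upwards [eventually_ge_atTop k] with n hn
      have : t ∈ E n := hk.trans (by exact_mod_cast hn)
      simp [this]
  obtain ⟨n, hn⟩ := ((ENNReal.tendsto_nhds_zero.1 htrunc) _ hε3).exists
  have hfn := hfm.indicator₀ (hE n)
  have hbd : ∀ t, ‖(E n).indicator f t‖ ≤ n + 1 := fun t => by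
    by_cases ht : t ∈ E n
    · simp only [ht, Set.indicator_of_mem]; exact le_trans ht (by simp)
    · simp [ht]; positivity
  obtain ⟨g, hg, hglim⟩ := exists_continuous_tendsto_ae hfn (M := n + 1) (by positivity)
    (Eventually.of_forall hbd)
  have hcont : Tendsto (fun k => X.fnrm (fun t => (E n).indicator f t - g k t)) atTop (𝓝 0) := by
    refine tendsto_fnrm_of_dominated hX hsep (f := fun _ => ((2 * (n + 1) : ℝ) : ℂ))
      (hX.fnrm_bounded aestronglyMeasurable_const (Eventually.of_forall fun _ => le_rfl))
      (fun k => hfn.sub (aestronglyMeasurable_continuousMap _))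
      (fun k => Eventually.of_forall fun t => ?_) ?_
    · rw [Complex.norm_real, Real.norm_of_nonneg (by positivity)]
      exact (norm_sub_le _ _).trans ((add_le_add (hbd t) (hg k t)).trans_eq (two_mul _).symm)
    · filter_upwards [hglim] with t ht
      simpa using ht.const_sub ((E n).indicator f t)
  obtain ⟨k, hk⟩ := ((ENNReal.tendsto_nhds_zero.1 hcont) _ hε3).exists
  obtain ⟨η, hη, hηε⟩ := exists_ofReal_mul_le hX.fnrm_one_lt_top hε3
  obtain ⟨c, hc⟩ := exists_norm_sub_trigPoly_lt (g k) hη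
  refine ⟨c, ?_⟩
  have h3 : X.fnrm (fun t => g k t - trigPoly c t) ≤ ε / 3 := by
    refine (hX.fnrm_le_of_bound ((aestronglyMeasurable_continuousMap _).sub
      (aestronglyMeasurable_continuousMap _)) (C := η) (Eventually.of_forall fun t => ?_)).trans hηε
    exact ((g k - trigPoly c).norm_coe_le_norm t).trans hc.le
  calc _ ≤ ε / 3 + (ε / 3 + ε / 3) :=
        (fnrm_sub_le_add _ ((E n).indicator f) _).trans (add_le_add hn
          ((fnrm_sub_le_add _ (g k) _).trans (add_le_add hk h3)))
    _ = ε := by rw [← add_assoc, ENNReal.add_thirds]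

/-! ### Uniqueness of Fourier coefficients -/

theorem integral_mul_continuous_eq_zero {f : 𝕋 → ℂ} (hf : Integrable f m)
    (h0 : ∀ n, fourierCoeff f n = 0) (g : C(𝕋, ℂ)) : ∫ t, f t * g t ∂m = 0 := by
  have hfg_int : ∀ g : C(𝕋, ℂ), Integrable (fun t => f t * g t) m := fun g =>
    hf.mul_bdd (c := ‖g‖) (aestronglyMeasurable_continuousMap g)
      (Eventually.of_forall g.norm_coe_le_norm)
  have htp : ∀ c, ∫ t, f t * trigPoly c t ∂m = 0 := by
    intro c
    induction c using Finsupp.induction_linear with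
    | zero => simp
    | add c d hc hd =>
      simp only [map_add, ContinuousMap.add_apply, mul_add]
      rw [integral_add (hfg_int _) (hfg_int _), hc, hd, add_zero]
    | single n a =>
      have := h0 (-n)
      simp only [fourierCoeff, neg_neg, smul_eq_mul] at this
      simp only [trigPoly_single, ContinuousMap.smul_apply, smul_eq_mul]
      have h2 : ∀ t, f t * (a * fourier n t) = a * (fourier n t * f t) := fun t => by ring
      simp_rw [h2, integral_const_mul, this, mul_zero]
  rw [← norm_eq_zero]
  refine le_antisymm (le_of_forall_pos_le_add fun ε hε => ?_) (norm_nonneg _)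
  have hK : 0 < (∫ t, ‖f t‖ ∂m) + 1 := by
    have : 0 ≤ ∫ t, ‖f t‖ ∂m := integral_nonneg fun t => norm_nonneg _
    positivity
  obtain ⟨c, hc⟩ := exists_norm_sub_trigPoly_lt g (div_pos hε hK)
  have h1 : ∫ t, f t * g t ∂m = ∫ t, f t * (g - trigPoly c) t ∂m := by
    simp only [ContinuousMap.sub_apply, mul_sub]
    rw [integral_sub (hfg_int _) (hfg_int _), htp, sub_zero]
  rw [h1, zero_add]
  calc ‖∫ t, f t * (g - trigPoly c) t ∂m‖ ≤ ∫ t, ‖f t‖ * (ε / ((∫ t, ‖f t‖ ∂m) + 1)) ∂m := by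
        refine norm_integral_le_of_norm_le (hf.norm.mul_const _) (Eventually.of_forall fun t => ?_)
        rw [norm_mul]
        exact mul_le_mul_of_nonneg_left (((g - trigPoly c).norm_coe_le_norm t).trans hc.le)
          (norm_nonneg _)
    _ = (∫ t, ‖f t‖ ∂m) * (ε / ((∫ t, ‖f t‖ ∂m) + 1)) := integral_mul_const _ _
    _ ≤ ε := by
        rw [mul_div_assoc', div_le_iff₀ hK]
        nlinarith

/-- By density of trigonometric polynomials, `f` annihilates all continuous functions. Boundedly
approximating its conjugate sign by continuous functions gives `∫ |f| = 0`. Where `f` vanishes the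
sign is `0`, by the convention `0⁻¹ = 0`. -/
theorem ae_eq_zero_of_fourierCoeff {f : 𝕋 → ℂ} (hf : Integrable f m)
    (h0 : ∀ n, fourierCoeff f n = 0) : f =ᵐ[m] 0 := by
  let s : 𝕋 → ℂ := fun t => conj (f t) * ((‖f t‖⁻¹ : ℝ) : ℂ)
  have hs : AEStronglyMeasurable s m :=
    (Complex.continuous_conj.comp_aestronglyMeasurable hf.1).mul
      (Complex.measurable_ofReal.comp_aemeasurable
        hf.1.norm.aemeasurable.inv).aestronglyMeasurable
  have hs1 : ∀ t, ‖s t‖ ≤ 1 := fun t => by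
    simp only [s, norm_mul, RCLike.norm_conj, Complex.norm_real, norm_inv, norm_norm]
    exact mul_inv_le_one
  obtain ⟨g, hg, hglim⟩ := exists_continuous_tendsto_ae hs one_pos (Eventually.of_forall hs1)
  have hlim : Tendsto (fun n => ∫ t, f t * g n t ∂m) atTop (𝓝 (∫ t, f t * s t ∂m)) := by
    refine tendsto_integral_of_dominated_convergence (fun t => ‖f t‖)
      (fun n => hf.1.mul (aestronglyMeasurable_continuousMap _)) hf.norm
      (fun n => Eventually.of_forall fun t => ?_) ?_
    · rw [norm_mul]
      exact mul_le_of_le_one_right (norm_nonneg _) (hg n t)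
    · filter_upwards [hglim] with t ht
      exact ht.const_mul _
  simp only [integral_mul_continuous_eq_zero hf h0] at hlim
  have h1 := tendsto_nhds_unique hlim tendsto_const_nhds
  have h2 : ∀ t, f t * s t = (‖f t‖ : ℂ) := fun t => by
    simp only [s]
    rw [← mul_assoc, Complex.mul_conj, Complex.normSq_eq_norm_sq]
    rcases eq_or_ne ‖f t‖ 0 with h | h
    · simp [h]
    · push_cast; field_simp
  simp_rw [h2] at h1
  rw [integral_complex_ofReal] at h1
  have h3 : ∫ t, ‖f t‖ ∂m = 0 := by exact_mod_cast h1
  rw [integral_eq_zero_iff_of_nonneg (fun t => norm_nonneg _) hf.norm] at h3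
  exact h3.mono fun t ht => norm_eq_zero.1 ht

theorem ae_eq_of_fourierCoeff {f g : 𝕋 → ℂ} (hf : Integrable f m) (hg : Integrable g m)
    (h : ∀ n, fourierCoeff f n = fourierCoeff g n) : f =ᵐ[m] g := by
  have h0 : ∀ n, fourierCoeff (f + (-1 : ℂ) • g) n = 0 := fun n => by
    rw [fourierCoeff.add hf (hg.smul _), Pi.add_apply, fourierCoeff.const_smul, h]; simp
  filter_upwards [ae_eq_zero_of_fourierCoeff (hf.add (hg.smul _)) h0] with t ht
  simpa [add_neg_eq_zero] using ht

/-! ### The normalised angle -/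

/-- The angle divided by `2π`, a point of `[0, 1)`. -/
def unitAngle (t : 𝕋) : ℝ := angle t / (2 * Real.pi)

theorem measurable_unitAngle : Measurable unitAngle := measurable_angle.div_const _

theorem unitAngle_mem (t : 𝕋) : unitAngle t ∈ Set.Ico (0 : ℝ) 1 := by
  have h := (AddCircle.equivIco (2 * Real.pi) 0 t).2
  exact ⟨div_nonneg h.1 Real.two_pi_pos.le,
    (div_lt_one Real.two_pi_pos).2 (h.2.trans_eq (zero_add _))⟩

theorem unitAngle_coe {x : ℝ} (hx : x ∈ Set.Ico 0 (2 * Real.pi)) :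
    unitAngle (x : 𝕋) = x / (2 * Real.pi) := by
  rw [unitAngle, angle, AddCircle.equivIco_coe_eq (by rwa [zero_add])]

theorem angle_eq (t : 𝕋) : angle t = 2 * Real.pi * unitAngle t := by
  rw [unitAngle]; field_simp

theorem coe_angle (t : 𝕋) : ((2 * Real.pi * unitAngle t : ℝ) : 𝕋) = t := by
  rw [← angle_eq]
  exact (AddCircle.equivIco (2 * Real.pi) 0).symm_apply_apply t

/-- Transports the circle to `[0, 1)` with Lebesgue measure, where dilations are scalings and
decreasing rearrangements live. -/
theorem measurePreserving_unitAngle :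
    MeasurePreserving unitAngle m (volume.restrict (Set.Ico 0 1)) := by
  refine ⟨measurable_unitAngle, Measure.ext fun S hS => ?_⟩
  rw [Measure.map_apply measurable_unitAngle hS, Measure.restrict_apply hS]
  have h1 : volume (unitAngle ⁻¹' S) = ENNReal.ofReal (2 * Real.pi) * m (unitAngle ⁻¹' S) := by
    rw [AddCircle.volume_eq_smul_haarAddCircle]; rfl
  have h2 : volume (unitAngle ⁻¹' S) = ENNReal.ofReal (2 * Real.pi) * volume (S ∩ Set.Ico 0 1) := by
    rw [AddCircle.add_projection_respects_measure (2 * Real.pi) 0 (measurable_unitAngle hS)]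
    have hpi := Real.two_pi_pos
    have h3 := Real.volume_preimage_mul_left (a := (2 * Real.pi)⁻¹) (inv_ne_zero hpi.ne')
      (S ∩ Set.Ico 0 1)
    rw [inv_inv, abs_of_pos hpi] at h3
    rw [← h3]
    refine measure_congr ?_
    -- The covering projection is described on `(0, 2π]` and the angle takes values in `[0, 2π)`;
    -- the two intervals differ only at these points.
    have h4 : ∀ᵐ x : ℝ, x ≠ 0 ∧ x ≠ 2 * Real.pi :=
      (Measure.ae_ne volume 0).and (Measure.ae_ne volume (2 * Real.pi))
    filter_upwards [h4] with x hx
    refine propext ?_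
    change (unitAngle (x : 𝕋) ∈ S ∧ x ∈ Set.Ioc 0 (0 + 2 * Real.pi)) ↔
      ((2 * Real.pi)⁻¹ * x ∈ S ∧ (2 * Real.pi)⁻¹ * x ∈ Set.Ico 0 1)
    have h5 : x ∈ Set.Ioc 0 (0 + 2 * Real.pi) ↔ x ∈ Set.Ico 0 (2 * Real.pi) := by
      rw [zero_add]
      exact ⟨fun h => ⟨h.1.le, lt_of_le_of_ne h.2 hx.2⟩, fun h => ⟨lt_of_le_of_ne h.1 hx.1.symm, h.2.le⟩⟩
    have h6 : (2 * Real.pi)⁻¹ * x ∈ Set.Ico (0 : ℝ) 1 ↔ x ∈ Set.Ico 0 (2 * Real.pi) := by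
      rw [inv_mul_eq_div, Set.mem_Ico, Set.mem_Ico, div_lt_one hpi, le_div_iff₀ hpi, zero_mul]
    rw [h5, h6]
    refine and_congr_left fun h => ?_
    rw [unitAngle_coe h, inv_mul_eq_div]
  rw [h1] at h2
  exact (ENNReal.mul_right_inj (by simpa using Real.pi_pos) ENNReal.ofReal_ne_top).1 h2

theorem measure_unitAngle_lt {x : ℝ} (hx : x ≤ 1) :
    m {t | unitAngle t < x} = ENNReal.ofReal x := by
  have := measurePreserving_unitAngle.measure_preimage (s := Set.Iio x)
    measurableSet_Iio.nullMeasurableSet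
  change m (unitAngle ⁻¹' Set.Iio x) = _
  rw [this, Measure.restrict_apply measurableSet_Iio]
  have h : Set.Iio x ∩ Set.Ico 0 1 = Set.Ico 0 x := by
    ext y; simp only [Set.mem_inter_iff, Set.mem_Iio, Set.mem_Ico]
    exact ⟨fun h => ⟨h.2.1, h.1⟩, fun h => ⟨h.2, h.1, h.2.trans_le hx⟩⟩
  rw [h, Real.volume_Ico, sub_zero]

/-! ### Dilations -/

theorem dilation_cond {s : ℝ} (hs : 0 < s) (t : 𝕋) :
    s * angle t ∈ Set.Ico 0 (2 * Real.pi) ↔ s * unitAngle t < 1 := by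
  have hpi := Real.two_pi_pos
  have h0 := (unitAngle_mem t).1
  rw [angle_eq, Set.mem_Ico]
  constructor
  · intro h; by_contra hc; nlinarith [h.2]
  · intro h; exact ⟨by positivity, by nlinarith⟩

/-- Scaling by `s > 0` pulls null sets of `[0, 1)` back to null sets, so a dilation may be computed
on any representative. -/
theorem dilationFun_congr {s : ℝ} (hs : 0 < s) {f g : 𝕋 → ℂ} (h : f =ᵐ[m] g) :
    dilationFun s f =ᵐ[m] dilationFun s g := by
  obtain ⟨N, hNsub, hN, hN0⟩ := exists_measurable_superset_of_null (ae_iff.1 h)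
  let S : Set ℝ := {x | ((2 * Real.pi * x : ℝ) : 𝕋) ∈ N}
  have hSm : MeasurableSet S :=
    ((AddCircle.measurable_mk' (a := 2 * Real.pi)).comp (measurable_const_mul _)) hN
  have hS : volume (S ∩ Set.Ico 0 1) = 0 := by
    rw [← Measure.restrict_apply hSm, ← measurePreserving_unitAngle.measure_preimage
      hSm.nullMeasurableSet]
    refine measure_mono_null (fun t ht => ?_) hN0
    have : ((2 * Real.pi * unitAngle t : ℝ) : 𝕋) ∈ N := ht
    rwa [coe_angle] at this
  have hS' : volume ((fun x => s * x) ⁻¹' (S ∩ Set.Ico 0 1)) = 0 := by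
    rw [Real.volume_preimage_mul_left hs.ne', hS, mul_zero]
  have hpre : m (unitAngle ⁻¹' ((fun x => s * x) ⁻¹' (S ∩ Set.Ico 0 1))) = 0 := by
    rw [measurePreserving_unitAngle.measure_preimage
      ((measurable_const_mul s) (hSm.inter measurableSet_Ico)).nullMeasurableSet]
    exact Measure.absolutelyContinuous_of_le Measure.restrict_le_self hS'
  filter_upwards [measure_eq_zero_iff_ae_notMem.1 hpre] with t ht
  unfold dilationFun
  split_ifs with hc
  · have hlt := (dilation_cond hs t).1 hc
    have h0 := (unitAngle_mem t).1
    have hnot : s * unitAngle t ∉ S := fun hS =>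
      ht ⟨hS, mul_nonneg hs.le h0, hlt⟩
    have hnot' : ((s * angle t : ℝ) : 𝕋) ∉ N := by
      intro hN; apply hnot
      change ((2 * Real.pi * (s * unitAngle t) : ℝ) : 𝕋) ∈ N
      convert hN using 2; rw [angle_eq]; ring
    by_contra hne
    exact hnot' (hNsub hne)
  · rfl

theorem coeFn_dilation {s : ℝ} (hs : 0 < s) {F : L0} {f : 𝕋 → ℂ} (h : F =ᵐ[m] f) :
    dilation s F =ᵐ[m] dilationFun s f :=
  (AEEqFun.coeFn_mk _ _).trans (dilationFun_congr hs h)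

theorem dilationFun_comp_unitAngle {s : ℝ} (hs : 0 < s) (φ : ℝ → ℂ) (t : 𝕋) :
    dilationFun s (fun t => φ (unitAngle t)) t =
      if s * unitAngle t < 1 then φ (s * unitAngle t) else 0 := by
  unfold dilationFun
  by_cases h : s * angle t ∈ Set.Ico 0 (2 * Real.pi)
  · rw [if_pos h, if_pos ((dilation_cond hs t).1 h)]
    beta_reduce
    rw [unitAngle_coe h, angle_eq]
    congr 1; field_simp
  · rw [if_neg h, if_neg (mt (dilation_cond hs t).2 h)]

theorem nrm_dilation_le {s : ℝ} (hs : 0 < s) {f : L0} (hf : X.nrm f < ∞) :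
    X.nrm (dilation s f) ≤ dilationNorm X s * X.nrm f := by
  rcases eq_or_ne (X.nrm f) 0 with h0 | h0
  · have hf0 := X.eq_zero_of_nrm f h0
    have : dilation s f = 0 := by
      refine AEEqFun.ext (((coeFn_dilation hs (f := fun _ => 0) ?_)).trans ?_)
      · rw [hf0]; exact AEEqFun.coeFn_zero
      · refine EventuallyEq.trans ?_ AEEqFun.coeFn_zero.symm
        exact Eventually.of_forall fun t => by simp [dilationFun]
    rw [this, X.nrm_zero]; exact zero_le
  let c : ℂ := ((X.nrm f).toReal⁻¹ : ℝ)
  have hc : ‖c‖ₑ = (X.nrm f)⁻¹ := by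
    rw [← ofReal_norm, Complex.norm_real, Real.norm_of_nonneg (by positivity),
      ENNReal.ofReal_inv_of_pos (ENNReal.toReal_pos h0 hf.ne), ENNReal.ofReal_toReal hf.ne]
  have h1 : dilation s (c • f) = c • dilation s f := by
    refine AEEqFun.ext ((coeFn_dilation hs (f := c • (f : 𝕋 → ℂ)) (AEEqFun.coeFn_smul _ _)).trans ?_)
    filter_upwards [AEEqFun.coeFn_smul c (dilation s f), coeFn_dilation hs (ae_eq_refl f)]
      with t h1 h2
    rw [h1, Pi.smul_apply, h2]
    unfold dilationFun
    split_ifs <;> simp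
  have h2 : X.nrm (dilation s (c • f)) ≤ dilationNorm X s := by
    refine le_iSup₂_of_le (c • f) ?_ le_rfl
    rw [X.nrm_smul, hc, ENNReal.inv_mul_cancel h0 hf.ne]
  rw [h1, X.nrm_smul, hc, mul_comm, ← div_eq_mul_inv] at h2
  exact (ENNReal.div_le_iff h0 hf.ne).1 h2

theorem fnrm_dilationFun_le {s : ℝ} (hs : 0 < s) {f : 𝕋 → ℂ} (hf : X.fnrm f < ∞) :
    X.fnrm (dilationFun s f) ≤ dilationNorm X s * X.fnrm f := by
  have hfm := aestronglyMeasurable_of_fnrm_lt_top hf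
  rw [← fnrm_congr (coeFn_dilation hs (AEEqFun.coeFn_mk f hfm)), fnrm_coe]
  rw [fnrm_eq hfm] at hf ⊢
  exact nrm_dilation_le hs hf

/-- The upper index is the exponential growth rate of the expanding dilations; any exponent strictly
between it and `1` works for large `s`, and the midpoint is chosen. -/
theorem exists_dilationNorm_inv_le (hB : HasNontrivialBoydIndices Y) :
    ∃ b ∈ Set.Ioo (0 : ℝ) 1, ∃ R > 1, ∀ s ≥ R,
      dilationNorm Y (1 / s) ≤ ENNReal.ofReal (s ^ b) := by
  obtain ⟨α, -, β, hβ, -, h⟩ := hB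
  -- The lower end `0` of the interval matters. Since `toReal ∞ = 0` and `log 0 = 0`, a positive
  -- quotient certifies that the dilation norm is finite.
  have h1 : ∀ᶠ s : ℝ in atTop,
      Real.log (dilationNorm Y (1 / s)).toReal / Real.log s ∈ Set.Ioo 0 ((β + 1) / 2) :=
    h.eventually (Ioo_mem_nhds hβ.1 (by linarith [hβ.2]))
  obtain ⟨R, hR⟩ := eventually_atTop.1 (h1.and (eventually_gt_atTop 1))
  refine ⟨(β + 1) / 2, ⟨by linarith [hβ.1], by linarith [hβ.2]⟩, max R 2,
    lt_max_of_lt_right one_lt_two, fun s hs => ?_⟩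
  obtain ⟨h2, h3⟩ := hR s ((le_max_left _ _).trans hs)
  have hlog := Real.log_pos h3
  set N := dilationNorm Y (1 / s)
  have hNpos : 0 < Real.log N.toReal := (div_pos_iff_of_pos_right hlog).1 h2.1
  have hN0 : 0 < N.toReal := by
    rcases (ENNReal.toReal_nonneg (a := N)).eq_or_lt with h | h
    · rw [← h] at hNpos; simp at hNpos
    · exact h
  refine ENNReal.le_ofReal_iff_toReal_le (ENNReal.toReal_pos_iff.1 hN0).2.ne (by positivity) |>.2 ?_
  rw [← Real.log_le_log_iff hN0 (by positivity), Real.log_rpow (by positivity)]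
  exact ((div_lt_iff₀ hlog).1 h2.2).le

/-- The positive lower index controls the contracting dilations in the same way, after the
substitution `s ↦ s⁻¹`. Here the logarithm is strictly negative, which again excludes the value `∞`.
-/
theorem exists_dilationNorm_le (hB : HasNontrivialBoydIndices Y) :
    ∃ a ∈ Set.Ioo (0 : ℝ) 1, ∃ R > 1, ∀ s ≥ R,
      dilationNorm Y s ≤ ENNReal.ofReal (s ^ (-a)) := by
  obtain ⟨α, hα, β, -, h, -⟩ := hB
  have h1 : ∀ᶠ s : ℝ in 𝓝[>] 0,
      α / 2 < Real.log (dilationNorm Y (1 / s)).toReal / Real.log s :=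
    h.eventually (lt_mem_nhds (by linarith [hα.1]))
  obtain ⟨R, hR⟩ := eventually_atTop.1 ((tendsto_inv_atTop_nhdsGT_zero.eventually h1).and
    (eventually_gt_atTop 1))
  refine ⟨α / 2, ⟨by linarith [hα.1], by linarith [hα.2, hα.1]⟩, max R 2,
    lt_max_of_lt_right one_lt_two, fun s hs => ?_⟩
  obtain ⟨h2, h3⟩ := hR s ((le_max_left _ _).trans hs)
  have hlog := Real.log_pos h3
  rw [one_div, inv_inv, Real.log_inv, div_neg] at h2
  set N := dilationNorm Y s
  have h4 : Real.log N.toReal < -(α / 2) * Real.log s := by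
    have : Real.log N.toReal / Real.log s < -(α / 2) := by linarith
    exact (div_lt_iff₀ hlog).1 this
  have hNneg : Real.log N.toReal < 0 := by nlinarith [hα.1]
  have hN0 : 0 < N.toReal := by
    rcases (ENNReal.toReal_nonneg (a := N)).eq_or_lt with h | h
    · rw [← h] at hNneg; simp at hNneg
    · exact h
  refine ENNReal.le_ofReal_iff_toReal_le (ENNReal.toReal_pos_iff.1 hN0).2.ne (by positivity) |>.2 ?_
  rw [← Real.log_le_log_iff hN0 (by positivity), Real.log_rpow (by positivity)]
  exact h4.le

/-! ### Norms of indicator functions and embedding into `L¹` -/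

theorem IsRearrangementInvariant.fnrm_eq (hri : IsRearrangementInvariant X) {f g : 𝕋 → ℂ}
    (hf : AEStronglyMeasurable f m) (hg : AEStronglyMeasurable g m)
    (h : ∀ r : ℝ, 0 ≤ r → m {t | r < ‖f t‖} = m {t | r < ‖g t‖}) : X.fnrm f = X.fnrm g := by
  have hdist : ∀ {f : 𝕋 → ℂ} (hf : AEStronglyMeasurable f m) (r : ℝ),
      distribution (AEEqFun.mk f hf) r = m {t | r < ‖f t‖} := fun hf r => by
    refine measure_congr ?_
    filter_upwards [AEEqFun.coeFn_mk _ hf] with t ht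
    change (r < ‖_‖) = (r < ‖_‖)
    rw [ht]
  have heq : Equimeasurable (AEEqFun.mk f hf) (AEEqFun.mk g hg) := fun r hr => by
    rw [hdist, hdist, h r hr]
  have heq' : Equimeasurable (AEEqFun.mk g hg) (AEEqFun.mk f hf) := fun r hr => (heq r hr).symm
  rw [FunctionSpace.fnrm_eq hf, FunctionSpace.fnrm_eq hg]
  by_cases h1 : AEEqFun.mk f hf ∈ X.space
  · exact (hri _ _ heq h1).2
  · by_cases h2 : AEEqFun.mk g hg ∈ X.space
    · exact (h1 (hri _ _ heq' h2).1).elim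
    · rw [mem_space_iff, not_lt, top_le_iff] at h1 h2
      rw [h1, h2]

theorem norm_indicator_one (E : Set 𝕋) (t : 𝕋) :
    ‖E.indicator (fun _ => (1 : ℂ)) t‖ = E.indicator (fun _ => (1 : ℝ)) t := by
  by_cases h : t ∈ E <;> simp [h]

theorem aestronglyMeasurable_indicator_one {E : Set 𝕋} (hE : NullMeasurableSet E m) :
    AEStronglyMeasurable (E.indicator fun _ => (1 : ℂ)) m :=
  aestronglyMeasurable_const.indicator₀ hE

theorem nullMeasurableSet_unitAngle_lt (x : ℝ) : NullMeasurableSet {t | unitAngle t < x} m :=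
  (measurable_unitAngle measurableSet_Iio).nullMeasurableSet

theorem fnrm_indicator_eq (hri : IsRearrangementInvariant X) {E : Set 𝕋}
    (hE : NullMeasurableSet E m) :
    X.fnrm (E.indicator fun _ => 1) =
      X.fnrm ({t | unitAngle t < (m E).toReal}.indicator fun _ => 1) := by
  refine hri.fnrm_eq (aestronglyMeasurable_indicator_one hE)
    (aestronglyMeasurable_indicator_one (nullMeasurableSet_unitAngle_lt _)) fun r hr => ?_
  have key : ∀ F : Set 𝕋, {t | r < ‖F.indicator (fun _ => (1 : ℂ)) t‖} =
      if r < 1 then F else ∅ := fun F => by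
    ext t
    by_cases ht : t ∈ F <;> by_cases hr1 : r < 1 <;> simp [ht, hr1, hr]
  rw [key, key]
  split_ifs
  · rw [measure_unitAngle_lt, ENNReal.ofReal_toReal (measure_ne_top _ _)]
    exact measureReal_le_one
  · rfl

theorem fnrm_indicator_mono (hX : IsBanachFunctionSpace X) {E F : Set 𝕋}
    (hE : NullMeasurableSet E m) (h : E ⊆ F) :
    X.fnrm (E.indicator fun _ => 1) ≤ X.fnrm (F.indicator fun _ => 1) :=
  hX.fnrm_mono (aestronglyMeasurable_indicator_one hE)
    (Eventually.of_forall fun _ => norm_indicator_le_of_subset h _ _)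

theorem fnrm_indicator_lt_top (hX : IsBanachFunctionSpace X) {E : Set 𝕋}
    (hE : NullMeasurableSet E m) : X.fnrm (E.indicator fun _ => 1) < ∞ :=
  hX.fnrm_bounded (aestronglyMeasurable_indicator_one hE) (C := 1)
    (Eventually.of_forall fun t => (norm_indicator_le_norm_self _ _).trans (by simp))

theorem fnrm_one_ne_zero : X.fnrm (fun _ => 1) ≠ 0 := fun h => by
  have h1 : ∀ᵐ t ∂m, (fun _ => (1 : ℂ)) t = (0 : 𝕋 → ℂ) t := ae_eq_zero_of_fnrm h
  obtain ⟨t, ht⟩ := h1.exists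
  exact one_ne_zero ht

/-- The dilation `D_x` stretches the indicator of an arc of measure `x` to the constant `1`. -/
theorem fnrm_one_le_dilationNorm_mul (hX : IsBanachFunctionSpace X) {x : ℝ} (hx0 : 0 < x)
    (hx1 : x ≤ 1) :
    X.fnrm (fun _ => 1) ≤
      dilationNorm X x * X.fnrm ({t | unitAngle t < x}.indicator fun _ => 1) := by
  refine le_trans (le_of_eq ?_) (fnrm_dilationFun_le hx0
    (fnrm_indicator_lt_top hX (nullMeasurableSet_unitAngle_lt x)))
  congr 1
  ext t
  have h := dilationFun_comp_unitAngle hx0 ((Set.Iio x).indicator fun _ => 1) t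
  have h0 := unitAngle_mem t
  have h1 : x * unitAngle t < x := mul_lt_of_lt_one_right hx0 h0.2
  rw [if_pos (h1.trans_le hx1), Set.indicator_of_mem (Set.mem_Iio.2 h1)] at h
  exact h.symm

/-- A lower bound for the fundamental function: the previous lemma with `‖D_x‖ ≤ x^{-b}` gives it
for `x ≤ 1 / R`, and monotonicity gives it for larger sets at the cost of the factor `(1 / R)^b`. -/
theorem exists_mul_rpow_le_fnrm_indicator (hY : IsBanachFunctionSpace Y)
    (hri : IsRearrangementInvariant Y) (hB : HasNontrivialBoydIndices Y) :
    ∃ b ∈ Set.Ioo (0 : ℝ) 1, ∃ c : ℝ≥0∞, c ≠ 0 ∧ c ≠ ∞ ∧ ∀ E, NullMeasurableSet E m →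
      c * m E ^ b ≤ Y.fnrm (E.indicator fun _ => 1) := by
  obtain ⟨b, hb, R, hR, h⟩ := exists_dilationNorm_inv_le hB
  have hR0 : 0 < R := one_pos.trans hR
  have hsmall : ∀ x : ℝ, 0 < x → x ≤ 1 / R → Y.fnrm (fun _ => 1) * ENNReal.ofReal x ^ b ≤
      Y.fnrm ({t | unitAngle t < x}.indicator fun _ => 1) := by
    intro x hx hxR
    have hx1 : x ≤ 1 := hxR.trans ((div_le_one hR0).2 hR.le)
    have h1 := h (1 / x) (by rw [ge_iff_le, le_div_comm₀ hR0 hx]; exact hxR)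
    rw [one_div_one_div] at h1
    have h2 := (fnrm_one_le_dilationNorm_mul hY hx hx1).trans (mul_le_mul_left h1 _)
    rw [one_div, Real.inv_rpow hx.le, ENNReal.ofReal_inv_of_pos (by positivity),
      ← ENNReal.ofReal_rpow_of_pos hx, mul_comm, ← div_eq_mul_inv] at h2
    rw [mul_comm]
    refine (ENNReal.le_div_iff_mul_le (Or.inl ?_) (Or.inl ?_)).1 h2 |>.trans' (mul_comm _ _).le
    · simp [hx]
    · exact ENNReal.rpow_ne_top_of_nonneg hb.1.le ENNReal.ofReal_ne_top
  refine ⟨b, hb, Y.fnrm (fun _ => 1) * ENNReal.ofReal (1 / R) ^ b,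
    mul_ne_zero fnrm_one_ne_zero ?_, (ENNReal.mul_lt_top hY.fnrm_one_lt_top ?_).ne, fun E hE => ?_⟩
  · simp [hR0, hb.1.le]
  · exact ENNReal.rpow_lt_top_of_nonneg hb.1.le ENNReal.ofReal_ne_top
  rw [fnrm_indicator_eq hri hE]
  set x := (m E).toReal
  have hx : m E = ENNReal.ofReal x := (ENNReal.ofReal_toReal (measure_ne_top _ _)).symm
  have hx1 : x ≤ 1 := measureReal_le_one
  rw [hx]
  rcases eq_or_lt_of_le (ENNReal.toReal_nonneg : 0 ≤ x) with h0 | h0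
  · have hx0 : x = 0 := h0.symm
    rw [hx0]; simp [hb.1]
  rcases le_total x (1 / R) with hxR | hxR
  · refine le_trans ?_ (hsmall x h0 hxR)
    gcongr
    refine mul_le_of_le_one_right zero_le (ENNReal.rpow_le_one ?_ hb.1.le)
    exact ENNReal.ofReal_le_one.2 ((div_le_one hR0).2 hR.le)
  · refine le_trans ?_ ((hsmall (1 / R) (by positivity) le_rfl).trans
      (fnrm_indicator_mono hY (nullMeasurableSet_unitAngle_lt _) fun t ht => lt_of_lt_of_le ht hxR))
    exact mul_le_of_le_one_right zero_le (ENNReal.rpow_le_one (ENNReal.ofReal_le_one.2 hx1) hb.1.le)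

theorem ofReal_mul_fnrm_indicator_le (hX : IsBanachFunctionSpace X) {f : 𝕋 → ℂ}
    (hf : AEStronglyMeasurable f m) {r : ℝ} (hr : 0 ≤ r) :
    ENNReal.ofReal r * X.fnrm ({t | r < ‖f t‖}.indicator fun _ => 1) ≤ X.fnrm f := by
  have hE : NullMeasurableSet {t | r < ‖f t‖} m :=
    nullMeasurableSet_lt aemeasurable_const hf.norm.aemeasurable
  have hm := aestronglyMeasurable_indicator_one hE
  have h1 : ‖(r : ℂ)‖ₑ = ENNReal.ofReal r := by
    rw [← ofReal_norm, Complex.norm_real, Real.norm_of_nonneg hr]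
  rw [← h1, ← fnrm_const_mul (r : ℂ) hm]
  refine hX.fnrm_mono (hm.const_mul _) (Eventually.of_forall fun t => ?_)
  rw [norm_mul, norm_indicator_one, Complex.norm_real, Real.norm_of_nonneg hr]
  by_cases ht : r < ‖f t‖
  · simp [Set.indicator, ht, ht.le]
  · simp [Set.indicator, ht]

/-- Embedding of `Y` in weak `Lʳ` with `r = 1 / b > 1`: Chebyshev's inequality in `Y`, combined with
the lower bound for the norms of indicators. -/
theorem exists_measure_lt_norm_le (hY : IsBanachFunctionSpace Y)
    (hri : IsRearrangementInvariant Y) (hB : HasNontrivialBoydIndices Y) :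
    ∃ r : ℝ, 1 < r ∧ ∃ B : ℝ≥0∞, B ≠ ∞ ∧ ∀ f, AEStronglyMeasurable f m → ∀ l : ℝ, 0 < l →
      m {t | l < ‖f t‖} ≤ (B * Y.fnrm f / ENNReal.ofReal l) ^ r := by
  obtain ⟨b, hb, c, hc0, hct, h⟩ := exists_mul_rpow_le_fnrm_indicator hY hri hB
  refine ⟨b⁻¹, (one_lt_inv₀ hb.1).2 hb.2, c⁻¹, ENNReal.inv_ne_top.2 hc0, fun f hf l hl => ?_⟩
  rw [ENNReal.le_rpow_inv_iff hb.1]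
  have h1 := h _ (nullMeasurableSet_lt (aemeasurable_const (b := l)) hf.norm.aemeasurable)
  have h2 := ofReal_mul_fnrm_indicator_le hY hf hl.le
  rw [ENNReal.le_div_iff_mul_le (by simp [hl]) (by simp)]
  rw [mul_comm c⁻¹, ← div_eq_mul_inv, ENNReal.le_div_iff_mul_le (by simp [hc0]) (by simp [hct])]
  refine le_trans (le_of_eq ?_) (h2.trans' (mul_le_mul_right h1 _))
  ring

theorem setLIntegral_norm_le {f : 𝕋 → ℂ} (hf : AEStronglyMeasurable f m) (n : ℕ) :
    ∫⁻ t in {t | (2 : ℝ) ^ n < ‖f t‖}, ‖f t‖ₑ ∂m ≤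
      ∑' j : ℕ, (2 : ℝ≥0∞) ^ (n + j + 1) * m {t | (2 : ℝ) ^ (n + j) < ‖f t‖} := by
  have hm : ∀ r : ℝ, NullMeasurableSet {t | r < ‖f t‖} m := fun r =>
    nullMeasurableSet_lt aemeasurable_const hf.norm.aemeasurable
  rw [← lintegral_indicator₀ (hm _)]
  calc _ ≤ ∫⁻ t, ∑' j : ℕ, {t | (2 : ℝ) ^ (n + j) < ‖f t‖}.indicator
          (fun _ => (2 : ℝ≥0∞) ^ (n + j + 1)) t ∂m := by
        refine lintegral_mono fun t => ?_
        by_cases ht : (2 : ℝ) ^ n < ‖f t‖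
        · have hex : ∃ k : ℕ, ‖f t‖ ≤ 2 ^ k := by
            obtain ⟨k, hk⟩ := pow_unbounded_of_one_lt ‖f t‖ one_lt_two
            exact ⟨k, hk.le⟩
          classical
          have hk := Nat.find_spec hex
          have hmin := fun j => Nat.find_min hex (m := j)
          set k := Nat.find hex
          have hnk : n < k := by
            by_contra hc
            exact ht.not_ge (hk.trans (pow_le_pow_right₀ one_le_two (not_lt.1 hc)))
          obtain ⟨j, hj⟩ := Nat.exists_eq_add_of_lt hnk
          rw [hj] at hk hmin
          refine le_trans ?_ (ENNReal.le_tsum j)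
          have h1 : (2 : ℝ) ^ (n + j) < ‖f t‖ := not_le.1 (hmin (n + j) (by omega))
          simp only [Set.indicator, Set.mem_ofPred_eq, ht, h1, if_true]
          rw [← ofReal_norm]
          refine (ENNReal.ofReal_le_ofReal hk).trans (le_of_eq ?_)
          rw [ENNReal.ofReal_pow zero_le_two]; simp
        · simp [Set.indicator, ht]
    _ = _ := by
        rw [lintegral_tsum fun j => (aemeasurable_const.indicator₀ (hm _))]
        congr 1; ext j
        rw [lintegral_indicator₀ (hm _), setLIntegral_const]

/-- Uniform integrability of balls of `Y`. On the dyadic layer of height `2^i` the weak `Lʳ` bound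
contributes a multiple of `2^{i(1 - r)}`, a geometric series because `r > 1`. -/
theorem exists_setLIntegral_norm_le (hY : IsBanachFunctionSpace Y)
    (hri : IsRearrangementInvariant Y) (hB : HasNontrivialBoydIndices Y) {K : ℝ≥0∞} (hK : K ≠ ∞) :
    ∃ φ : ℕ → ℝ≥0∞, (∀ n, φ n ≠ ∞) ∧ Tendsto φ atTop (𝓝 0) ∧ ∀ f, AEStronglyMeasurable f m →
      Y.fnrm f ≤ K → ∀ n : ℕ, ∫⁻ t in {t | (2 : ℝ) ^ n < ‖f t‖}, ‖f t‖ₑ ∂m ≤ φ n := by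
  obtain ⟨r, hr, B, hBt, h⟩ := exists_measure_lt_norm_le hY hri hB
  let q : ℝ≥0∞ := 2 ^ (1 - r)
  have hq : q < 1 := ENNReal.rpow_lt_one_of_one_lt_of_neg (by norm_num) (by linarith)
  let A : ℝ≥0∞ := 2 * (B * K) ^ r * (1 - q)⁻¹
  have hA : A ≠ ∞ := by
    refine ENNReal.mul_ne_top (ENNReal.mul_ne_top (by simp) ?_) ?_
    · exact ENNReal.rpow_ne_top_of_nonneg (by linarith) (ENNReal.mul_ne_top hBt hK)
    · exact ENNReal.inv_ne_top.2 (tsub_pos_of_lt hq).ne'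
  refine ⟨fun n => A * q ^ n, fun n => ENNReal.mul_ne_top hA (ENNReal.pow_ne_top
    (hq.trans ENNReal.one_lt_top).ne), ?_, fun f hf hfK n => ?_⟩
  · have := ENNReal.Tendsto.const_mul (a := A)
      (ENNReal.tendsto_pow_atTop_nhds_zero_of_lt_one hq) (Or.inr hA)
    simpa using this
  · refine (setLIntegral_norm_le hf n).trans ?_
    have hterm : ∀ j : ℕ, (2 : ℝ≥0∞) ^ (n + j + 1) * m {t | (2 : ℝ) ^ (n + j) < ‖f t‖} ≤
        2 * (B * K) ^ r * q ^ n * q ^ j := by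
      intro j
      have h1 : m {t | (2 : ℝ) ^ (n + j) < ‖f t‖} ≤ (B * K / 2 ^ (n + j)) ^ r := by
        refine (h f hf (2 ^ (n + j)) (by positivity)).trans ?_
        rw [ENNReal.ofReal_pow zero_le_two, ENNReal.ofReal_ofNat]
        gcongr
      have h2 : (2 : ℝ≥0∞) ^ (n + j) * ((2 : ℝ≥0∞) ^ (n + j)) ^ (-r) = q ^ (n + j) := by
        have h20 : (2 : ℝ≥0∞) ≠ 0 := by norm_num
        have h2t : (2 : ℝ≥0∞) ≠ ∞ := by norm_num
        rw [← ENNReal.rpow_natCast, ← ENNReal.rpow_natCast, ← ENNReal.rpow_mul, ← ENNReal.rpow_mul,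
          ← ENNReal.rpow_add _ _ h20 h2t]
        congr 1; ring
      calc _ ≤ (2 : ℝ≥0∞) ^ (n + j + 1) * (B * K / 2 ^ (n + j)) ^ r := by gcongr
        _ = 2 * (B * K) ^ r * ((2 : ℝ≥0∞) ^ (n + j) * ((2 : ℝ≥0∞) ^ (n + j)) ^ (-r)) := by
          rw [ENNReal.div_rpow_of_nonneg _ _ (by linarith), ENNReal.rpow_neg, div_eq_mul_inv]
          ring
        _ = _ := by rw [h2, pow_add]; ring
    refine (ENNReal.tsum_le_tsum hterm).trans (le_of_eq ?_)
    rw [ENNReal.tsum_mul_left, ENNReal.tsum_geometric]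
    simp only [A]; ring

theorem exists_lintegral_norm_le (hY : IsBanachFunctionSpace Y)
    (hri : IsRearrangementInvariant Y) (hB : HasNontrivialBoydIndices Y) :
    ∃ C : ℝ≥0∞, C ≠ ∞ ∧ ∀ f, AEStronglyMeasurable f m →
      Y.fnrm f < ∞ → ∫⁻ t, ‖f t‖ₑ ∂m ≤ C * Y.fnrm f := by
  obtain ⟨φ, hφ, -, h⟩ := exists_setLIntegral_norm_le hY hri hB ENNReal.one_ne_top
  have hunit : ∀ f, AEStronglyMeasurable f m → Y.fnrm f ≤ 1 → ∫⁻ t, ‖f t‖ₑ ∂m ≤ 1 + φ 0 := by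
    intro f hf hf1
    have hm : NullMeasurableSet {t | (2 : ℝ) ^ 0 < ‖f t‖} m :=
      nullMeasurableSet_lt aemeasurable_const hf.norm.aemeasurable
    calc ∫⁻ t, ‖f t‖ₑ ∂m
        ≤ ∫⁻ t, 1 + {t | (2 : ℝ) ^ 0 < ‖f t‖}.indicator (fun t => ‖f t‖ₑ) t ∂m := by
          refine lintegral_mono fun t => ?_
          by_cases ht : (2 : ℝ) ^ 0 < ‖f t‖
          · simp only [Set.indicator, Set.mem_ofPred_eq, ht, if_true]; exact le_add_self
          · refine le_add_of_le_left ?_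
            rw [← ofReal_norm]
            exact ENNReal.ofReal_le_one.2 (by simpa using ht)
      _ ≤ 1 + φ 0 := by
          rw [lintegral_add_left measurable_const, lintegral_indicator₀ hm]
          refine add_le_add (by simp) (h f hf hf1 0)
  refine ⟨1 + φ 0, ENNReal.add_ne_top.2 ⟨by simp, hφ 0⟩, fun f hf hft => ?_⟩
  rcases eq_or_ne (Y.fnrm f) 0 with h0 | h0
  · have : ∫⁻ t, ‖f t‖ₑ ∂m = 0 := by
      rw [lintegral_eq_zero_iff' hf.enorm]
      exact (ae_eq_zero_of_fnrm h0).mono fun t ht => by simp [ht]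
    rw [this]; exact zero_le
  let c : ℂ := ((Y.fnrm f).toReal⁻¹ : ℝ)
  have hc : ‖c‖ₑ = (Y.fnrm f)⁻¹ := by
    rw [← ofReal_norm, Complex.norm_real, Real.norm_of_nonneg (by positivity),
      ENNReal.ofReal_inv_of_pos (ENNReal.toReal_pos h0 hft.ne), ENNReal.ofReal_toReal hft.ne]
  have h1 := hunit (fun t => c * f t) (hf.const_mul c) (by
    rw [fnrm_const_mul c hf, hc, ENNReal.inv_mul_cancel h0 hft.ne])
  simp_rw [enorm_mul, hc] at h1
  rw [lintegral_const_mul'' _ hf.enorm, mul_comm, ← div_eq_mul_inv] at h1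
  exact (ENNReal.div_le_iff h0 hft.ne).1 h1

/-! ### The Riesz projection of trigonometric polynomials -/

/-- The part of a coefficient sequence supported on `n ≥ 0`. -/
def analyticPart : (ℤ →₀ ℂ) →ₗ[ℂ] (ℤ →₀ ℂ) where
  toFun c := c.filter (0 ≤ ·)
  map_add' _ _ := Finsupp.filter_add
  map_smul' _ _ := Finsupp.filter_smul

theorem analyticPart_single (n : ℤ) (a : ℂ) :
    analyticPart (Finsupp.single n a) = if 0 ≤ n then Finsupp.single n a else 0 := by
  split_ifs with h
  · exact Finsupp.filter_single_of_pos _ h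
  · exact Finsupp.filter_single_of_neg _ h

theorem integral_fourier (n : ℤ) : ∫ t, fourier n t ∂m = if n = 0 then 1 else 0 := by
  have h := congrFun (fourierCoeff_fourier (T := 2 * Real.pi) n) 0
  simp only [fourierCoeff, neg_zero, fourier_zero, one_smul] at h
  rw [h, Pi.single_apply]
  simp [eq_comm]

theorem fourier_one_pow (n : ℕ) : (fourier 1 : C(𝕋, ℂ)) ^ n = fourier (n : ℤ) := by
  induction n with
  | zero => ext t; simp
  | succ n ih => ext t; rw [pow_succ, ih]; push_cast; rw [fourier_add]; rfl

/-- The function `p(e^{iθ})` on the circle. -/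
def circlePoly (p : Polynomial ℂ) : C(𝕋, ℂ) := Polynomial.aeval (fourier 1 : C(𝕋, ℂ)) p

theorem circlePoly_monomial (n : ℕ) (a : ℂ) :
    circlePoly (Polynomial.monomial n a) = a • fourier (n : ℤ) := by
  rw [circlePoly, Polynomial.aeval_monomial, fourier_one_pow, Algebra.smul_def]

theorem integral_circlePoly (p : Polynomial ℂ) : ∫ t, circlePoly p t ∂m = p.coeff 0 := by
  induction p using Polynomial.induction_on' with
  | add p q hp hq =>
    have : circlePoly (p + q) = circlePoly p + circlePoly q := map_add _ _ _
    simp only [this, ContinuousMap.add_apply, Polynomial.coeff_add]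
    rw [integral_add (integrable_continuousMap _) (integrable_continuousMap _), hp, hq]
  | monomial n a =>
    rw [circlePoly_monomial]
    simp only [ContinuousMap.smul_apply, smul_eq_mul]
    rw [integral_const_mul, integral_fourier, Polynomial.coeff_monomial]
    simp

/-- Splits a trigonometric polynomial into an analytic part and the conjugate of another, in genuine
polynomials whose powers remain analytic. The constant term is assigned to `g`. -/
theorem exists_circlePoly (c : ℤ →₀ ℂ) : ∃ g h : Polynomial ℂ,
    trigPoly (analyticPart c) = circlePoly g ∧ trigPoly c = circlePoly g + star (circlePoly h) ∧
      h.coeff 0 = 0 := by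
  have hz : circlePoly 0 = 0 := map_zero _
  have hadd : ∀ p q, circlePoly (p + q) = circlePoly p + circlePoly q := fun p q => map_add _ _ _
  induction c using Finsupp.induction_linear with
  | zero => exact ⟨0, 0, by simp [hz], by simp [hz], by simp⟩
  | add c d hc hd =>
    obtain ⟨g, h, h1, h2, h3⟩ := hc
    obtain ⟨g', h', h1', h2', h3'⟩ := hd
    refine ⟨g + g', h + h', ?_, ?_, by simp [h3, h3']⟩
    · rw [map_add, map_add, h1, h1', hadd]
    · rw [map_add, h2, h2', hadd, hadd, star_add]; abel
  | single n a =>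
    rw [analyticPart_single]
    by_cases hn : 0 ≤ n
    · obtain ⟨k, rfl⟩ := Int.eq_ofNat_of_zero_le hn
      refine ⟨Polynomial.monomial k a, 0, ?_, ?_, by simp⟩
      · rw [if_pos hn, circlePoly_monomial, trigPoly_single]
      · rw [circlePoly_monomial, trigPoly_single, hz]; simp
    · obtain ⟨k, hk⟩ := Int.eq_ofNat_of_zero_le (a := -n) (by omega)
      refine ⟨0, Polynomial.monomial k (conj a), ?_, ?_, ?_⟩
      · rw [if_neg hn, hz, map_zero]
      · rw [circlePoly_monomial, trigPoly_single, hz, zero_add]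
        ext t
        have : n = -(k : ℤ) := by omega
        change a • fourier n t = star (conj a • fourier (k : ℤ) t)
        rw [this, fourier_neg, smul_eq_mul, smul_eq_mul]
        simp only [Complex.star_def, map_mul, Complex.conj_conj]
      · rw [Polynomial.coeff_monomial, if_neg (by omega)]

/-! ### M. Riesz's theorem for even exponents -/

theorem norm_pow_sub_pow_le_mul {a b : ℂ} {M : ℝ} (ha : ‖a‖ ≤ M) (hb : ‖b‖ ≤ M) (n : ℕ) :
    ‖a ^ n - b ^ n‖ ≤ n * ‖a - b‖ * M ^ (n - 1) := by
  have hM : 0 ≤ M := (norm_nonneg _).trans ha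
  rw [← (Commute.all a b).geom_sum₂_mul, norm_mul]
  have : ‖∑ i ∈ Finset.range n, a ^ i * b ^ (n - 1 - i)‖ ≤ n * M ^ (n - 1) := by
    refine (norm_sum_le _ _).trans ?_
    rw [← nsmul_eq_mul]
    refine (Finset.sum_le_card_nsmul _ _ (M ^ (n - 1)) fun i hi => ?_).trans (by simp)
    rw [norm_mul, norm_pow, norm_pow]
    have hi' : n - 1 = i + (n - 1 - i) := by have := Finset.mem_range.1 hi; omega
    calc ‖a‖ ^ i * ‖b‖ ^ (n - 1 - i) ≤ M ^ i * M ^ (n - 1 - i) := by gcongr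
      _ = M ^ (n - 1) := by rw [← pow_add, ← hi']
  calc _ ≤ n * M ^ (n - 1) * ‖a - b‖ := by gcongr
    _ = _ := by ring

/-- The pointwise inequality behind the theorem of M. Riesz. -/
theorem norm_pow_le_re_pow {k : ℕ} (hk : 0 < k) (z : ℂ) :
    ‖z‖ ^ (2 * k) ≤ 3 * (4 * (2 * k : ℕ)) ^ (2 * k) * |z.re| ^ (2 * k) +
      2 * ((-1) ^ k * (z ^ (2 * k)).re) := by
  set n := 2 * k with hn
  -- On the imaginary axis `(-1)^k w^{2k} = |w|^{2k}`; moving from `w` to `z` costs at most `n |Re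
  -- z| |z|^{n-1}` in the `n`-th power.
  let w : ℂ := Complex.I * z.im
  have hzw : z - w = z.re := by
    apply Complex.ext <;> simp [w]
  have hw : ‖w‖ ≤ ‖z‖ := by
    simpa [w] using Complex.abs_im_le_norm z
  have hwn : w ^ n = (((-1) ^ k * z.im ^ n : ℝ) : ℂ) := by
    simp only [w, mul_pow, hn]
    rw [pow_mul Complex.I, Complex.I_sq]; push_cast; ring
  have hev : Even n := ⟨k, by omega⟩
  have h1 := norm_pow_sub_pow_le_mul (le_refl ‖z‖) hw n
  rw [hzw, Complex.norm_real, Real.norm_eq_abs] at h1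
  have hs : ((-1 : ℝ) ^ k) * (-1) ^ k = 1 := by rw [← mul_pow]; simp
  have h2 : z.im ^ n - n * |z.re| * ‖z‖ ^ (n - 1) ≤ (-1) ^ k * (z ^ n).re := by
    have h3 : |(-1) ^ k * (z ^ n).re - z.im ^ n| ≤ ‖z ^ n - w ^ n‖ := by
      have h4 : (-1) ^ k * (z ^ n).re - z.im ^ n = (-1) ^ k * (z ^ n - w ^ n).re := by
        rw [Complex.sub_re, hwn, Complex.ofReal_re, mul_sub, ← mul_assoc, hs, one_mul]
      rw [h4, abs_mul, abs_pow, abs_neg, abs_one, one_pow, one_mul]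
      exact Complex.abs_re_le_norm _
    have := (abs_le.1 (h3.trans h1)).1
    linarith
  have h5 : ‖z‖ ^ n ≤ z.im ^ n + n * |z.re| * ‖z‖ ^ (n - 1) := by
    have h6 : ‖z ^ n‖ ≤ ‖w ^ n‖ + ‖z ^ n - w ^ n‖ := by
      have := norm_add_le (w ^ n) (z ^ n - w ^ n); simpa using this
    have h7 : ‖w ^ n‖ = z.im ^ n := by
      rw [hwn, Complex.norm_real, Real.norm_eq_abs, abs_mul, abs_pow, abs_neg, abs_one, one_pow,
        one_mul, abs_of_nonneg (hev.pow_nonneg _)]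
    rw [norm_pow, h7] at h6
    linarith
  have hnn : ‖z‖ ^ n = ‖z‖ * ‖z‖ ^ (n - 1) := by
    rw [← pow_succ']; congr 1; omega
  have hP : 0 ≤ ‖z‖ ^ (n - 1) := by positivity
  -- If `z` is close to the imaginary axis, the two errors together are at most half of `|z|^n` and
  -- are absorbed. Otherwise `|z|` is itself bounded by `4 n |Re z|`.
  rcases le_total (4 * n * |z.re|) ‖z‖ with h | h
  · have h8 : 4 * n * |z.re| * ‖z‖ ^ (n - 1) ≤ ‖z‖ ^ n := by
      rw [hnn]; exact mul_le_mul_of_nonneg_right h hP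
    have h9 : 0 ≤ 3 * (4 * (n : ℝ)) ^ n * |z.re| ^ n := by positivity
    linarith
  · have h8 : ‖z‖ ^ n ≤ (4 * n) ^ n * |z.re| ^ n := by
      rw [← mul_pow]; exact pow_le_pow_left₀ (norm_nonneg _) h n
    have h9 : |(-1) ^ k * (z ^ n).re| ≤ ‖z‖ ^ n := by
      rw [abs_mul, abs_pow, abs_neg, abs_one, one_pow, one_mul, ← norm_pow]
      exact Complex.abs_re_le_norm _
    have := (abs_le.1 h9).1
    linarith

theorem integrable_of_continuous {E : Type*} [NormedAddCommGroup E] {f : 𝕋 → E}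
    (hf : Continuous f) : Integrable f m :=
  hf.integrable_of_hasCompactSupport (HasCompactSupport.of_compactSpace _)

/-- The pointwise inequality is integrated; the term `Re p^{2k}` has mean `Re p(0)^{2k}` because
`p^{2k}` is again an analytic polynomial. -/
theorem integral_norm_circlePoly_pow_le {k : ℕ} (hk : 0 < k) (p : Polynomial ℂ) :
    ∫ t, ‖circlePoly p t‖ ^ (2 * k) ∂m ≤
      3 * (4 * (2 * k : ℕ)) ^ (2 * k) * ∫ t, |(circlePoly p t).re| ^ (2 * k) ∂m +
        2 * ‖p.coeff 0‖ ^ (2 * k) := by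
  have hc := (circlePoly p).continuous
  have hpow : ∀ t, circlePoly p t ^ (2 * k) = circlePoly (p ^ (2 * k)) t := fun t => by
    simp [circlePoly]
  have hi1 : Integrable (fun t => |(circlePoly p t).re| ^ (2 * k)) m :=
    integrable_of_continuous ((Complex.continuous_re.comp hc).abs.pow _)
  have hi2 : Integrable (fun t => circlePoly (p ^ (2 * k)) t) m := integrable_continuousMap _
  have hi3 : Integrable (fun t => (circlePoly (p ^ (2 * k)) t).re) m := hi2.re
  calc _ ≤ ∫ t, (3 * (4 * (2 * k : ℕ)) ^ (2 * k) * |(circlePoly p t).re| ^ (2 * k) +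
      2 * ((-1) ^ k * (circlePoly (p ^ (2 * k)) t).re)) ∂m := by
        refine integral_mono (integrable_of_continuous (hc.norm.pow _))
          ((hi1.const_mul _).add ((hi3.const_mul _).const_mul _)) fun t => ?_
        rw [← hpow]
        exact norm_pow_le_re_pow hk _
    _ = 3 * (4 * (2 * k : ℕ)) ^ (2 * k) * ∫ t, |(circlePoly p t).re| ^ (2 * k) ∂m +
        2 * ((-1) ^ k * ((p.coeff 0) ^ (2 * k)).re) := by
        rw [integral_add (hi1.const_mul _) ((hi3.const_mul _).const_mul _), integral_const_mul,
          integral_const_mul, integral_const_mul]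
        have : ∫ t, (circlePoly (p ^ (2 * k)) t).re ∂m = ((p.coeff 0) ^ (2 * k)).re := by
          have h1 : ∫ t, (circlePoly (p ^ (2 * k)) t).re ∂m =
            (∫ t, circlePoly (p ^ (2 * k)) t ∂m).re := integral_re hi2
          rw [h1, integral_circlePoly, Polynomial.coeff_zero_eq_eval_zero, Polynomial.eval_pow,
            ← Polynomial.coeff_zero_eq_eval_zero]
        rw [this]
    _ ≤ _ := by
        gcongr
        refine (le_abs_self _).trans ?_
        rw [abs_mul, abs_pow, abs_neg, abs_one, one_pow, one_mul, ← norm_pow]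
        exact Complex.abs_re_le_norm _

theorem norm_coeff_zero_pow_le (f : C(𝕋, ℂ)) (n : ℕ) :
    ‖∫ t, f t ∂m‖ ^ n ≤ ∫ t, ‖f t‖ ^ n ∂m := by
  calc ‖∫ t, f t ∂m‖ ^ n ≤ (∫ t, ‖f t‖ ∂m) ^ n :=
        pow_le_pow_left₀ (norm_nonneg _) (norm_integral_le_integral_norm _) n
    _ ≤ ∫ t, ‖f t‖ ^ n ∂m :=
        (convexOn_pow n).map_integral_le (continuousOn_pow n) isClosed_Ici
          (Eventually.of_forall fun t => norm_nonneg _) (integrable_of_continuous f.continuous.norm)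
          (integrable_of_continuous (f.continuous.norm.pow n))

/-- M. Riesz's theorem for even exponents and trigonometric polynomials. -/
theorem integral_norm_analyticPart_pow_le {k : ℕ} (hk : 0 < k) (c : ℤ →₀ ℂ) :
    ∫ t, ‖trigPoly (analyticPart c) t‖ ^ (2 * k) ∂m ≤
      (6 * (4 * (2 * k : ℕ)) ^ (2 * k) + 4) * ∫ t, ‖trigPoly c t‖ ^ (2 * k) ∂m := by
  obtain ⟨g, h, hg, hf, h0⟩ := exists_circlePoly c
  set n := 2 * k
  set f := trigPoly c
  -- With `f = g + conj h`, the analytic polynomials `p₁` and `p₂` have real parts `Re f` and `Im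
  -- f`, and `g = (p₁ + i p₂) / 2`. Since `h(0) = 0`, both have constant terms of modulus `|g(0)| =
  -- |∫ f|`.
  let p₁ : Polynomial ℂ := g + h
  let p₂ : Polynomial ℂ := Polynomial.C (-Complex.I) * (g - h)
  have e₁ : ∀ t, circlePoly p₁ t = circlePoly g t + circlePoly h t := fun t => by
    simp [circlePoly, p₁]
  have e₂ : ∀ t, circlePoly p₂ t = -Complex.I * (circlePoly g t - circlePoly h t) := fun t => by
    simp [circlePoly, p₂]
  have ef : ∀ t, f t = circlePoly g t + conj (circlePoly h t) := fun t => by rw [hf]; rfl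
  have hc0 : g.coeff 0 = ∫ t, f t ∂m := by
    have hi2 : Integrable (fun t => conj (circlePoly h t)) m :=
      integrable_continuousMap (star (circlePoly h))
    simp_rw [ef]
    rw [integral_add (integrable_continuousMap _) hi2,
      integral_circlePoly, integral_conj, integral_circlePoly, h0]
    simp
  have hJ := norm_coeff_zero_pow_le f n
  have hi : Integrable (fun t => ‖f t‖ ^ n) m := integrable_of_continuous (f.continuous.norm.pow n)
  have key : ∀ p : Polynomial ℂ, ‖p.coeff 0‖ = ‖g.coeff 0‖ →
      (∀ t, |(circlePoly p t).re| ≤ ‖f t‖) → ∫ t, ‖circlePoly p t‖ ^ n ∂m ≤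
        (3 * (4 * (n : ℕ)) ^ n + 2) * ∫ t, ‖f t‖ ^ n ∂m := by
    intro p hp0 hpre
    refine (integral_norm_circlePoly_pow_le hk p).trans ?_
    rw [hp0, hc0, add_mul]
    gcongr
    · exact integrable_of_continuous
        ((Complex.continuous_re.comp (circlePoly p).continuous).abs.pow _)
    · exact fun t => pow_le_pow_left₀ (abs_nonneg _) (hpre t) _
  have k₁ := key p₁ (by simp [p₁, h0]) fun t => by
    have : (circlePoly p₁ t).re = (f t).re := by rw [e₁, ef]; simp
    rw [this]; exact Complex.abs_re_le_norm _
  have k₂ := key p₂ (by simp [p₂, h0, Polynomial.mul_coeff_zero]) fun t => by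
    have : (circlePoly p₂ t).re = (f t).im := by rw [e₂, ef]; simp [sub_eq_add_neg]
    rw [this]; exact Complex.abs_im_le_norm _
  have hi₁ : ∀ p : Polynomial ℂ, Integrable (fun t => ‖circlePoly p t‖ ^ n) m := fun p =>
    integrable_of_continuous ((circlePoly p).continuous.norm.pow n)
  rw [hg]
  calc ∫ t, ‖circlePoly g t‖ ^ n ∂m
      ≤ ∫ t, (‖circlePoly p₁ t‖ ^ n + ‖circlePoly p₂ t‖ ^ n) ∂m := by
        refine integral_mono (hi₁ g) ((hi₁ p₁).add (hi₁ p₂)) fun t => ?_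
        have h1 : ‖circlePoly g t‖ ≤ (‖circlePoly p₁ t‖ + ‖circlePoly p₂ t‖) / 2 := by
          have h2 : circlePoly g t = (circlePoly p₁ t + Complex.I * circlePoly p₂ t) / 2 := by
            rw [e₁, e₂]; linear_combination ((circlePoly g t - circlePoly h t) / 2) * Complex.I_sq
          rw [h2, norm_div]
          have := norm_add_le (circlePoly p₁ t) (Complex.I * circlePoly p₂ t)
          rw [norm_mul, Complex.norm_I, one_mul] at this
          simp only [Complex.norm_ofNat]
          gcongr
        rcases le_total ‖circlePoly p₁ t‖ ‖circlePoly p₂ t‖ with h2 | h2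
        · have : ‖circlePoly g t‖ ^ n ≤ ‖circlePoly p₂ t‖ ^ n :=
            pow_le_pow_left₀ (norm_nonneg _) (by linarith) n
          exact this.trans (le_add_of_nonneg_left (by positivity))
        · have : ‖circlePoly g t‖ ^ n ≤ ‖circlePoly p₁ t‖ ^ n :=
            pow_le_pow_left₀ (norm_nonneg _) (by linarith) n
          exact this.trans (le_add_of_nonneg_right (by positivity))
    _ ≤ _ := by
        rw [integral_add (hi₁ p₁) (hi₁ p₂)]
        linarith

theorem lintegral_enorm_pow_eq (f : C(𝕋, ℂ)) (n : ℕ) :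
    ∫⁻ t, ‖f t‖ₑ ^ n ∂m = ENNReal.ofReal (∫ t, ‖f t‖ ^ n ∂m) := by
  have hi : Integrable (fun t => ‖f t‖ ^ n) m := integrable_of_continuous (f.continuous.norm.pow n)
  rw [ofReal_integral_eq_lintegral_ofReal hi
    (Eventually.of_forall fun t => by positivity)]
  simp_rw [ENNReal.ofReal_pow (norm_nonneg _), ofReal_norm]

theorem exists_lintegral_analyticPart_le {k : ℕ} (hk : 0 < k) : ∃ C : ℝ≥0∞, C ≠ ∞ ∧ ∀ c : ℤ →₀ ℂ,
    ∫⁻ t, ‖trigPoly (analyticPart c) t‖ₑ ^ (2 * k) ∂m ≤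
      C * ∫⁻ t, ‖trigPoly c t‖ₑ ^ (2 * k) ∂m := by
  refine ⟨ENNReal.ofReal (6 * (4 * (2 * k : ℕ)) ^ (2 * k) + 4), ENNReal.ofReal_ne_top, fun c => ?_⟩
  rw [lintegral_enorm_pow_eq, lintegral_enorm_pow_eq, ← ENNReal.ofReal_mul (by positivity)]
  exact ENNReal.ofReal_le_ofReal (integral_norm_analyticPart_pow_le hk c)

/-- The Riesz projection is an orthogonal projection in `L²`; its symmetry passes estimates to the
conjugate exponent. -/
theorem integral_analyticPart_mul_conj (c d : ℤ →₀ ℂ) :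
    ∫ t, trigPoly (analyticPart c) t * conj (trigPoly d t) ∂m =
      ∫ t, trigPoly c t * conj (trigPoly (analyticPart d) t) ∂m := by
  have hfg_int : ∀ f g : C(𝕋, ℂ), Integrable (fun t => f t * conj (g t)) m := fun f g =>
    integrable_continuousMap (f * star g)
  induction c using Finsupp.induction_linear with
  | zero => simp
  | add c c' hc hc' =>
    simp only [map_add, ContinuousMap.add_apply, add_mul]
    rw [integral_add (hfg_int _ _) (hfg_int _ _), integral_add (hfg_int _ _) (hfg_int _ _), hc, hc']
  | single n a =>
    induction d using Finsupp.induction_linear with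
    | zero => simp
    | add d d' hd hd' =>
      simp only [map_add, ContinuousMap.add_apply, mul_add]
      rw [integral_add (hfg_int _ _) (hfg_int _ _), integral_add (hfg_int _ _) (hfg_int _ _), hd, hd']
    | single k b =>
      have h : ∫ t, trigPoly (Finsupp.single n a) t * conj (trigPoly (Finsupp.single k b) t) ∂m =
          if n = k then a * conj b else 0 := by
        have h1 : ∀ t, trigPoly (Finsupp.single n a) t * conj (trigPoly (Finsupp.single k b) t) =
            a * conj b * fourier (n - k) t := fun t => by
          rw [sub_eq_add_neg, fourier_add, fourier_neg]
          simp; ring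
        simp_rw [h1]
        rw [integral_const_mul, integral_fourier]
        simp [sub_eq_zero]
      rw [analyticPart_single, analyticPart_single]
      by_cases hn : 0 ≤ n <;> by_cases hk : 0 ≤ k
      · rw [if_pos hn, if_pos hk]
      · rw [if_pos hn, if_neg hk, h, if_neg (by omega)]; simp
      · rw [if_neg hn, if_pos hk, h, if_neg (by omega)]; simp
      · rw [if_neg hn, if_neg hk]; simp

/-! ### Weak type estimates -/

theorem exists_trigPoly_tendsto_ae {f : 𝕋 → ℂ} (hf : AEStronglyMeasurable f m) {M : ℝ}
    (hM : 0 < M) (hfM : ∀ᵐ t ∂m, ‖f t‖ ≤ M) :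
    ∃ c : ℕ → ℤ →₀ ℂ, (∀ n t, ‖trigPoly (c n) t‖ ≤ M + 1) ∧
      ∀ᵐ t ∂m, Tendsto (fun n => trigPoly (c n) t) atTop (𝓝 (f t)) := by
  obtain ⟨g, hg, hlim⟩ := exists_continuous_tendsto_ae hf hM hfM
  choose c hc using fun n : ℕ => exists_norm_sub_trigPoly_lt (g n)
    (ε := 1 / ((n : ℝ) + 1)) (by positivity)
  have hd : ∀ n t, ‖trigPoly (c n) t - g n t‖ ≤ 1 / ((n : ℝ) + 1) := fun n t => by
    rw [norm_sub_rev]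
    exact ((g n - trigPoly (c n)).norm_coe_le_norm t).trans (hc n).le
  refine ⟨c, fun n t => ?_, ?_⟩
  · have h1 : ‖trigPoly (c n) t‖ ≤ ‖g n t‖ + ‖trigPoly (c n) t - g n t‖ := by
      have := norm_add_le (g n t) (trigPoly (c n) t - g n t); simpa using this
    have h2 : 1 / ((n : ℝ) + 1) ≤ 1 := by
      rw [div_le_one (by positivity)]; linarith [Nat.cast_nonneg (α := ℝ) n]
    linarith [hg n t, hd n t]
  · filter_upwards [hlim] with t ht
    have h1 : Tendsto (fun n => trigPoly (c n) t - g n t) atTop (𝓝 0) :=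
      squeeze_zero_norm (fun n => hd n t) tendsto_one_div_add_atTop_nhds_zero_nat
    simpa using ht.add h1

theorem tendsto_lintegral_rpow {f : 𝕋 → ℂ} {g : ℕ → 𝕋 → ℂ} {p M : ℝ} (hp : 0 ≤ p)
    (hg : ∀ n, AEStronglyMeasurable (g n) m) (hM : ∀ n t, ‖g n t‖ ≤ M)
    (hlim : ∀ᵐ t ∂m, Tendsto (fun n => g n t) atTop (𝓝 (f t))) :
    Tendsto (fun n => ∫⁻ t, ‖g n t‖ₑ ^ p ∂m) atTop (𝓝 (∫⁻ t, ‖f t‖ₑ ^ p ∂m)) := by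
  refine tendsto_lintegral_of_dominated_convergence' (fun _ => ENNReal.ofReal M ^ p)
    (fun n => (hg n).enorm.pow_const p) (fun n => Eventually.of_forall fun t => ?_) ?_ ?_
  · beta_reduce
    rw [← ofReal_norm]
    exact ENNReal.rpow_le_rpow (ENNReal.ofReal_le_ofReal (hM n t)) hp
  · rw [lintegral_const, measure_univ, mul_one]
    exact ENNReal.rpow_ne_top_of_nonneg hp ENNReal.ofReal_ne_top
  · filter_upwards [hlim] with t ht
    exact (ENNReal.continuous_rpow_const.tendsto _).comp ht.enorm

theorem enorm_integral_mul_conj_le {p q : ℝ} (hpq : p.HolderConjugate q) (f g : C(𝕋, ℂ)) :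
    ‖∫ t, f t * conj (g t) ∂m‖ₑ ≤
      (∫⁻ t, ‖f t‖ₑ ^ p ∂m) ^ (1 / p) * (∫⁻ t, ‖g t‖ₑ ^ q ∂m) ^ (1 / q) := by
  refine (enorm_integral_le_lintegral_enorm _).trans (le_trans (le_of_eq ?_)
    (ENNReal.lintegral_mul_le_Lp_mul_Lq m hpq
      f.continuous.enorm.aemeasurable g.continuous.enorm.aemeasurable))
  congr 1; ext t
  simp [enorm_mul]

/-- Duality. With `F` the analytic part and `E` its superlevel set, testing `F` against its sign on
`E` gives at least `l · m(E)`. The projection is moved to the test function, whose `L^q` norm is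
`m(E)^{1/q}`, and this power is cancelled. The sign is replaced by trigonometric polynomials
converging to it boundedly almost everywhere. -/
theorem exists_weak_type_le {p q : ℝ} (hpq : p.HolderConjugate q) {C : ℝ≥0∞} (hC : C ≠ ∞)
    (hq : ∀ c : ℤ →₀ ℂ, ∫⁻ t, ‖trigPoly (analyticPart c) t‖ₑ ^ q ∂m ≤
      C * ∫⁻ t, ‖trigPoly c t‖ₑ ^ q ∂m) :
    ∃ C' : ℝ≥0∞, C' ≠ ∞ ∧ ∀ (c : ℤ →₀ ℂ) (l : ℝ), 0 ≤ l →
      ENNReal.ofReal l ^ p * m {t | l < ‖trigPoly (analyticPart c) t‖} ≤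
        C' * ∫⁻ t, ‖trigPoly c t‖ₑ ^ p ∂m := by
  have hp0 := hpq.pos
  have hq0 := hpq.symm.pos
  refine ⟨(C ^ (1 / q)) ^ p, ENNReal.rpow_ne_top_of_nonneg hp0.le
    (ENNReal.rpow_ne_top_of_nonneg (by positivity) hC), fun c l hl => ?_⟩
  set F := trigPoly (analyticPart c)
  set E := {t | l < ‖F t‖}
  set A := ∫⁻ t, ‖trigPoly c t‖ₑ ^ p ∂m
  have hE : MeasurableSet E := measurableSet_lt measurable_const F.continuous.norm.measurable
  let h : 𝕋 → ℂ := E.indicator fun t => F t * ((‖F t‖⁻¹ : ℝ) : ℂ)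
  have hhm : AEStronglyMeasurable h m := by
    refine AEStronglyMeasurable.indicator ?_ hE
    exact F.continuous.aestronglyMeasurable.mul
      (Complex.measurable_ofReal.comp F.continuous.norm.measurable.inv).aestronglyMeasurable
  have hne : ∀ t ∈ E, ‖F t‖ ≠ 0 := fun t ht => (hl.trans_lt ht).ne'
  have hh1 : ∀ t, ‖h t‖ = E.indicator (fun _ => (1 : ℝ)) t := fun t => by
    by_cases ht : t ∈ E
    · simp [h, ht, hne t ht]
    · simp [h, ht]
  have hhe : ∀ t, ‖h t‖ₑ ^ q = E.indicator (fun _ => (1 : ℝ≥0∞)) t := fun t => by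
    rw [← ofReal_norm, hh1]
    by_cases ht : t ∈ E <;> simp [ht, hq0]
  have hhE : ∫⁻ t, ‖h t‖ₑ ^ q ∂m = m E := by
    simp_rw [hhe]; rw [lintegral_indicator hE]; simp
  obtain ⟨d, hd, hdlim⟩ := exists_trigPoly_tendsto_ae hhm one_pos (Eventually.of_forall fun t => by
    rw [hh1]; exact Set.indicator_le_self' (fun _ _ => zero_le_one) t)
  have hlim1 : Tendsto (fun n => ‖∫ t, F t * conj (trigPoly (d n) t) ∂m‖ₑ) atTop
      (𝓝 ‖∫ t, F t * conj (h t) ∂m‖ₑ) := by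
    refine Tendsto.enorm (tendsto_integral_of_dominated_convergence (fun t => ‖F t‖ * (1 + 1))
      (fun n => (aestronglyMeasurable_continuousMap (F * star (trigPoly (d n)))))
      ((integrable_continuousMap F).norm.mul_const _)
      (fun n => Eventually.of_forall fun t => ?_) ?_)
    · rw [norm_mul, RCLike.norm_conj]
      exact mul_le_mul_of_nonneg_left (hd n t) (norm_nonneg _)
    · filter_upwards [hdlim] with t ht
      exact ((Complex.continuous_conj.tendsto _).comp ht).const_mul _
  have hlim2 : Tendsto (fun n => A ^ (1 / p) *
      (C * ∫⁻ t, ‖trigPoly (d n) t‖ₑ ^ q ∂m) ^ (1 / q)) atTop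
      (𝓝 (A ^ (1 / p) * (C * m E) ^ (1 / q))) := by
    have h1 := tendsto_lintegral_rpow hq0.le
      (fun n => aestronglyMeasurable_continuousMap (trigPoly (d n))) hd hdlim
    rw [hhE] at h1
    have h2 := (ENNReal.continuous_rpow_const (y := 1 / q)).tendsto (C * m E) |>.comp
      (ENNReal.Tendsto.const_mul h1 (Or.inr hC))
    refine ENNReal.Tendsto.const_mul h2 (Or.inr ?_)
    refine ENNReal.rpow_ne_top_of_nonneg (by positivity) ?_
    have := tendsto_lintegral_rpow (f := trigPoly c) (g := fun _ => trigPoly c) hp0.le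
      (fun n => aestronglyMeasurable_continuousMap _)
      (fun n => (trigPoly c).norm_coe_le_norm) (Eventually.of_forall fun t => tendsto_const_nhds)
    refine ne_of_lt (lt_of_le_of_lt (lintegral_mono fun t => ENNReal.rpow_le_rpow
      (ENNReal.ofReal_le_ofReal ((trigPoly c).norm_coe_le_norm t) |>.trans' (ofReal_norm _).ge)
      hp0.le) ?_)
    rw [lintegral_const, measure_univ, mul_one]
    exact ENNReal.rpow_lt_top_of_nonneg hp0.le ENNReal.ofReal_ne_top
  have hbound : ‖∫ t, F t * conj (h t) ∂m‖ₑ ≤ A ^ (1 / p) * (C * m E) ^ (1 / q) := by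
    refine le_of_tendsto_of_tendsto' hlim1 hlim2 fun n => ?_
    rw [integral_analyticPart_mul_conj]
    exact (enorm_integral_mul_conj_le hpq _ _).trans (by gcongr; exact hq _)
  have hlow : ENNReal.ofReal l * m E ≤ ‖∫ t, F t * conj (h t) ∂m‖ₑ := by
    have h1 : ∀ t, F t * conj (h t) = ((E.indicator (fun t => ‖F t‖) t : ℝ) : ℂ) := fun t => by
      by_cases ht : t ∈ E
      · have h2 := hne t ht
        simp only [h, ht, Set.indicator_of_mem, map_mul, Complex.conj_ofReal]
        rw [← mul_assoc, Complex.mul_conj, Complex.normSq_eq_norm_sq, ← Complex.ofReal_mul]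
        congr 1; field_simp
      · simp [h, ht]
    simp_rw [h1]
    rw [integral_complex_ofReal, ← ofReal_norm, Complex.norm_real, Real.norm_of_nonneg
      (integral_nonneg fun t => Set.indicator_nonneg (fun _ _ => norm_nonneg _) _),
      ofReal_integral_eq_lintegral_ofReal ((integrable_continuousMap F).norm.indicator hE)
      (Eventually.of_forall fun t => Set.indicator_nonneg (fun _ _ => norm_nonneg _) _),
      ← setLIntegral_const, ← lintegral_indicator hE]
    refine lintegral_mono fun t => ?_
    by_cases ht : t ∈ E
    · simp only [ht, Set.indicator_of_mem]
      exact ENNReal.ofReal_le_ofReal (le_of_lt ht)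
    · simp [ht]
  rcases eq_or_ne (m E) 0 with h0 | h0
  · rw [h0, mul_zero]; exact zero_le
  have hmt : m E ≠ ∞ := measure_ne_top _ _
  have hmain : ENNReal.ofReal l * m E ^ (1 / p) ≤ C ^ (1 / q) * A ^ (1 / p) := by
    have h1 := hlow.trans hbound
    rw [ENNReal.mul_rpow_of_nonneg _ _ (by positivity)] at h1
    have h2 : m E = m E ^ (1 / p) * m E ^ (1 / q) := by
      rw [← ENNReal.rpow_add _ _ h0 hmt, one_div, one_div, hpq.inv_add_inv_eq_one,
        ENNReal.rpow_one]
    rw [h2] at h1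
    have h3 : m E ^ (1 / q) ≠ 0 := by simp [h0, hmt]
    have h4 : m E ^ (1 / q) ≠ ∞ := ENNReal.rpow_ne_top_of_nonneg (by positivity) hmt
    rw [← h2] at h1
    refine (ENNReal.mul_le_mul_iff_left h3 h4).1 ?_
    calc _ = ENNReal.ofReal l * (m E ^ (1 / p) * m E ^ (1 / q)) := by ring
      _ = ENNReal.ofReal l * m E := by rw [← h2]
      _ ≤ _ := h1
      _ = _ := by ring
  have h5 := ENNReal.rpow_le_rpow hmain hp0.le
  rw [ENNReal.mul_rpow_of_nonneg _ _ hp0.le, ENNReal.mul_rpow_of_nonneg _ _ hp0.le,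
    ← ENNReal.rpow_mul (m E), ← ENNReal.rpow_mul A, one_div_mul_cancel hp0.ne', ENNReal.rpow_one,
    ENNReal.rpow_one] at h5
  exact h5

/-- The weak type estimate for a sum of two bounded functions, each in its own exponent. -/
theorem exists_measure_analyticPart_le {k : ℕ} (hk : 0 < k) :
    ∃ C : ℝ≥0∞, C ≠ ∞ ∧ ∀ (c : ℤ →₀ ℂ) (f : 𝕋 → ℂ) (l M : ℝ), 0 < l →
      AEStronglyMeasurable f m → (∀ t, ‖f t‖ ≤ M) →
      m {t | 2 * l < ‖trigPoly (analyticPart c) t‖} ≤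
        C * ENNReal.ofReal l ^ (-(Real.conjExponent (2 * k))) *
          ∫⁻ t, ‖f t‖ₑ ^ (Real.conjExponent (2 * k)) ∂m +
        C * ENNReal.ofReal l ^ (-(2 * k : ℝ)) *
          ∫⁻ t, ‖trigPoly c t - f t‖ₑ ^ (2 * k : ℝ) ∂m := by
  obtain ⟨C, hC, hCq⟩ := exists_lintegral_analyticPart_le hk
  have hq1 : (1 : ℝ) < 2 * k := by
    have : (1 : ℝ) ≤ k := by exact_mod_cast hk
    linarith
  set q : ℝ := 2 * k with hqdef
  have hpow : ∀ x : ℝ≥0∞, x ^ (2 * k) = x ^ q := fun x => by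
    rw [← ENNReal.rpow_natCast]; push_cast; rfl
  simp_rw [hpow] at hCq
  have hpq : (Real.conjExponent q).HolderConjugate q := (Real.HolderConjugate.conjExponent hq1).symm
  set p := Real.conjExponent q
  obtain ⟨C', hC', hC'p⟩ := exists_weak_type_le hpq hC hCq
  have hp0 := hpq.pos
  have hq0 := hpq.symm.pos
  refine ⟨C' + C, ENNReal.add_ne_top.2 ⟨hC', hC⟩, fun c f l M hl hf hM => ?_⟩
  have hM1 : 0 < |M| + 1 := by positivity
  obtain ⟨d, hd, hdlim⟩ := exists_trigPoly_tendsto_ae hf hM1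
    (Eventually.of_forall fun t => (hM t).trans ((le_abs_self M).trans (by linarith)))
  have hl0 : ENNReal.ofReal l ≠ 0 := by simpa using hl
  have hlt : ENNReal.ofReal l ≠ ∞ := ENNReal.ofReal_ne_top
  have hneg : ∀ {r : ℝ} {a b : ℝ≥0∞}, ENNReal.ofReal l ^ r * a ≤ b →
      a ≤ ENNReal.ofReal l ^ (-r) * b := fun {r a b} h => by
    have h1 : ENNReal.ofReal l ^ (-r) * (ENNReal.ofReal l ^ r * a) = a := by
      rw [← mul_assoc, ← ENNReal.rpow_add _ _ hl0 hlt]; simp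
    rw [← h1]; gcongr
  -- The function `f` is only bounded, so the estimates apply to polynomials `d n → f`: weak type
  -- for `d n`, and Chebyshev with the strong bound for `c - d n`. Then `n → ∞`.
  have hstep : ∀ n, m {t | 2 * l < ‖trigPoly (analyticPart c) t‖} ≤
      C' * ENNReal.ofReal l ^ (-p) * ∫⁻ t, ‖trigPoly (d n) t‖ₑ ^ p ∂m +
        C * ENNReal.ofReal l ^ (-q) * ∫⁻ t, ‖trigPoly (c - d n) t‖ₑ ^ q ∂m := by
    intro n
    have hsub : {t | 2 * l < ‖trigPoly (analyticPart c) t‖} ⊆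
        {t | l < ‖trigPoly (analyticPart (d n)) t‖} ∪
          {t | l < ‖trigPoly (analyticPart (c - d n)) t‖} := by
      intro t ht
      by_contra hcon
      simp only [Set.mem_union, Set.mem_ofPred_eq, not_or, not_lt] at hcon ht
      have h1 : trigPoly (analyticPart c) t =
          trigPoly (analyticPart (d n)) t + trigPoly (analyticPart (c - d n)) t := by
        simp [map_sub]
      rw [h1] at ht
      linarith [norm_add_le (trigPoly (analyticPart (d n)) t)
        (trigPoly (analyticPart (c - d n)) t), hcon.1, hcon.2]
    refine (measure_mono hsub).trans ((measure_union_le _ _).trans (add_le_add ?_ ?_))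
    · refine (hneg (hC'p (d n) l hl.le)).trans (le_of_eq (by ring))
    · have h2 : ENNReal.ofReal l ^ q * m {t | l < ‖trigPoly (analyticPart (c - d n)) t‖} ≤
          C * ∫⁻ t, ‖trigPoly (c - d n) t‖ₑ ^ q ∂m := by
        refine le_trans ?_ (hCq (c - d n))
        refine le_trans ?_ (mul_meas_ge_le_lintegral₀
          ((trigPoly (analyticPart (c - d n))).continuous.enorm.aemeasurable.pow_const q)
            (ENNReal.ofReal l ^ q))
        gcongr with t
        intro ht
        rw [← ofReal_norm]
        gcongr
      exact (hneg h2).trans (le_of_eq (by ring))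
  have hlim1 := tendsto_lintegral_rpow hp0.le
    (fun n => aestronglyMeasurable_continuousMap (trigPoly (d n))) hd hdlim
  have hlim2 : Tendsto (fun n => ∫⁻ t, ‖trigPoly (c - d n) t‖ₑ ^ q ∂m) atTop
      (𝓝 (∫⁻ t, ‖trigPoly c t - f t‖ₑ ^ q ∂m)) := by
    refine tendsto_lintegral_rpow (f := fun t => trigPoly c t - f t) hq0.le
      (M := ‖trigPoly c‖ + (|M| + 1 + 1))
      (fun n => aestronglyMeasurable_continuousMap _) (fun n t => ?_) ?_
    · rw [map_sub, ContinuousMap.sub_apply]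
      exact (norm_sub_le _ _).trans (add_le_add ((trigPoly c).norm_coe_le_norm t) (hd n t))
    · filter_upwards [hdlim] with t ht
      simp only [map_sub, ContinuousMap.sub_apply]
      exact ht.const_sub _
  have hfin : ∀ r : ℝ, ENNReal.ofReal l ^ r ≠ ∞ := fun r => by
    rw [ENNReal.ofReal_rpow_of_pos hl]; exact ENNReal.ofReal_ne_top
  have hlim := (ENNReal.Tendsto.const_mul hlim1 (Or.inr (ENNReal.mul_ne_top hC' (hfin (-p))))).add
    (ENNReal.Tendsto.const_mul hlim2 (Or.inr (ENNReal.mul_ne_top hC (hfin (-q)))))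
  refine (ge_of_tendsto' hlim hstep).trans ?_
  gcongr
  · exact le_self_add
  · exact le_add_self

/-! ### Decreasing rearrangement -/

/-- The decreasing rearrangement of a continuous function. -/
def rearrangement (f : C(𝕋, ℂ)) (x : ℝ) : ℝ :=
  sInf {r | 0 ≤ r ∧ m {t | r < ‖f t‖} ≤ ENNReal.ofReal x}

theorem rearrangement_set_nonempty (f : C(𝕋, ℂ)) (x : ℝ) :
    {r | 0 ≤ r ∧ m {t | r < ‖f t‖} ≤ ENNReal.ofReal x}.Nonempty := by
  refine ⟨‖f‖, norm_nonneg _, ?_⟩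
  have : {t | ‖f‖ < ‖f t‖} = ∅ := by
    ext t; simpa using f.norm_coe_le_norm t
  rw [this]; simp

theorem rearrangement_nonneg (f : C(𝕋, ℂ)) (x : ℝ) : 0 ≤ rearrangement f x :=
  Real.sInf_nonneg fun _ h => h.1

/-- The infimum defining the rearrangement is attained, by continuity of the measure along
increasing unions. This yields the Galois connection `rearrangement_le_iff`, from which all other
properties follow. -/
theorem measure_rearrangement_lt_le (f : C(𝕋, ℂ)) (x : ℝ) :
    m {t | rearrangement f x < ‖f t‖} ≤ ENNReal.ofReal x := by
  have hU : {t | rearrangement f x < ‖f t‖} =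
      ⋃ n : ℕ, {t | rearrangement f x + 1 / ((n : ℝ) + 1) < ‖f t‖} := by
    ext t
    simp only [Set.mem_ofPred_eq, Set.mem_iUnion]
    constructor
    · intro h
      obtain ⟨n, hn⟩ := exists_nat_one_div_lt (sub_pos.2 h)
      exact ⟨n, by linarith⟩
    · rintro ⟨n, hn⟩
      have : (0 : ℝ) < 1 / ((n : ℝ) + 1) := by positivity
      linarith
  have hmono : Monotone fun n : ℕ => {t | rearrangement f x + 1 / ((n : ℝ) + 1) < ‖f t‖} := by
    intro i j hij t ht
    have h1 : 1 / ((j : ℝ) + 1) ≤ 1 / ((i : ℝ) + 1) := Nat.one_div_le_one_div hij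
    simp only [Set.mem_ofPred_eq] at ht ⊢
    linarith
  rw [hU, hmono.measure_iUnion]
  refine iSup_le fun n => ?_
  obtain ⟨r, hr, hlt⟩ := exists_lt_of_csInf_lt (rearrangement_set_nonempty f x)
    (show rearrangement f x < rearrangement f x + 1 / ((n : ℝ) + 1) by
      have : (0 : ℝ) < 1 / ((n : ℝ) + 1) := by positivity
      linarith)
  exact (measure_mono fun t ht => lt_trans hlt ht).trans hr.2

theorem rearrangement_le_iff (f : C(𝕋, ℂ)) (x : ℝ) {r : ℝ} (hr : 0 ≤ r) :
    rearrangement f x ≤ r ↔ m {t | r < ‖f t‖} ≤ ENNReal.ofReal x := by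
  constructor
  · intro h
    exact (measure_mono fun t ht => lt_of_le_of_lt h ht).trans (measure_rearrangement_lt_le f x)
  · intro h
    exact csInf_le ⟨0, fun _ h => h.1⟩ ⟨hr, h⟩

theorem rearrangement_antitone (f : C(𝕋, ℂ)) : Antitone (rearrangement f) := fun x y hxy => by
  rw [rearrangement_le_iff f y (rearrangement_nonneg f x)]
  exact (measure_rearrangement_lt_le f x).trans (ENNReal.ofReal_le_ofReal hxy)

theorem rearrangement_eq_zero (f : C(𝕋, ℂ)) {x : ℝ} (hx : 1 ≤ x) : rearrangement f x = 0 := by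
  refine le_antisymm ((rearrangement_le_iff f x le_rfl).2 ?_) (rearrangement_nonneg f x)
  exact prob_le_one.trans (ENNReal.one_le_ofReal.2 hx)

theorem aestronglyMeasurable_rearrangement (f : C(𝕋, ℂ)) (s : ℝ) :
    AEStronglyMeasurable (fun t => (rearrangement f (s * unitAngle t) : ℂ)) m :=
  (Complex.measurable_ofReal.comp ((rearrangement_antitone f).measurable.comp
    (measurable_unitAngle.const_mul s))).aestronglyMeasurable

theorem fnrm_rearrangement (hri : IsRearrangementInvariant X) (f : C(𝕋, ℂ)) :
    X.fnrm (fun t => (rearrangement f (unitAngle t) : ℂ)) = X.fnrm f := by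
  have hm := aestronglyMeasurable_rearrangement f 1
  simp only [one_mul] at hm
  refine hri.fnrm_eq hm (aestronglyMeasurable_continuousMap f) fun r hr => ?_
  set d := (m {t | r < ‖f t‖}).toReal
  have hd : m {t | r < ‖f t‖} = ENNReal.ofReal d :=
    (ENNReal.ofReal_toReal (measure_ne_top _ _)).symm
  rw [hd, ← measure_unitAngle_lt (x := d) measureReal_le_one]
  congr 1
  ext t
  have h0 := (unitAngle_mem t).1
  simp only [Set.mem_ofPred_eq, Complex.norm_real,
    Real.norm_of_nonneg (rearrangement_nonneg f _)]
  rw [← not_le, rearrangement_le_iff f _ hr, hd, ENNReal.ofReal_le_ofReal_iff h0, not_le]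

/-- The rearrangement vanishes on `[1, ∞)`, which agrees with the extension by zero in the dilation
operator. -/
theorem fnrm_rearrangement_dilation_le (hX : IsBanachFunctionSpace X)
    (hri : IsRearrangementInvariant X) (f : C(𝕋, ℂ)) {s : ℝ} (hs : 0 < s) :
    X.fnrm (fun t => (rearrangement f (s * unitAngle t) : ℂ)) ≤ dilationNorm X s * X.fnrm f := by
  rw [← fnrm_rearrangement hri f]
  refine le_trans (le_of_eq ?_) (fnrm_dilationFun_le hs ?_)
  · congr 1; ext t
    rw [dilationFun_comp_unitAngle hs (fun x => (rearrangement f x : ℂ))]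
    split_ifs with h
    · rfl
    · rw [rearrangement_eq_zero f (not_lt.1 h)]; simp
  · rw [fnrm_rearrangement hri]; exact hX.fnrm_continuous_lt_top f

/-! ### Interpolation -/

theorem tsum_rpow_le_rpow_tsum {p : ℝ} (hp : 1 ≤ p) (a : ℕ → ℝ≥0∞) :
    ∑' j, a j ^ p ≤ (∑' j, a j) ^ p := by
  set S := ∑' j, a j
  have hsplit : ∀ x : ℝ≥0∞, x ^ p = x * x ^ (p - 1) := fun x => by
    have := ENNReal.rpow_add_of_nonneg (x := x) 1 (p - 1) zero_le_one (by linarith)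
    rwa [add_sub_cancel, ENNReal.rpow_one] at this
  calc ∑' j, a j ^ p ≤ ∑' j, a j * S ^ (p - 1) := by
        refine ENNReal.tsum_le_tsum fun j => ?_
        rw [hsplit]
        gcongr
        · exact ENNReal.le_tsum j
    _ = S ^ p := by rw [ENNReal.tsum_mul_right, ← hsplit]

/-- The layer `f*(R^{-j} x) < |f| ≤ f*(R^{-j-1} x)` has measure at most `R^{-j} x`. Such layers
cover the large part up to a null set. -/
theorem lintegral_large_part_le (f : C(𝕋, ℂ)) {R x p : ℝ} (hR : 1 < R) (hp : 0 < p) :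
    ∫⁻ t, ‖{t | rearrangement f x < ‖f t‖}.indicator f t‖ₑ ^ p ∂m ≤
      ∑' j : ℕ, ENNReal.ofReal (rearrangement f (R⁻¹ ^ (j + 1) * x)) ^ p *
        ENNReal.ofReal (R⁻¹ ^ j * x) := by
  let l : ℕ → ℝ := fun j => rearrangement f (R⁻¹ ^ j * x)
  have hl0 : l 0 = rearrangement f x := by simp [l]
  have hm : ∀ j, MeasurableSet {t | l j < ‖f t‖} := fun j =>
    measurableSet_lt measurable_const f.continuous.norm.measurable
  have hml : ∀ j, m {t | l j < ‖f t‖} ≤ ENNReal.ofReal (R⁻¹ ^ j * x) := fun j =>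
    measure_rearrangement_lt_le f _
  have hnull : m (⋂ j, {t | l j < ‖f t‖}) = 0 := by
    have hlim : Tendsto (fun j : ℕ => ENNReal.ofReal (R⁻¹ ^ j * x)) atTop (𝓝 0) := by
      have h1 := (tendsto_pow_atTop_nhds_zero_of_lt_one (inv_nonneg.2 (by linarith))
        (inv_lt_one_of_one_lt₀ hR)).mul_const x
      rw [zero_mul] at h1
      simpa [Function.comp_def] using (ENNReal.continuous_ofReal.tendsto 0).comp h1
    exact le_antisymm (ge_of_tendsto' hlim fun j =>
      (measure_mono (Set.iInter_subset _ j)).trans (hml j)) zero_le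
  calc _ ≤ ∫⁻ t, ∑' j : ℕ, {t | l j < ‖f t‖}.indicator
          (fun _ => ENNReal.ofReal (l (j + 1)) ^ p) t ∂m := by
        refine lintegral_mono_ae ?_
        filter_upwards [measure_eq_zero_iff_ae_notMem.1 hnull] with t ht
        by_cases h : rearrangement f x < ‖f t‖
        · have hex : ∃ j, ‖f t‖ ≤ l j := by
            by_contra! hc
            exact ht (Set.mem_iInter.2 hc)
          classical
          have hj := Nat.find_spec hex
          have hmin := fun j => Nat.find_min hex (m := j)
          obtain ⟨i, hi⟩ : ∃ i, Nat.find hex = i + 1 := by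
            refine Nat.exists_eq_succ_of_ne_zero fun h0 => ?_
            rw [h0, hl0] at hj
            exact h.not_ge hj
          rw [hi] at hj hmin
          refine le_trans ?_ (ENNReal.le_tsum i)
          have h1 : l i < ‖f t‖ := not_le.1 (hmin i (by omega))
          simp only [Set.indicator, Set.mem_ofPred_eq, h, h1, if_true]
          rw [← ofReal_norm]
          exact ENNReal.rpow_le_rpow (ENNReal.ofReal_le_ofReal hj) hp.le
        · simp [Set.indicator, h, hp]
    _ ≤ _ := by
        rw [lintegral_tsum fun j => (measurable_const.indicator (hm j)).aemeasurable]
        refine ENNReal.tsum_le_tsum fun j => ?_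
        rw [lintegral_indicator (hm j), setLIntegral_const]
        gcongr
        exact hml j

/-- Here the layers are `f*(R^{j+1} x) < |f| ≤ f*(R^j x)`, of measure at most `R^{j+1} x`. They
exhaust the nonzero values because `f*` vanishes beyond `1`. -/
theorem lintegral_small_part_le (f : C(𝕋, ℂ)) {R x q : ℝ} (hR : 1 < R) (hx : 0 < x) (hq : 0 < q) :
    ∫⁻ t, ‖f t - {t | rearrangement f x < ‖f t‖}.indicator f t‖ₑ ^ q ∂m ≤
      ∑' j : ℕ, ENNReal.ofReal (rearrangement f (R ^ j * x)) ^ q *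
        ENNReal.ofReal (R ^ (j + 1) * x) := by
  let l : ℕ → ℝ := fun j => rearrangement f (R ^ j * x)
  have hl0 : l 0 = rearrangement f x := by simp [l]
  have hm : ∀ j, MeasurableSet {t | l j < ‖f t‖} := fun j =>
    measurableSet_lt measurable_const f.continuous.norm.measurable
  have hml : ∀ j, m {t | l j < ‖f t‖} ≤ ENNReal.ofReal (R ^ j * x) := fun j =>
    measure_rearrangement_lt_le f _
  calc _ ≤ ∫⁻ t, ∑' j : ℕ, {t | l (j + 1) < ‖f t‖}.indicator
          (fun _ => ENNReal.ofReal (l j) ^ q) t ∂m := by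
        refine lintegral_mono fun t => ?_
        by_cases h : rearrangement f x < ‖f t‖
        · simp [Set.indicator, h, hq]
        rcases (norm_nonneg (f t)).eq_or_lt with h0 | h0
        · have : f t = 0 := norm_eq_zero.1 h0.symm
          simp [Set.indicator, this, hq]
        have hex : ∃ j, l j < ‖f t‖ := by
          obtain ⟨j, hj⟩ := pow_unbounded_of_one_lt x⁻¹ hR
          refine ⟨j, ?_⟩
          have h1 : 1 ≤ R ^ j * x := by
            have := mul_le_mul_of_nonneg_right hj.le hx.le
            rwa [inv_mul_cancel₀ hx.ne'] at this
          simp only [l]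
          rwa [rearrangement_eq_zero f h1]
        classical
        have hj := Nat.find_spec hex
        have hmin := fun j => Nat.find_min hex (m := j)
        obtain ⟨i, hi⟩ : ∃ i, Nat.find hex = i + 1 := by
          refine Nat.exists_eq_succ_of_ne_zero fun h0 => ?_
          rw [h0, hl0] at hj
          exact h hj
        rw [hi] at hj hmin
        refine le_trans ?_ (ENNReal.le_tsum i)
        have h1 : ‖f t‖ ≤ l i := not_lt.1 (hmin i (by omega))
        simp only [Set.indicator, Set.mem_ofPred_eq, h, hj, if_true, if_false, sub_zero]
        rw [← ofReal_norm]
        exact ENNReal.rpow_le_rpow (ENNReal.ofReal_le_ofReal h1) hq.le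
    _ ≤ _ := by
        rw [lintegral_tsum fun j => (measurable_const.indicator (hm _)).aemeasurable]
        refine ENNReal.tsum_le_tsum fun j => ?_
        rw [lintegral_indicator (hm _), setLIntegral_const]
        gcongr
        exact hml _

theorem ofReal_pow_eq_rpow {R y : ℝ} (hR : 0 < R) (hy : y ≠ 0) (j : ℕ) :
    ENNReal.ofReal (R ^ j) = ENNReal.ofReal (R ^ ((j : ℝ) / y)) ^ y := by
  rw [ENNReal.ofReal_rpow_of_pos (by positivity), ← Real.rpow_mul hR.le, div_mul_cancel₀ _ hy,
    Real.rpow_natCast]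

/-- Pointwise bound for the rearrangement of the analytic part. -/
theorem exists_rearrangement_analyticPart_le {k : ℕ} (hk : 0 < k) {R : ℝ} (hR : 1 < R) :
    ∃ D : ℝ, 0 ≤ D ∧ ∀ (c : ℤ →₀ ℂ) (x : ℝ), 0 < x →
      ENNReal.ofReal (rearrangement (trigPoly (analyticPart c)) x) ≤
        ENNReal.ofReal D * ∑' j : ℕ,
          (ENNReal.ofReal (R⁻¹ ^ ((j : ℝ) / Real.conjExponent (2 * k))) *
            ENNReal.ofReal (rearrangement (trigPoly c) (R⁻¹ ^ (j + 1) * x)) +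
          ENNReal.ofReal (R ^ ((j : ℝ) / (2 * k))) *
            ENNReal.ofReal (rearrangement (trigPoly c) (R ^ j * x))) := by
  obtain ⟨C, hC, hW⟩ := exists_measure_analyticPart_le hk
  have hR0 : 0 < R := one_pos.trans hR
  have hq1 : (1 : ℝ) < 2 * k := by
    have : (1 : ℝ) ≤ k := by exact_mod_cast hk
    linarith
  set q : ℝ := 2 * k
  have hpq : (Real.conjExponent q).HolderConjugate q := (Real.HolderConjugate.conjExponent hq1).symm
  set p := Real.conjExponent q
  have hp1 : 1 < p := hpq.lt
  -- At a level `l ≥ D (S₁ + S₂)` the weak type bound is at most `x (C + C R) / D ≤ x`. The summand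
  -- `1` makes `D ≥ 1`, so that `D^{-r} ≤ D⁻¹` for both exponents.
  let D : ℝ≥0∞ := C + C * ENNReal.ofReal R + 1
  have hD : D ≠ ∞ := ENNReal.add_ne_top.2 ⟨ENNReal.add_ne_top.2
    ⟨hC, ENNReal.mul_ne_top hC ENNReal.ofReal_ne_top⟩, ENNReal.one_ne_top⟩
  have hD1 : 1 ≤ D := le_add_self
  have hD0 : D ≠ 0 := (one_pos.trans_le hD1).ne'
  refine ⟨(2 * D).toReal, ENNReal.toReal_nonneg, fun c x hx => ?_⟩
  rw [ENNReal.ofReal_toReal (ENNReal.mul_ne_top (by simp) hD), ENNReal.tsum_add]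
  set f := trigPoly c
  set S₁ := ∑' j : ℕ, ENNReal.ofReal (R⁻¹ ^ ((j : ℝ) / p)) *
    ENNReal.ofReal (rearrangement f (R⁻¹ ^ (j + 1) * x))
  set S₂ := ∑' j : ℕ, ENNReal.ofReal (R ^ ((j : ℝ) / q)) *
    ENNReal.ofReal (rearrangement f (R ^ j * x))
  set f₁ : 𝕋 → ℂ := {t | rearrangement f x < ‖f t‖}.indicator f
  have hf₁ : AEStronglyMeasurable f₁ m := (aestronglyMeasurable_continuousMap f).indicator
    (measurableSet_lt measurable_const f.continuous.norm.measurable)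
  have hI₁ : ∫⁻ t, ‖f₁ t‖ₑ ^ p ∂m ≤ ENNReal.ofReal x * S₁ ^ p := by
    refine (lintegral_large_part_le f hR (by linarith)).trans ?_
    refine le_trans (le_of_eq ?_) (mul_le_mul_right (tsum_rpow_le_rpow_tsum hp1.le _) _)
    rw [← ENNReal.tsum_mul_left]
    congr 1; ext j
    rw [ENNReal.ofReal_mul (by positivity), ENNReal.mul_rpow_of_nonneg _ _ (by linarith),
      ofReal_pow_eq_rpow (inv_pos.2 hR0) (by linarith : p ≠ 0)]
    ring
  have hI₂ : ∫⁻ t, ‖f t - f₁ t‖ₑ ^ q ∂m ≤ ENNReal.ofReal x * ENNReal.ofReal R * S₂ ^ q := by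
    refine (lintegral_small_part_le f hR hx (by linarith)).trans ?_
    refine le_trans (le_of_eq ?_) (mul_le_mul_right (tsum_rpow_le_rpow_tsum hq1.le _) _)
    rw [← ENNReal.tsum_mul_left]
    congr 1; ext j
    rw [ENNReal.ofReal_mul (by positivity), ENNReal.mul_rpow_of_nonneg _ _ (by linarith), pow_succ,
      ENNReal.ofReal_mul (by positivity), ofReal_pow_eq_rpow hR0 (by linarith : q ≠ 0)]
    ring
  have hkey : ∀ l : ℝ, 0 < l → D * (S₁ + S₂) ≤ ENNReal.ofReal l →
      ENNReal.ofReal (rearrangement (trigPoly (analyticPart c)) x) ≤ 2 * ENNReal.ofReal l := by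
    intro l hl hSl
    have hl0 : ENNReal.ofReal l ≠ 0 := by simpa using hl
    have hlt : ENNReal.ofReal l ≠ ∞ := ENNReal.ofReal_ne_top
    have hratio : ∀ (S : ℝ≥0∞) (r : ℝ), 1 ≤ r → S ≤ S₁ + S₂ →
        ENNReal.ofReal l ^ (-r) * S ^ r ≤ D⁻¹ := by
      intro S r hr hS
      have h1 : S / ENNReal.ofReal l ≤ D⁻¹ := by
        rw [ENNReal.div_le_iff hl0 hlt, mul_comm, ← div_eq_mul_inv, ENNReal.le_div_iff_mul_le (Or.inl hD0)
          (Or.inl hD), mul_comm]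
        exact (mul_le_mul_right hS D).trans hSl
      have h2 : ENNReal.ofReal l ^ (-r) * S ^ r = (S / ENNReal.ofReal l) ^ r := by
        rw [ENNReal.div_rpow_of_nonneg _ _ (by linarith), ENNReal.rpow_neg, div_eq_mul_inv,
          mul_comm]
      rw [h2]
      refine (ENNReal.rpow_le_rpow h1 (by linarith)).trans ?_
      have := ENNReal.rpow_le_rpow_of_exponent_ge (ENNReal.inv_le_one.2 hD1) hr
      rwa [ENNReal.rpow_one] at this
    have hm := hW c f₁ l ‖f‖ hl hf₁ fun t =>
      (norm_indicator_le_norm_self _ _).trans (f.norm_coe_le_norm t)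
    have hle : m {t | 2 * l < ‖trigPoly (analyticPart c) t‖} ≤ ENNReal.ofReal x := by
      refine hm.trans ?_
      calc _ ≤ C * ENNReal.ofReal l ^ (-p) * (ENNReal.ofReal x * S₁ ^ p) +
            C * ENNReal.ofReal l ^ (-q) * (ENNReal.ofReal x * ENNReal.ofReal R * S₂ ^ q) := by
              gcongr
        _ = ENNReal.ofReal x * (C * (ENNReal.ofReal l ^ (-p) * S₁ ^ p) +
            C * ENNReal.ofReal R * (ENNReal.ofReal l ^ (-q) * S₂ ^ q)) := by ring
        _ ≤ ENNReal.ofReal x * (C * D⁻¹ + C * ENNReal.ofReal R * D⁻¹) := by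
              gcongr
              · exact hratio _ _ hp1.le le_self_add
              · exact hratio _ _ hq1.le le_add_self
        _ ≤ ENNReal.ofReal x * 1 := by
              gcongr
              rw [← add_mul, ← div_eq_mul_inv]
              exact ENNReal.div_le_of_le_mul (by rw [one_mul]; exact le_self_add)
        _ = _ := mul_one _
    have h2 := (rearrangement_le_iff _ x (by positivity)).2 hle
    refine (ENNReal.ofReal_le_ofReal h2).trans (le_of_eq ?_)
    rw [ENNReal.ofReal_mul zero_le_two, ENNReal.ofReal_ofNat]
  rcases eq_or_ne (S₁ + S₂) ∞ with hS | hS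
  · rw [hS, ENNReal.mul_top (by simp [hD0])]; exact le_top
  have hDS : D * (S₁ + S₂) ≠ ∞ := ENNReal.mul_ne_top hD hS
  -- The level must be positive although the sums may vanish, hence the added `ε / 2`; the factor
  -- `2` in front of the level turns it into `ε`.
  refine ENNReal.le_of_forall_pos_le_add fun ε hε _ => ?_
  have hε' : (0 : ℝ) < (ε : ℝ) / 2 := by have : (0 : ℝ) < ε := hε; positivity
  refine (hkey ((D * (S₁ + S₂)).toReal + ε / 2) (by positivity) ?_).trans ?_
  · rw [ENNReal.ofReal_add ENNReal.toReal_nonneg hε'.le, ENNReal.ofReal_toReal hDS]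
    exact le_self_add
  · rw [ENNReal.ofReal_add ENNReal.toReal_nonneg hε'.le, ENNReal.ofReal_toReal hDS, mul_add,
      mul_assoc]
    gcongr
    rw [← ENNReal.ofReal_ofNat, ← ENNReal.ofReal_mul zero_le_two, mul_div_cancel₀ _ two_ne_zero,
      ENNReal.ofReal_coe_nnreal]

/-- The Riesz projection is bounded on trigonometric polynomials. -/
theorem exists_fnrm_analyticPart_le (hY : IsBanachFunctionSpace Y)
    (hri : IsRearrangementInvariant Y) (hB : HasNontrivialBoydIndices Y)
    (hF : HasFatouProperty Y) : ∃ C : ℝ≥0∞, C ≠ ∞ ∧ ∀ c : ℤ →₀ ℂ,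
      Y.fnrm (trigPoly (analyticPart c)) ≤ C * Y.fnrm (trigPoly c) := by
  obtain ⟨b, hb, R₁, hR₁, hbound₁⟩ := exists_dilationNorm_inv_le hB
  obtain ⟨a, ha, R₂, hR₂, hbound₂⟩ := exists_dilationNorm_le hB
  let R := max R₁ R₂
  have hR : 1 < R := lt_max_of_lt_left hR₁
  have hR0 : 0 < R := one_pos.trans hR
  -- For such `k`, `1 / (2k) < a` and `b < 1 / p = 1 - 1 / (2k)`. Hence the growth of the dilations
  -- is strictly beaten by the weights of the series, and the ratios `u` and `v` are below `1`.
  obtain ⟨k, hk⟩ := exists_nat_gt (max 1 (max (1 / a) (1 / (1 - b))))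
  have hk0 : 0 < k := by
    have : (0 : ℝ) < k := (one_pos.trans_le (le_max_left _ _)).trans hk
    exact_mod_cast this
  have hka : 1 / a < k := ((le_max_left _ _).trans (le_max_right _ _)).trans_lt hk
  have hkb : 1 / (1 - b) < k := ((le_max_right _ _).trans (le_max_right _ _)).trans_lt hk
  have hkR : (0 : ℝ) < k := by exact_mod_cast hk0
  have hk1 : (1 : ℝ) ≤ k := by exact_mod_cast hk0
  obtain ⟨D, hD0, hD⟩ := exists_rearrangement_analyticPart_le hk0 hR
  set p := Real.conjExponent (2 * k)
  have hpinv : 1 / p = 1 - 1 / (2 * k) := by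
    simp only [p, Real.conjExponent]
    have : (2 * k - 1 : ℝ) ≠ 0 := by linarith
    field_simp
  have hap : 1 / (2 * k : ℝ) < a := by
    rw [div_lt_iff₀ ha.1] at hka
    rw [div_lt_iff₀ (by positivity)]; linarith
  have hbp : b < 1 / p := by
    rw [div_lt_iff₀ (by linarith [hb.2])] at hkb
    have : 1 / (2 * k : ℝ) < 1 - b := by
      rw [div_lt_iff₀ (by positivity)]; linarith
    linarith
  let u : ℝ≥0∞ := ENNReal.ofReal (R ^ (b - 1 / p))
  let v : ℝ≥0∞ := ENNReal.ofReal (R ^ (1 / (2 * k) - a))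
  have hu : u < 1 := ENNReal.ofReal_lt_one.2 (Real.rpow_lt_one_of_one_lt_of_neg hR (by linarith))
  have hv : v < 1 := ENNReal.ofReal_lt_one.2 (Real.rpow_lt_one_of_one_lt_of_neg hR (by linarith))
  refine ⟨ENNReal.ofReal D * (ENNReal.ofReal (R ^ b) * (1 - u)⁻¹ + (1 - v)⁻¹), ?_, fun c => ?_⟩
  · refine ENNReal.mul_ne_top ENNReal.ofReal_ne_top (ENNReal.add_ne_top.2
      ⟨ENNReal.mul_ne_top ENNReal.ofReal_ne_top ?_, ?_⟩) <;>
    exact ENNReal.inv_ne_top.2 (tsub_pos_of_lt (by assumption)).ne'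
  set f := trigPoly c
  set F := trigPoly (analyticPart c)
  rw [← fnrm_rearrangement hri F]
  let w₁ : ℕ → ℝ := fun j => R⁻¹ ^ ((j : ℝ) / p)
  let w₂ : ℕ → ℝ := fun j => R ^ ((j : ℝ) / (2 * k))
  have hw₁ : ∀ j, 0 ≤ w₁ j := fun j => by positivity
  have hw₂ : ∀ j, 0 ≤ w₂ j := fun j => by positivity
  let A : ℕ → 𝕋 → ℂ := fun j t => (rearrangement f (R⁻¹ ^ (j + 1) * unitAngle t) : ℂ)
  let B : ℕ → 𝕋 → ℂ := fun j t => (rearrangement f (R ^ j * unitAngle t) : ℂ)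
  have hAm : ∀ j, AEStronglyMeasurable (A j) m := fun j => aestronglyMeasurable_rearrangement f _
  have hBm : ∀ j, AEStronglyMeasurable (B j) m := fun j => aestronglyMeasurable_rearrangement f _
  let G : ℕ → 𝕋 → ℂ := fun j => fun t => (D : ℂ) * ((w₁ j : ℂ) * A j t + (w₂ j : ℂ) * B j t)
  have hGm : ∀ j, AEStronglyMeasurable (G j) m := fun j =>
    (((hAm j).const_mul _).add ((hBm j).const_mul _)).const_mul _
  have henorm : ∀ r : ℝ, 0 ≤ r → ‖(r : ℂ)‖ₑ = ENNReal.ofReal r := fun r hr => by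
    rw [← ofReal_norm, Complex.norm_real, Real.norm_of_nonneg hr]
  have hAn : ∀ j, Y.fnrm (A j) ≤ ENNReal.ofReal (R ^ (((j : ℝ) + 1) * b)) * Y.fnrm f := by
    intro j
    refine (fnrm_rearrangement_dilation_le hY hri f (by positivity)).trans ?_
    gcongr
    have h1 : R₁ ≤ R ^ (j + 1) := (le_max_left _ _).trans (le_self_pow₀ hR.le (by omega))
    have := hbound₁ _ h1
    rw [one_div, ← inv_pow, ← Real.rpow_natCast R, ← Real.rpow_mul hR0.le] at this
    push_cast at this
    exact this
  have hBn : ∀ j, Y.fnrm (B j) ≤ ENNReal.ofReal (R ^ (-((j : ℝ) * a))) * Y.fnrm f := by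
    intro j
    -- The dilation bound holds only for parameters at least `R₂`; the undilated term `j = 0` is
    -- just the rearrangement of `f`.
    rcases Nat.eq_zero_or_pos j with rfl | hj
    · have : Y.fnrm (B 0) = Y.fnrm f := by
        simp only [B, pow_zero, one_mul]; exact fnrm_rearrangement hri f
      rw [this]; simp
    · refine (fnrm_rearrangement_dilation_le hY hri f (by positivity)).trans ?_
      gcongr
      have h1 : R₂ ≤ R ^ j := (le_max_right _ _).trans (le_self_pow₀ hR.le (by omega))
      have := hbound₂ _ h1
      rw [← Real.rpow_natCast, ← Real.rpow_mul hR0.le, mul_neg, Real.rpow_natCast] at this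
      exact this
  have hGn : ∀ j, Y.fnrm (G j) ≤
      ENNReal.ofReal D * (ENNReal.ofReal (R ^ b) * u ^ j + v ^ j) * Y.fnrm f := by
    intro j
    have hm : AEStronglyMeasurable (fun t => (w₁ j : ℂ) * A j t + (w₂ j : ℂ) * B j t) m :=
      ((hAm j).const_mul _).add ((hBm j).const_mul _)
    rw [fnrm_const_mul (D : ℂ) hm, henorm D hD0, mul_assoc]
    gcongr
    refine (fnrm_add_le (fun t => (w₁ j : ℂ) * A j t) (fun t => (w₂ j : ℂ) * B j t)).trans ?_
    rw [fnrm_const_mul _ (hAm j), fnrm_const_mul _ (hBm j), henorm _ (hw₁ j), henorm _ (hw₂ j),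
      add_mul]
    refine add_le_add ((mul_le_mul_right (hAn j) _).trans (le_of_eq ?_))
      ((mul_le_mul_right (hBn j) _).trans (le_of_eq ?_))
    · rw [← mul_assoc, ← ENNReal.ofReal_mul (hw₁ j), ← ENNReal.ofReal_pow (by positivity),
        ← ENNReal.ofReal_mul (by positivity)]
      congr 2
      simp only [w₁]
      rw [Real.inv_rpow hR0.le, ← Real.rpow_neg hR0.le, ← Real.rpow_add hR0, ← Real.rpow_natCast,
        ← Real.rpow_mul hR0.le, ← Real.rpow_add hR0]
      congr 1; ring
    · rw [← mul_assoc, ← ENNReal.ofReal_mul (hw₂ j), ← ENNReal.ofReal_pow (by positivity)]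
      congr 2
      simp only [w₂]
      rw [← Real.rpow_add hR0, ← Real.rpow_natCast, ← Real.rpow_mul hR0.le]
      congr 1; ring
  have hFm := aestronglyMeasurable_rearrangement F 1
  simp only [one_mul] at hFm
  refine (fnrm_le_tsum hY hF hFm hGm ?_).trans ?_
  · have hpos : ∀ᵐ t ∂m, unitAngle t ≠ 0 := by
      have := measurePreserving_unitAngle.measure_preimage (s := {0})
        (measurableSet_singleton 0).nullMeasurableSet
      have h0 : (volume.restrict (Set.Ico (0 : ℝ) 1)) {0} = 0 :=
        Measure.absolutelyContinuous_of_le Measure.restrict_le_self (by simp)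
      rw [h0] at this
      exact (measure_eq_zero_iff_ae_notMem.1 this).mono fun t ht => ht
    filter_upwards [hpos] with t ht
    have hx : 0 < unitAngle t := lt_of_le_of_ne (unitAngle_mem t).1 ht.symm
    rw [henorm _ (rearrangement_nonneg _ _)]
    refine (hD c (unitAngle t) hx).trans (le_of_eq ?_)
    rw [← ENNReal.tsum_mul_left]
    congr 1; ext j
    have h1 : G j t = ((D * (w₁ j * rearrangement f (R⁻¹ ^ (j + 1) * unitAngle t) +
        w₂ j * rearrangement f (R ^ j * unitAngle t)) : ℝ) : ℂ) := by
      simp only [G, A, B]; push_cast; ring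
    have hA0 := rearrangement_nonneg f (R⁻¹ ^ (j + 1) * unitAngle t)
    have hB0 := rearrangement_nonneg f (R ^ j * unitAngle t)
    have h2 := mul_nonneg (hw₁ j) hA0
    have h3 := mul_nonneg (hw₂ j) hB0
    rw [h1, henorm _ (mul_nonneg hD0 (add_nonneg h2 h3)), ENNReal.ofReal_mul hD0,
      ENNReal.ofReal_add h2 h3, ENNReal.ofReal_mul (hw₁ j), ENNReal.ofReal_mul (hw₂ j)]
  · refine (ENNReal.tsum_le_tsum hGn).trans (le_of_eq ?_)
    rw [ENNReal.tsum_mul_right, ENNReal.tsum_mul_left, ENNReal.tsum_add, ENNReal.tsum_mul_left,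
      ENNReal.tsum_geometric, ENNReal.tsum_geometric]

/-! ### Convergence in norm and almost everywhere -/

theorem exists_pos_le_fnrm_indicator (hX : IsBanachFunctionSpace X)
    (hri : IsRearrangementInvariant X) {δ : ℝ≥0∞} (hδ : 0 < δ) :
    ∃ κ : ℝ≥0∞, 0 < κ ∧ ∀ E, NullMeasurableSet E m → δ ≤ m E →
      κ ≤ X.fnrm (E.indicator fun _ => 1) := by
  rcases lt_or_ge 1 δ with h1 | h1
  · exact ⟨1, one_pos, fun E _ hE => (h1.not_ge (hE.trans prob_le_one)).elim⟩
  have hδt : δ ≠ ∞ := (h1.trans_lt ENNReal.one_lt_top).ne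
  refine ⟨X.fnrm ({t | unitAngle t < δ.toReal}.indicator fun _ => 1),
    pos_iff_ne_zero.2 fun h => ?_, fun E hE hle => ?_⟩
  · have h2 : ∀ᵐ t ∂m, t ∉ {t | unitAngle t < δ.toReal} := by
      filter_upwards [ae_eq_zero_of_fnrm h] with t ht hmem
      rw [Set.indicator_of_mem (s := {t | unitAngle t < δ.toReal}) hmem] at ht
      exact one_ne_zero ht
    have h3 := measure_eq_zero_iff_ae_notMem.2 h2
    rw [measure_unitAngle_lt (ENNReal.toReal_le_of_le_ofReal zero_le_one (by simpa using h1)),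
      ENNReal.ofReal_toReal hδt] at h3
    exact hδ.ne' h3
  · rw [fnrm_indicator_eq hri hE]
    exact fnrm_indicator_mono hX (nullMeasurableSet_unitAngle_lt _) fun t ht =>
      lt_of_lt_of_le ht (ENNReal.toReal_mono (measure_ne_top _ _) hle)

/-- Convergence in norm implies convergence in measure, because sets of measure at least `δ` have
indicators of norm bounded below. No embedding in `L¹` is presupposed, so the lemma applies to `X`
before that embedding is known. -/
theorem exists_seq_tendsto_ae_of_tendsto (hX : IsBanachFunctionSpace X)
    (hri : IsRearrangementInvariant X) {u : ℕ → X.space} {x : X.space}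
    (h : Tendsto u atTop (𝓝 x)) :
    ∃ ns : ℕ → ℕ, StrictMono ns ∧
      ∀ᵐ t ∂m, Tendsto (fun i => (u (ns i) : L0) t) atTop (𝓝 ((x : L0) t)) := by
  refine TendstoInMeasure.exists_seq_tendsto_ae (f := fun n t => (u n : L0) t)
    (g := fun t => (x : L0) t) ?_
  rw [tendstoInMeasure_iff_norm]
  intro ε hε
  rw [ENNReal.tendsto_nhds_zero]
  intro δ hδ
  obtain ⟨κ, hκ, hκE⟩ := exists_pos_le_fnrm_indicator hX hri hδ
  let d : ℕ → 𝕋 → ℂ := fun n t => (u n : L0) t - (x : L0) t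
  have hd : ∀ n, AEStronglyMeasurable (d n) m := fun n =>
    (u n : L0).aestronglyMeasurable.sub (x : L0).aestronglyMeasurable
  have hnorm : Tendsto (fun n => X.fnrm (d n)) atTop (𝓝 0) := by
    have h1 : Tendsto (fun n => ‖u n - x‖ₑ) atTop (𝓝 0) := by
      have := (tendsto_sub_nhds_zero_iff.2 h).enorm
      simpa using this
    refine h1.congr fun n => ?_
    exact enorm_eq_fnrm _ (coeFn_sub _ _)
  have hε2 : 0 < ENNReal.ofReal (ε / 2) * κ :=
    ENNReal.mul_pos (by simpa using hε) hκ.ne'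
  filter_upwards [hnorm.eventually (gt_mem_nhds hε2)] with n hn
  have hE : NullMeasurableSet {t | ε / 2 < ‖d n t‖} m :=
    nullMeasurableSet_lt aemeasurable_const (hd n).norm.aemeasurable
  refine (measure_mono (t := {t | ε / 2 < ‖d n t‖}) fun t ht => ?_).trans ?_
  · exact lt_of_lt_of_le (by linarith) (show ε ≤ ‖d n t‖ from ht)
  · by_contra! hlt
    have h1 := hκE _ hE hlt.le
    have h2 := ofReal_mul_fnrm_indicator_le hX (hd n) (by positivity : 0 ≤ ε / 2)
    exact ((mul_le_mul_right h1 _).trans h2).not_gt hn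

/-- Multiplication by `a ∈ M(X, Y)`. -/
def mulLinear {a : L0} (ha : a ∈ multipliers X Y) : X.space →ₗ[ℂ] Y.space where
  toFun f := ⟨a * f, ha f f.2⟩
  map_add' f g := by
    refine Subtype.ext (AEEqFun.ext ?_)
    filter_upwards [AEEqFun.coeFn_mul a ((f : L0) + g), AEEqFun.coeFn_add (f : L0) g,
      AEEqFun.coeFn_mul a (f : L0), AEEqFun.coeFn_mul a (g : L0),
      AEEqFun.coeFn_add (a * (f : L0)) (a * g)] with t h1 h2 h3 h4 h5
    change (a * ((f : L0) + g)) t = (a * (f : L0) + a * (g : L0)) t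
    rw [h1, h5]
    simp only [Pi.mul_apply, Pi.add_apply, h2, h3, h4]
    ring
  map_smul' c f := by
    refine Subtype.ext (AEEqFun.ext ?_)
    filter_upwards [AEEqFun.coeFn_mul a (c • (f : L0)), AEEqFun.coeFn_smul c (f : L0),
      AEEqFun.coeFn_mul a (f : L0), AEEqFun.coeFn_smul c (a * (f : L0))] with t h1 h2 h3 h4
    change (a * (c • (f : L0))) t = (c • (a * (f : L0))) t
    rw [h1, h4]
    simp only [Pi.mul_apply, Pi.smul_apply, h2, h3, smul_eq_mul]
    ring

theorem coeFn_mulLinear {a : L0} (ha : a ∈ multipliers X Y) (f : X.space) :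
    ((mulLinear ha f : L0) : 𝕋 → ℂ) =ᵐ[m] fun t => a t * (f : L0) t :=
  AEEqFun.coeFn_mul a (f : L0)

/-- Closed graph theorem: along a common subsequence both `u n` and `a u n` converge almost
everywhere, which identifies the limit. -/
theorem continuous_mulLinear (hX : IsBanachFunctionSpace X) (hY : IsBanachFunctionSpace Y)
    (hXri : IsRearrangementInvariant X) (hYri : IsRearrangementInvariant Y) {a : L0}
    (ha : a ∈ multipliers X Y) : Continuous (mulLinear ha) := by
  have := hX.complete
  have := hY.complete
  refine LinearMap.continuous_of_seq_closed_graph _ fun u x y hu hy => ?_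
  obtain ⟨ns, hns, hlim⟩ := exists_seq_tendsto_ae_of_tendsto hX hXri hu
  obtain ⟨ks, hks, hlim'⟩ := exists_seq_tendsto_ae_of_tendsto hY hYri
    (hy.comp hns.tendsto_atTop)
  refine Subtype.ext (AEEqFun.ext ?_)
  have hall : ∀ᵐ t ∂m, ∀ n, (mulLinear ha (u n) : L0) t = a t * (u n : L0) t :=
    ae_all_iff.2 fun n => coeFn_mulLinear ha (u n)
  filter_upwards [hlim, hlim', hall, coeFn_mulLinear ha x] with t h1 h2 h3 h4
  rw [h4]
  refine tendsto_nhds_unique h2 ?_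
  simp only [Function.comp_apply, h3]
  exact (h1.comp hks.tendsto_atTop).const_mul _

/-- Multiplication by `a ∈ M(X, Y)` as a bounded operator. -/
def mulCLM (hX : IsBanachFunctionSpace X) (hY : IsBanachFunctionSpace Y)
    (hXri : IsRearrangementInvariant X) (hYri : IsRearrangementInvariant Y) {a : L0}
    (ha : a ∈ multipliers X Y) : X.space →L[ℂ] Y.space :=
  ⟨mulLinear ha, continuous_mulLinear hX hY hXri hYri ha⟩

/-! ### Integrability and Fourier coefficients -/

/-- The space is continuously embedded in `L¹`. -/
def EmbedsInL1 (X : FunctionSpace) : Prop :=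
  ∃ C : ℝ≥0∞, C ≠ ∞ ∧ ∀ f : 𝕋 → ℂ, AEStronglyMeasurable f m → X.fnrm f < ∞ →
    ∫⁻ t, ‖f t‖ₑ ∂m ≤ C * X.fnrm f

theorem EmbedsInL1.integrable_of_fnrm (hL : EmbedsInL1 X) {f : 𝕋 → ℂ} (hf : X.fnrm f < ∞) :
    Integrable f m := by
  obtain ⟨C, hC, h⟩ := hL
  have hm := aestronglyMeasurable_of_fnrm_lt_top hf
  exact ⟨hm, (h f hm hf).trans_lt (ENNReal.mul_lt_top (lt_top_iff_ne_top.2 hC) hf)⟩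

theorem EmbedsInL1.integrable (hL : EmbedsInL1 X) (f : X.space) : Integrable (f : L0) m :=
  hL.integrable_of_fnrm (fnrm_lt_top_coe f)

/-- The inclusion of `X` in `Y` is multiplication by `1`, hence bounded. -/
theorem EmbedsInL1.of_le (hX : IsBanachFunctionSpace X) (hY : IsBanachFunctionSpace Y)
    (hXri : IsRearrangementInvariant X) (hYri : IsRearrangementInvariant Y)
    (hXY : X.space ≤ Y.space) (hL : EmbedsInL1 Y) : EmbedsInL1 X := by
  obtain ⟨C, hC, h⟩ := hL
  have h1 : (1 : L0) ∈ multipliers X Y := fun g hg => by rw [one_mul]; exact hXY hg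
  let T := mulCLM hX hY hXri hYri h1
  refine ⟨C * ‖T‖ₑ, ENNReal.mul_ne_top hC enorm_ne_top, fun f hf hfX => ?_⟩
  have hT : Y.fnrm f ≤ ‖T‖ₑ * X.fnrm f := by
    have h2 := T.le_opENorm (X.toSpace f hfX)
    rw [enorm_toSpace] at h2
    refine le_trans (le_of_eq ?_) h2
    refine (enorm_eq_fnrm _ ?_).symm
    filter_upwards [coeFn_mulLinear h1 (X.toSpace f hfX), coeFn_toSpace hfX,
      AEEqFun.coeFn_one (α := 𝕋) (μ := m) (β := ℂ)] with t h3 h4 h5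
    change (mulLinear h1 (X.toSpace f hfX) : L0) t = f t
    rw [h3, h4, h5]; simp
  have hfY : Y.fnrm f < ∞ := hT.trans_lt (ENNReal.mul_lt_top enorm_lt_top hfX)
  refine (h f hf hfY).trans ?_
  rw [mul_assoc]
  gcongr

theorem enorm_fourierCoeff_le (f : 𝕋 → ℂ) (n : ℤ) : ‖fourierCoeff f n‖ₑ ≤ ∫⁻ t, ‖f t‖ₑ ∂m := by
  refine (enorm_integral_le_lintegral_enorm _).trans (le_of_eq ?_)
  congr 1; ext t
  rw [smul_eq_mul, enorm_mul, ← ofReal_norm (fourier (-n) t), fourier_apply, Circle.norm_coe]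
  simp

theorem exists_coeffCLM (hL : EmbedsInL1 X) (n : ℤ) :
    ∃ φ : X.space →L[ℂ] ℂ, ∀ f : X.space, φ f = fourierCoeff (f : L0) n := by
  obtain ⟨C, hC, h⟩ := id hL
  let φ : X.space →ₗ[ℂ] ℂ :=
    { toFun := fun f => fourierCoeff (f : L0) n
      map_add' := fun f g => by
        have h : ((f + g : X.space) : L0) =ᵐ[m] ((f : L0) : 𝕋 → ℂ) + ((g : L0) : 𝕋 → ℂ) :=
          AEEqFun.coeFn_add _ _
        rw [fourierCoeff_congr_ae h,
          fourierCoeff.add (hL.integrable f) (hL.integrable g), Pi.add_apply]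
      map_smul' := fun c f => by
        have h : ((c • f : X.space) : L0) =ᵐ[m] c • ((f : L0) : 𝕋 → ℂ) := AEEqFun.coeFn_smul _ _
        rw [fourierCoeff_congr_ae h, fourierCoeff.const_smul]; rfl }
  refine ⟨φ.mkContinuous C.toReal fun f => ?_, fun f => rfl⟩
  have h1 := (enorm_fourierCoeff_le (f : L0) n).trans
    (h (f : L0) (f : L0).aestronglyMeasurable (fnrm_lt_top_coe f))
  rw [fnrm_coe, ← enorm_def] at h1
  have h2 := ENNReal.toReal_mono (ENNReal.mul_ne_top hC enorm_ne_top) h1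
  rw [ENNReal.toReal_mul] at h2
  simpa [φ] using h2

theorem continuous_fourierCoeff (hL : EmbedsInL1 X) (n : ℤ) :
    Continuous fun f : X.space => fourierCoeff (f : L0) n := by
  obtain ⟨φ, hφ⟩ := exists_coeffCLM hL n
  exact φ.continuous.congr hφ

theorem EmbedsInL1.ext (hL : EmbedsInL1 X) {f g : X.space}
    (h : ∀ n, fourierCoeff (f : L0) n = fourierCoeff (g : L0) n) : f = g :=
  Subtype.ext (AEEqFun.ext (ae_eq_of_fourierCoeff (hL.integrable f) (hL.integrable g) h))

theorem fourierCoeff_trigPoly (c : ℤ →₀ ℂ) (n : ℤ) : fourierCoeff (trigPoly c) n = c n := by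
  induction c using Finsupp.induction_linear with
  | zero => simp [fourierCoeff]
  | add c d hc hd =>
    rw [map_add, ContinuousMap.coe_add, fourierCoeff.add (integrable_continuousMap _)
      (integrable_continuousMap _), Pi.add_apply, hc, hd, Finsupp.add_apply]
  | single k a =>
    rw [trigPoly_single, ContinuousMap.coe_smul, fourierCoeff.const_smul,
      fourierCoeff_fourier, Finsupp.single_apply, Pi.single_apply]
    simp [eq_comm]

/-- Continuous functions as elements of `X`. -/
def ofContinuous (hX : IsBanachFunctionSpace X) : C(𝕋, ℂ) →ₗ[ℂ] X.space :=
  (ContinuousMap.toAEEqFunLinearMap m).codRestrict X.space fun g => by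
    rw [mem_space_iff, ← fnrm_coe]
    exact (fnrm_congr (ContinuousMap.coeFn_toAEEqFun m g)).trans_lt (hX.fnrm_continuous_lt_top g)

theorem coeFn_ofContinuous (hX : IsBanachFunctionSpace X) (g : C(𝕋, ℂ)) :
    ((ofContinuous hX g : L0) : 𝕋 → ℂ) =ᵐ[m] g := ContinuousMap.coeFn_toAEEqFun m g

theorem enorm_ofContinuous (hX : IsBanachFunctionSpace X) (g : C(𝕋, ℂ)) :
    ‖ofContinuous hX g‖ₑ = X.fnrm g := enorm_eq_fnrm _ (coeFn_ofContinuous hX g)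

/-- Trigonometric polynomials as elements of `X`. -/
def trigSpace (hX : IsBanachFunctionSpace X) : (ℤ →₀ ℂ) →ₗ[ℂ] X.space :=
  (ofContinuous hX).comp trigPoly

theorem coeFn_trigSpace (hX : IsBanachFunctionSpace X) (c : ℤ →₀ ℂ) :
    ((trigSpace hX c : L0) : 𝕋 → ℂ) =ᵐ[m] trigPoly c := coeFn_ofContinuous hX _

theorem coe_trigSpace_single (hX : IsBanachFunctionSpace X) (n : ℤ) :
    (trigSpace hX (Finsupp.single n 1) : L0) = χ n := by
  simp only [trigSpace, LinearMap.comp_apply, trigPoly_single, one_smul]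
  rfl

theorem enorm_trigSpace (hX : IsBanachFunctionSpace X) (c : ℤ →₀ ℂ) :
    ‖trigSpace hX c‖ₑ = X.fnrm (trigPoly c) := enorm_ofContinuous hX _

theorem fourierCoeff_trigSpace (hX : IsBanachFunctionSpace X) (c : ℤ →₀ ℂ) (n : ℤ) :
    fourierCoeff (trigSpace hX c : L0) n = c n := by
  rw [fourierCoeff_congr_ae (coeFn_trigSpace hX c), fourierCoeff_trigPoly]

theorem denseRange_trigSpace (hX : IsBanachFunctionSpace X)
    (hsep : TopologicalSpace.SeparableSpace X.space) : DenseRange (trigSpace hX) := by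
  intro f
  rw [EMetric.mem_closure_iff]
  intro ε hε
  obtain ⟨c, hc⟩ := exists_fnrm_sub_trigPoly_le hX hsep (fnrm_lt_top_coe f)
    (ε := min (ε / 2) 1) (lt_min (ENNReal.half_pos hε.ne') one_pos)
  refine ⟨trigSpace hX c, ⟨c, rfl⟩, ?_⟩
  rw [edist_eq_enorm_sub, enorm_eq_fnrm _ ((coeFn_sub _ _).trans
    ((ae_eq_refl _).sub (coeFn_trigSpace hX c)))]
  refine hc.trans_lt ?_
  rcases eq_or_ne ε ∞ with rfl | h
  · exact (min_le_right _ _).trans_lt ENNReal.one_lt_top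
  · exact (min_le_left _ _).trans_lt (ENNReal.half_lt_self hε.ne' h)

/-- The Riesz projection on a space with nontrivial Boyd indices. -/
theorem exists_rieszProjection (hY : IsBanachFunctionSpace Y)
    (hri : IsRearrangementInvariant Y) (hsep : TopologicalSpace.SeparableSpace Y.space)
    (hB : HasNontrivialBoydIndices Y) (hF : HasFatouProperty Y) :
    ∃ P : Y.space →L[ℂ] Y.space, IsRieszProjection P := by
  have hL : EmbedsInL1 Y := exists_lintegral_norm_le hY hri hB
  obtain ⟨C, hC, h⟩ := exists_fnrm_analyticPart_le hY hri hB hF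
  have := hY.complete
  let A : (ℤ →₀ ℂ) →ₗ[ℂ] Y.space := (trigSpace hY).comp analyticPart
  have hA : ∃ K, ∀ c, ‖A c‖ ≤ K * ‖trigSpace hY c‖ := by
    refine ⟨C.toReal, fun c => ?_⟩
    have h1 := h c
    rw [← enorm_trigSpace hY, ← enorm_trigSpace hY] at h1
    have h2 := ENNReal.toReal_mono (ENNReal.mul_ne_top hC enorm_ne_top) h1
    rw [ENNReal.toReal_mul] at h2
    simpa [A] using h2
  have hdense := denseRange_trigSpace hY hsep
  refine ⟨A.extendOfNorm (trigSpace hY), fun f => ⟨hL.integrable _, hL.integrable _, fun n => ?_⟩⟩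
  have key : (fun f : Y.space => fourierCoeff ((A.extendOfNorm (trigSpace hY) f : Y.space) : L0) n) =
      fun f : Y.space => if 0 ≤ n then fourierCoeff (f : L0) n else 0 := by
    refine hdense.equalizer ((continuous_fourierCoeff hL n).comp (ContinuousLinearMap.continuous _))
      ?_ (funext fun c => ?_)
    · split_ifs
      · exact continuous_fourierCoeff hL n
      · exact continuous_const
    · simp only [Function.comp_apply]
      rw [LinearMap.extendOfNorm_eq hdense hA, fourierCoeff_trigSpace]
      change fourierCoeff (trigSpace hY (analyticPart c) : L0) n = _
      rw [fourierCoeff_trigSpace]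
      exact Finsupp.filter_apply _ _ _
  exact congrFun key f

/-! ### Density of analytic polynomials in the Hardy space -/

theorem fnrm_translate (hri : IsRearrangementInvariant X) (g : C(𝕋, ℂ)) (s : 𝕋) :
    X.fnrm (fun t => g (t + s)) = X.fnrm g := by
  have hmp : MeasurePreserving (fun t : 𝕋 => t + s) m m := measurePreserving_add_right m s
  refine hri.fnrm_eq (g.continuous.comp (continuous_add_const s)).aestronglyMeasurable
    (aestronglyMeasurable_continuousMap g) fun r _ => ?_
  exact hmp.measure_preimage (s := {t | r < ‖g t‖})
    (measurableSet_lt measurable_const g.continuous.norm.measurable).nullMeasurableSet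

/-- If `ℓ` is a functional on `X`, then `s ↦ ℓ (f (· + s))` is a continuous function with
Fourier coefficients `ℓ(χₙ) f̂(n)`. -/
theorem exists_translation_transform (hX : IsBanachFunctionSpace X)
    (hri : IsRearrangementInvariant X) (hsep : TopologicalSpace.SeparableSpace X.space)
    (hL : EmbedsInL1 X) (φ : X.space →L[ℂ] ℂ) :
    ∃ Ψ : X.space →L[ℂ] C(𝕋, ℂ), (∀ f, Ψ f 0 = φ f) ∧
      ∀ f n, fourierCoeff (Ψ f) n =
        fourierCoeff (f : L0) n * φ (trigSpace hX (Finsupp.single n 1)) := by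
  let w : ℤ → ℂ := fun n => φ (trigSpace hX (Finsupp.single n 1))
  have hw : ∀ n a, φ (trigSpace hX (Finsupp.single n a)) = a * w n := fun n a => by
    have : Finsupp.single n a = a • Finsupp.single n (1 : ℂ) := by simp
    rw [this, map_smul, map_smul, smul_eq_mul]
  -- On trigonometric polynomials `S c` is the transform itself, `τ s` being translation by `s` on
  -- coefficients. Translations preserve the norm of `X`, so the sup norm of `S c` is at most `‖φ‖`
  -- times the norm of the polynomial, and `S` extends by density.
  let S : (ℤ →₀ ℂ) →ₗ[ℂ] C(𝕋, ℂ) := Finsupp.linearCombination ℂ fun n => w n • fourier n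
  let τ : 𝕋 → (ℤ →₀ ℂ) →ₗ[ℂ] (ℤ →₀ ℂ) := fun s =>
    Finsupp.linearCombination ℂ fun n => Finsupp.single n (fourier n s)
  have hτ : ∀ s c t, trigPoly (τ s c) t = trigPoly c (t + s) := by
    intro s c t
    induction c using Finsupp.induction_linear with
    | zero => simp
    | add c d hc hd => simp only [map_add, ContinuousMap.add_apply, hc, hd]
    | single n a =>
      have h1 : fourier n (t + s) = fourier n t * fourier n s := by
        simp only [fourier_apply, smul_add, AddCircle.toCircle_add, Circle.coe_mul]
      simp only [τ, Finsupp.linearCombination_single, map_smul, trigPoly_single,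
        ContinuousMap.smul_apply, h1, smul_eq_mul]
      ring
  have hS : ∀ c s, S c s = φ (trigSpace hX (τ s c)) := by
    intro c s
    induction c using Finsupp.induction_linear with
    | zero => simp
    | add c d hc hd => simp only [map_add, ContinuousMap.add_apply, hc, hd]
    | single n a =>
      simp only [τ, S, Finsupp.linearCombination_single, map_smul, ContinuousMap.smul_apply, hw,
        smul_eq_mul]
      ring
  have hScoeff : ∀ c n, fourierCoeff (S c) n = c n * w n := by
    intro c n
    induction c using Finsupp.induction_linear with
    | zero => simp [fourierCoeff]
    | add c d hc hd =>
      rw [map_add, ContinuousMap.coe_add, fourierCoeff.add (integrable_continuousMap _)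
        (integrable_continuousMap _), Pi.add_apply, hc, hd, Finsupp.add_apply, add_mul]
    | single k a =>
      simp only [S, Finsupp.linearCombination_single]
      rw [ContinuousMap.coe_smul, ContinuousMap.coe_smul, fourierCoeff.const_smul,
        fourierCoeff.const_smul, fourierCoeff_fourier, Finsupp.single_apply, Pi.single_apply]
      by_cases h : k = n
      · subst h; simp
      · simp [h, Ne.symm h]
  have hbound : ∃ K, ∀ c, ‖S c‖ ≤ K * ‖trigSpace hX c‖ := by
    refine ⟨‖φ‖, fun c => (ContinuousMap.norm_le _ (by positivity)).2 fun s => ?_⟩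
    rw [hS]
    refine (φ.le_opNorm _).trans (le_of_eq ?_)
    have h1 : ‖trigSpace hX (τ s c)‖ₑ = ‖trigSpace hX c‖ₑ := by
      rw [enorm_trigSpace, enorm_trigSpace, ← fnrm_translate hri (trigPoly c) s]
      congr 1; ext t; exact hτ s c t
    have h2 := congrArg ENNReal.toReal h1
    simp only [toReal_enorm] at h2
    rw [h2]
  have hdense := denseRange_trigSpace hX hsep
  have hext := fun c => LinearMap.extendOfNorm_eq hdense hbound c
  refine ⟨S.extendOfNorm (trigSpace hX), fun f => ?_, fun f n => ?_⟩
  · refine congrFun (hdense.equalizer (g := fun f => S.extendOfNorm (trigSpace hX) f 0) (h := φ)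
      ((continuous_eval_const (0 : 𝕋)).comp (ContinuousLinearMap.continuous _))
      φ.continuous (funext fun c => ?_)) f
    simp only [Function.comp_apply]
    rw [hext, hS]
    congr 2
    have : τ 0 = LinearMap.id := by
      ext n : 1
      ext
      simp [τ]
    rw [this]; rfl
  · have hc : Continuous fun g : C(𝕋, ℂ) => fourierCoeff g n := by
      have h1 : ∀ g : C(𝕋, ℂ), fourierCoeff g n =
          ∫ t, (fourier (-n) * g : C(𝕋, ℂ)) t ∂m := fun g => rfl
      simp_rw [h1]
      have h2 : Continuous fun g : C(𝕋, ℂ) => ContinuousMap.toLp (E := ℂ) 1 m ℂ (fourier (-n) * g) :=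
        (ContinuousMap.toLp (E := ℂ) 1 m ℂ).continuous.comp (continuous_const.mul continuous_id)
      refine (continuous_integral.comp h2).congr fun g => ?_
      exact integral_congr_ae (ContinuousMap.coeFn_toLp m _)
    refine congrFun (hdense.equalizer
      (g := fun f => fourierCoeff (S.extendOfNorm (trigSpace hX) f) n)
      (h := fun f : X.space => fourierCoeff (f : L0) n * w n)
      (hc.comp (ContinuousLinearMap.continuous _))
      ((continuous_fourierCoeff hL n).mul continuous_const) (funext fun c => ?_)) f
    simp only [Function.comp_apply]
    rw [hext, hScoeff, fourierCoeff_trigSpace]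

/-- A bounded operator on `H[X]` is determined by its values at `χⱼ`, `j ≥ 0`. -/
theorem eq_zero_of_hardyχ (hX : IsBanachFunctionSpace X)
    (hri : IsRearrangementInvariant X) (hsep : TopologicalSpace.SeparableSpace X.space)
    (hL : EmbedsInL1 X) {E : Type*} [NormedAddCommGroup E] [NormedSpace ℂ E]
    (B : hardy X →L[ℂ] E) (hB : ∀ j : ℕ, B (hardyχ hX j) = 0) : B = 0 := by
  ext f
  refine SeparatingDual.eq_zero_of_forall_dual_eq_zero (R := ℂ) fun ψ => ?_
  -- Hahn–Banach carries the functional to all of `X`, where translates of trigonometric polynomials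
  -- are available. The coefficients of `Ψ f` vanish for `n ≥ 0` by the hypothesis on `B`, and for
  -- `n < 0` because `f` is analytic.
  obtain ⟨φ, hφ, -⟩ := exists_extension_norm_eq (hardy X) (ψ.comp B)
  obtain ⟨Ψ, hΨ0, hΨ⟩ := exists_translation_transform hX hri hsep hL φ
  have hzero : ∀ n, fourierCoeff (Ψ f) n = 0 := by
    intro n
    rw [hΨ]
    by_cases hn : 0 ≤ n
    · obtain ⟨j, rfl⟩ := Int.eq_ofNat_of_zero_le hn
      have h1 : trigSpace hX (Finsupp.single (j : ℤ) 1) = (hardyχ hX j : X.space) :=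
        Subtype.ext (coe_trigSpace_single hX j)
      rw [h1, hφ]
      simp [hB]
    · rw [f.2.2 n (not_le.1 hn), zero_mul]
  have h0 := (Continuous.ae_eq_iff_eq m (Ψ f).continuous continuous_zero).1
    (ae_eq_zero_of_fourierCoeff (integrable_continuousMap _) hzero)
  have h1 : φ (f : X.space) = 0 := by rw [← hΨ0, h0]; rfl
  rwa [hφ] at h1

/-! ### Weak limits -/

/-- Banach–Alaoglu along an ultrafilter, which avoids passing to subsequences. -/
theorem exists_weak_limit {H : Type*} [NormedAddCommGroup H] [InnerProductSpace ℂ H]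
    [CompleteSpace H] (U : Ultrafilter ℕ) {x : ℕ → H} {K : ℝ} (hx : ∀ n, ‖x n‖ ≤ K) :
    ∃ a : H, ∀ g, Tendsto (fun n => inner ℂ g (x n)) U (𝓝 (inner ℂ g a)) := by
  let y : ℕ → WeakDual ℂ H := fun n => StrongDual.toWeakDual (InnerProductSpace.toDual ℂ H (x n))
  have hcomp := WeakDual.isCompact_closedBall (𝕜 := ℂ) (E := H) 0 K
  obtain ⟨φ, -, hφ⟩ := hcomp.ultrafilter_le_nhds (U.map y) (by
    rw [le_principal_iff]
    refine Eventually.of_forall (f := (U : Filter ℕ)) fun n => ?_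
    have : InnerProductSpace.toDual ℂ H (x n) ∈ Metric.closedBall (0 : StrongDual ℂ H) K := by
      rw [mem_closedBall_zero_iff, LinearIsometryEquiv.norm_map]; exact hx n
    exact this)
  refine ⟨(InnerProductSpace.toDual ℂ H).symm (WeakDual.toStrongDual φ), fun g => ?_⟩
  have h1 : Tendsto (fun n => inner ℂ (x n) g) U (𝓝 (φ g)) := by
    have h2 : Tendsto y U (𝓝 φ) := hφ
    exact ((WeakDual.eval_continuous g).tendsto φ).comp h2
  have h3 := (Complex.continuous_conj.tendsto _).comp h1
  have h4 : φ g = inner ℂ ((InnerProductSpace.toDual ℂ H).symm (WeakDual.toStrongDual φ)) g := by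
    rw [InnerProductSpace.toDual_symm_apply]; rfl
  rw [h4, inner_conj_symm] at h3
  refine h3.congr fun n => ?_
  simp [inner_conj_symm]

/-- Mazur's theorem: a point outside a closed convex set is strictly separated from it by a
functional, and functionals pass to the weak limit. -/
theorem weak_limit_mem {H : Type*} [NormedAddCommGroup H] [InnerProductSpace ℂ H]
    [CompleteSpace H] {U : Ultrafilter ℕ} {x : ℕ → H} {a : H}
    (hlim : ∀ g, Tendsto (fun n => inner ℂ g (x n)) U (𝓝 (inner ℂ g a)))
    {S : Set H} (hconv : Convex ℝ S) (hclosed : IsClosed S) (hx : ∀ n, x n ∈ S) : a ∈ S := by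
  by_contra ha
  obtain ⟨f, u, hfS, hfa⟩ := RCLike.geometric_hahn_banach_closed_point (𝕜 := ℂ) hconv hclosed ha
  have hf : ∀ z, f z = inner ℂ ((InnerProductSpace.toDual ℂ H).symm f) z := fun z => by
    rw [InnerProductSpace.toDual_symm_apply]
  have h1 : Tendsto (fun n => RCLike.re (f (x n))) U (𝓝 (RCLike.re (f a))) := by
    simp_rw [hf]
    exact (RCLike.continuous_re.tendsto _).comp (hlim _)
  exact (le_of_tendsto' h1 fun n => (hfS _ (hx n)).le).not_gt hfa

/-- Weak limits in `L²` do not increase a seminorm with the Fatou property. -/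
theorem weak_limit_le {N : (𝕋 → ℂ) → ℝ≥0∞}
    (hcongr : ∀ f g, f =ᵐ[m] g → N f = N g) (hadd : ∀ f g, AEStronglyMeasurable f m →
      AEStronglyMeasurable g m → N (f + g) ≤ N f + N g)
    (hmul : ∀ (r : ℝ) f, 0 ≤ r → AEStronglyMeasurable f m → N (r • f) ≤ ENNReal.ofReal r * N f)
    (hfatou : ∀ (f : ℕ → 𝕋 → ℂ) g K, (∀ n, AEStronglyMeasurable (f n) m) →
      AEStronglyMeasurable g m → (∀ᵐ t ∂m, Tendsto (fun n => f n t) atTop (𝓝 (g t))) →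
      (∀ n, N (f n) ≤ K) → N g ≤ K)
    {U : Ultrafilter ℕ} {x : ℕ → Lp ℂ 2 m} {a : Lp ℂ 2 m}
    (hlim : ∀ g, Tendsto (fun n => inner ℂ g (x n)) U (𝓝 (inner ℂ g a))) {K : ℝ≥0∞}
    (hx : ∀ n, N (x n) ≤ K) : N a ≤ K := by
  refine weak_limit_mem (S := {h : Lp ℂ 2 m | N h ≤ K}) hlim ?_ ?_ hx
  · intro f hf g hg r s hr hs hrs
    have h1 : ((r • f + s • g : Lp ℂ 2 m) : 𝕋 → ℂ) =ᵐ[m] r • (f : 𝕋 → ℂ) + s • (g : 𝕋 → ℂ) := by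
      filter_upwards [Lp.coeFn_add (r • f) (s • g), Lp.coeFn_smul r f, Lp.coeFn_smul s g]
        with t h1 h2 h3
      rw [h1]; simp [h2, h3]
    refine (hcongr _ _ h1).le.trans ?_
    have hfm := (Lp.memLp f).1
    have hgm := (Lp.memLp g).1
    calc _ ≤ ENNReal.ofReal r * N f + ENNReal.ofReal s * N g :=
          (hadd _ _ (hfm.const_smul r) (hgm.const_smul s)).trans
            (add_le_add (hmul r _ hr hfm) (hmul s _ hs hgm))
      _ ≤ ENNReal.ofReal r * K + ENNReal.ofReal s * K := by
          gcongr
          · exact hf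
          · exact hg
      _ = K := by rw [← add_mul, ← ENNReal.ofReal_add hr hs, hrs]; simp
  · refine IsSeqClosed.isClosed fun u v hu huv => ?_
    obtain ⟨ns, -, hns⟩ := (tendstoInMeasure_of_tendsto_Lp huv).exists_seq_tendsto_ae
    exact hfatou (fun n => u (ns n)) v K (fun n => (Lp.memLp _).1) (Lp.memLp _).1 hns
      fun n => hu (ns n)

theorem fourierCoeff_eq_inner (f : Lp ℂ 2 m) (k : ℤ) :
    fourierCoeff f k = inner ℂ (fourierBasis (T := 2 * Real.pi) k) f := by
  rw [← fourierBasis_repr, HilbertBasis.repr_apply_apply]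

theorem enorm_fourierCoeff_sub_le {f g : 𝕋 → ℂ} (hf : Integrable f m) (hg : Integrable g m)
    (k : ℤ) : ‖fourierCoeff f k - fourierCoeff g k‖ₑ ≤ ∫⁻ t, ‖f t - g t‖ₑ ∂m := by
  have h1 : fourierCoeff f k - fourierCoeff g k = fourierCoeff (fun t => f t - g t) k := by
    simp only [fourierCoeff, smul_sub]
    rw [integral_sub]
    · exact hf.fourier_smul _
    · exact hg.fourier_smul _
  rw [h1]
  exact enorm_fourierCoeff_le _ k

/-- A sequence bounded in `Y` whose Fourier coefficients are eventually constant has a limit in `Y`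
with these Fourier coefficients. -/
theorem exists_of_bounded_fourierCoeff (hY : IsBanachFunctionSpace Y)
    (hri : IsRearrangementInvariant Y) (hB : HasNontrivialBoydIndices Y)
    (hF : HasFatouProperty Y) {K : ℝ≥0∞} (hK : K ≠ ∞) {b : ℕ → 𝕋 → ℂ}
    (hbm : ∀ n, AEStronglyMeasurable (b n) m) (hb : ∀ n, Y.fnrm (b n) ≤ K) {c : ℤ → ℂ}
    (hc : ∀ k, ∀ᶠ n in atTop, fourierCoeff (b n) k = c k) :
    ∃ a : 𝕋 → ℂ, AEStronglyMeasurable a m ∧ Y.fnrm a ≤ K ∧ ∀ k, fourierCoeff a k = c k := by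
  have hL : EmbedsInL1 Y := exists_lintegral_norm_le hY hri hB
  have hbi : ∀ n, Integrable (b n) m := fun n =>
    hL.integrable_of_fnrm ((hb n).trans_lt (lt_top_iff_ne_top.2 hK))
  obtain ⟨φ, hφt, hφ0, hφ⟩ := exists_setLIntegral_norm_le hY hri hB hK
  -- Truncation at height `2^M` puts the sequence into a ball of `L²`, at an `L¹` cost of at most `φ
  -- M`, uniformly in `n`.
  let tr : ℕ → ℕ → 𝕋 → ℂ := fun M n => {t | ‖b n t‖ ≤ 2 ^ M}.indicator (b n)
  have hset : ∀ M n, NullMeasurableSet {t | ‖b n t‖ ≤ (2 : ℝ) ^ M} m := fun M n =>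
    nullMeasurableSet_le (hbm n).norm.aemeasurable aemeasurable_const
  have hset' : ∀ M n, NullMeasurableSet {t | (2 : ℝ) ^ M < ‖b n t‖} m := fun M n =>
    nullMeasurableSet_lt aemeasurable_const (hbm n).norm.aemeasurable
  have htrm : ∀ M n, AEStronglyMeasurable (tr M n) m := fun M n => (hbm n).indicator₀ (hset M n)
  have htrb : ∀ M n t, ‖tr M n t‖ ≤ 2 ^ M := fun M n t => by
    by_cases ht : ‖b n t‖ ≤ 2 ^ M
    · simp [tr, ht]
    · simp [tr, ht]
  have htrle : ∀ M n t, ‖tr M n t‖ ≤ ‖b n t‖ := fun M n t => norm_indicator_le_norm_self _ _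
  have htr2 : ∀ M n, MemLp (tr M n) 2 m := fun M n =>
    MemLp.of_bound (htrm M n) (2 ^ M) (Eventually.of_forall (htrb M n))
  have htail : ∀ M n, ∫⁻ t, {t | (2 : ℝ) ^ M < ‖b n t‖}.indicator (fun t => ‖b n t‖ₑ) t ∂m ≤ φ M :=
    fun M n => by
      rw [lintegral_indicator₀ (hset' M n)]
      exact hφ (b n) (hbm n) (hb n) M
  let x : ℕ → ℕ → Lp ℂ 2 m := fun M n => (htr2 M n).toLp (tr M n)
  have hxc : ∀ M n, (x M n : 𝕋 → ℂ) =ᵐ[m] tr M n := fun M n => (htr2 M n).coeFn_toLp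
  have hxK : ∀ M n, ‖x M n‖ ≤ 2 ^ M := fun M n => by
    rw [Lp.norm_toLp]
    refine ENNReal.toReal_le_of_le_ofReal (by positivity) ?_
    refine (eLpNorm_le_of_ae_bound (Eventually.of_forall (htrb M n))).trans ?_
    simp
  -- One ultrafilter serves all `M`, so weak limits for different truncation levels can be
  -- subtracted.
  let U : Ultrafilter ℕ := hyperfilter ℕ
  have hU : (U : Filter ℕ) ≤ atTop := Nat.hyperfilter_le_atTop
  choose a ha using fun M => exists_weak_limit U (hxK M)
  have haK : ∀ M, Y.fnrm (a M) ≤ K := fun M => by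
    refine weak_limit_le (N := Y.fnrm) (fun f g => fnrm_congr) (fun f g _ _ => fnrm_add_le f g)
      (fun r f hr hf => ?_) (fun f g K hf hg hlim hK => fnrm_le_of_liminf hY hF hg hf hlim hK)
      (ha M) fun n => ?_
    · have h1 : r • f = fun t => (r : ℂ) * f t := by ext t; simp
      rw [h1, fnrm_const_mul _ hf, ← ofReal_norm, Complex.norm_real, Real.norm_of_nonneg hr]
    · rw [fnrm_congr (hxc M n)]
      exact (hY.fnrm_mono (htrm M n) (Eventually.of_forall (htrle M n))).trans (hb n)
  -- Two truncations of `b n` differ only where `|b n| > 2^M`, by at most `|b n|`; the weak limit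
  -- does not increase the `L¹` norm. Hence the `a M` are Cauchy in `L¹`.
  have hdiff : ∀ M M', M ≤ M' → ∫⁻ t, ‖(a M - a M' : Lp ℂ 2 m) t‖ₑ ∂m ≤ φ M := fun M M' hM => by
    refine weak_limit_le (N := fun f => ∫⁻ t, ‖f t‖ₑ ∂m)
      (fun f g h => lintegral_congr_ae (h.mono fun t ht => by simp [ht])) (fun f g hf _ => ?_)
      (fun r f hr hf => ?_) (fun f g K hf hg hlim hK => ?_)
      (x := fun n => x M n - x M' n) (U := U) (fun g => ?_) fun n => ?_
    · rw [← lintegral_add_left' hf.enorm]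
      exact lintegral_mono fun t => enorm_add_le _ _
    · rw [← lintegral_const_mul'' _ hf.enorm]
      refine lintegral_mono fun t => le_of_eq ?_
      rw [Pi.smul_apply, Complex.real_smul, enorm_mul, ← ofReal_norm (r : ℂ), Complex.norm_real,
        Real.norm_of_nonneg hr]
    · have h1 : ∫⁻ t, ‖g t‖ₑ ∂m = ∫⁻ t, liminf (fun n => ‖f n t‖ₑ) atTop ∂m :=
        lintegral_congr_ae (hlim.mono fun t ht => ht.enorm.liminf_eq.symm)
      rw [h1]
      refine (lintegral_liminf_le' fun n => (hf n).enorm).trans ?_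
      exact liminf_le_of_le (by isBoundedDefault) fun y hy => by
        obtain ⟨n, hn⟩ := hy.exists
        exact hn.trans (hK n)
    · simp only [inner_sub_right]
      exact (ha M g).sub (ha M' g)
    · refine le_trans (lintegral_mono_ae ?_) (htail M n)
      filter_upwards [Lp.coeFn_sub (x M n) (x M' n), hxc M n, hxc M' n] with t h1 h2 h3
      rw [h1, Pi.sub_apply, h2, h3]
      by_cases ht : ‖b n t‖ ≤ 2 ^ M
      · have ht' : ‖b n t‖ ≤ 2 ^ M' := ht.trans (pow_le_pow_right₀ one_le_two hM)
        simp [tr, Set.indicator, ht, ht']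
      · simp only [tr, Set.indicator, Set.mem_ofPred_eq, ht, not_le.1 ht, if_true, if_false]
        split_ifs <;> simp
  have hai : ∀ M, Integrable (a M) m := fun M => (Lp.memLp (a M)).integrable (by norm_num)
  have hcoeff : ∀ M k, ‖fourierCoeff (a M) k - c k‖ₑ ≤ φ M := fun M k => by
    have h1 : Tendsto (fun n => ‖fourierCoeff (x M n) k - c k‖ₑ) U
        (𝓝 ‖fourierCoeff (a M) k - c k‖ₑ) := by
      simp_rw [fourierCoeff_eq_inner]
      exact ((ha M _).sub_const _).enorm
    refine le_of_tendsto h1 ((Eventually.filter_mono hU (hc k)).mono fun n hn => ?_)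
    rw [← hn, fourierCoeff_congr_ae (hxc M n)]
    refine (enorm_fourierCoeff_sub_le ((htr2 M n).integrable (by norm_num)) (hbi n) k).trans ?_
    refine le_trans (lintegral_mono fun t => ?_) (htail M n)
    by_cases ht : ‖b n t‖ ≤ 2 ^ M
    · simp [tr, Set.indicator, ht]
    · simp [tr, Set.indicator, ht, not_le.1 ht]
  have ha1 : ∀ M, MemLp (a M) 1 m := fun M => memLp_one_iff_integrable.2 (hai M)
  let s : ℕ → Lp ℂ 1 m := fun M => (ha1 M).toLp (a M)
  have hcauchy : CauchySeq s := by
    refine cauchySeq_of_le_tendsto_0' (fun M => (φ M).toReal) (fun M M' hM => ?_) ?_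
    · rw [dist_edist, Lp.edist_toLp_toLp, eLpNorm_one_eq_lintegral_enorm]
      refine ENNReal.toReal_mono (hφt M) (le_trans (le_of_eq ?_) (hdiff M M' hM))
      refine lintegral_congr_ae ((Lp.coeFn_sub (a M) (a M')).mono fun t ht => ?_)
      simp only [ht]
    · simpa [Function.comp_def] using (ENNReal.tendsto_toReal (ENNReal.zero_ne_top)).comp hφ0
  obtain ⟨A, hA⟩ := cauchySeq_tendsto_of_complete hcauchy
  have hAi : Integrable A m := memLp_one_iff_integrable.1 (Lp.memLp A)
  have hL1 : Tendsto (fun M => ∫⁻ t, ‖a M t - A t‖ₑ ∂m) atTop (𝓝 0) := by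
    have h1 := tendsto_iff_edist_tendsto_0.1 hA
    refine h1.congr fun M => ?_
    rw [Lp.edist_def, eLpNorm_one_eq_lintegral_enorm]
    refine lintegral_congr_ae ((ha1 M).coeFn_toLp.mono fun t ht => ?_)
    simp only [Pi.sub_apply, s, ht]
  refine ⟨A, hAi.1, ?_, fun k => ?_⟩
  · obtain ⟨ns, -, hns⟩ := (tendstoInMeasure_of_tendsto_Lp hA).exists_seq_tendsto_ae
    refine fnrm_le_of_liminf hY hF hAi.1 (f := fun n => s (ns n)) (fun n => (Lp.memLp _).1) hns
      fun n => ?_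
    rw [fnrm_congr (ha1 (ns n)).coeFn_toLp]
    exact haK _
  · have h1 : Tendsto (fun M => ‖fourierCoeff (a M) k - fourierCoeff A k‖ₑ) atTop (𝓝 0) :=
      tendsto_of_tendsto_of_tendsto_of_le_of_le tendsto_const_nhds hL1 (fun _ => zero_le)
        fun M => enorm_fourierCoeff_sub_le (hai M) hAi k
    have h2 : Tendsto (fun M => ‖fourierCoeff (a M) k - c k‖ₑ) atTop (𝓝 0) :=
      tendsto_of_tendsto_of_tendsto_of_le_of_le tendsto_const_nhds hφ0 (fun _ => zero_le)
        fun M => hcoeff M k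
    have h3 : ∀ z : ℂ, Tendsto (fun M => ‖fourierCoeff (a M) k - z‖ₑ) atTop (𝓝 0) →
        Tendsto (fun M => fourierCoeff (a M) k) atTop (𝓝 z) := fun z hz => by
      rw [tendsto_iff_edist_tendsto_0]
      simpa only [edist_eq_enorm_sub] using hz
    exact tendsto_nhds_unique (h3 _ h1) (h3 _ h2)

/-! ### Toeplitz operators -/

theorem pairing_χ (f : L0) (n : ℤ) : pairing f (χ n) = fourierCoeff f n := by
  refine integral_congr_ae ?_
  filter_upwards [coeFn_χ n] with t ht
  rw [ht, fourier_neg, smul_eq_mul, mul_comm]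

theorem fourierCoeff_fourier_mul (f : 𝕋 → ℂ) (n k : ℤ) :
    fourierCoeff (fun t => fourier n t * f t) k = fourierCoeff f (k - n) := by
  refine integral_congr_ae (Eventually.of_forall fun t => ?_)
  simp only [smul_eq_mul]
  rw [← mul_assoc, ← fourier_add]
  congr 3
  ring

theorem norm_fourier_mul (n : ℤ) (t : 𝕋) (z : ℂ) : ‖fourier n t * z‖ = ‖z‖ := by
  rw [norm_mul, fourier_apply, Circle.norm_coe, one_mul]

theorem fnrm_fourier_mul (hX : IsBanachFunctionSpace X) (n : ℤ) {f : 𝕋 → ℂ}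
    (hf : AEStronglyMeasurable f m) : X.fnrm (fun t => fourier n t * f t) = X.fnrm f := by
  have h : AEStronglyMeasurable (fun t => fourier n t * f t) m :=
    AEStronglyMeasurable.mul (aestronglyMeasurable_continuousMap (fourier n)) hf
  exact hX.fnrm_congr_norm hf h (Eventually.of_forall fun t => norm_fourier_mul n t (f t))

theorem integrable_trigPoly_mul {a : 𝕋 → ℂ} (ha : Integrable a m) (d : ℤ →₀ ℂ) :
    Integrable (fun t => trigPoly d t * a t) m :=
  ha.bdd_mul (aestronglyMeasurable_continuousMap _)
    (Eventually.of_forall fun t => (trigPoly d).norm_coe_le_norm t)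

theorem fourierCoeff_trigPoly_mul {a : 𝕋 → ℂ} (ha : Integrable a m) (d : ℤ →₀ ℂ) (k : ℤ) :
    fourierCoeff (fun t => trigPoly d t * a t) k =
      d.sum fun j z => z * fourierCoeff a (k - j) := by
  induction d using Finsupp.induction_linear with
  | zero => simp [fourierCoeff]
  | add d e hd he =>
    have h : (fun t => trigPoly (d + e) t * a t) =
        (fun t => trigPoly d t * a t) + fun t => trigPoly e t * a t := by
      ext t; simp [add_mul]
    rw [h, fourierCoeff.add (integrable_trigPoly_mul ha d) (integrable_trigPoly_mul ha e),
      Pi.add_apply, hd, he, Finsupp.sum_add_index' (by simp) (by intros; ring)]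
  | single n z =>
    have h : (fun t => trigPoly (Finsupp.single n z) t * a t) =
        z • fun t => fourier n t * a t := by
      ext t; simp [trigPoly_single, mul_assoc]
    rw [h, fourierCoeff.const_smul, fourierCoeff_fourier_mul, Finsupp.sum_single_index (by simp),
      smul_eq_mul]

/-- The analytic polynomial `χₙ f` for a trigonometric polynomial `f` of lower degree at least
`-n`. -/
def shiftedPoly (hX : IsBanachFunctionSpace X) (n : ℤ) : (ℤ →₀ ℂ) →ₗ[ℂ] hardy X :=
  -- For `j + n < 0` the truncation `toNat` would give the index `0`; the identification with `χₙ f`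
  -- is made only for `n` so large that this does not occur.
  Finsupp.linearCombination ℂ fun j => hardyχ hX (j + n).toNat

theorem map_shiftedPoly (hX : IsBanachFunctionSpace X) (φ : hardy X →ₗ[ℂ] ℂ) (n : ℤ)
    (d : ℤ →₀ ℂ) :
    φ (shiftedPoly hX n d) = d.sum fun j z => z * φ (hardyχ hX (j + n).toNat) := by
  simp [shiftedPoly, Finsupp.linearCombination_apply, map_finsuppSum]

theorem fourierCoeff_χ (n k : ℤ) : fourierCoeff (χ n : L0) k = if k = n then 1 else 0 := by
  rw [fourierCoeff_congr_ae (coeFn_χ n), fourierCoeff_fourier, Pi.single_apply]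

theorem coeFn_shiftedPoly (hX : IsBanachFunctionSpace X) (hL : EmbedsInL1 X) {n : ℤ}
    {d : ℤ →₀ ℂ} (hd : ∀ j ∈ d.support, 0 ≤ j + n) :
    (((shiftedPoly hX n d : X.space) : L0) : 𝕋 → ℂ) =ᵐ[m] fun t => fourier n t * trigPoly d t := by
  have hi : Integrable (fun t => fourier n t * trigPoly d t) m := by
    have := integrable_continuousMap (fourier n * trigPoly d)
    rwa [ContinuousMap.coe_mul] at this
  refine ae_eq_of_fourierCoeff (hL.integrable _) hi fun k => ?_
  obtain ⟨φ, hφ⟩ := exists_coeffCLM hL k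
  have h1 := map_shiftedPoly hX (φ.comp (hardy X).subtypeL).toLinearMap n d
  simp only [ContinuousLinearMap.coe_coe, ContinuousLinearMap.comp_apply,
    Submodule.subtypeL_apply, hφ] at h1
  rw [h1, fourierCoeff_fourier_mul, fourierCoeff_trigPoly]
  have h2 : ∀ j ∈ d.support,
      d j * fourierCoeff (((hardyχ hX (j + n).toNat : X.space) : L0) : 𝕋 → ℂ) k =
        if j = k - n then d j else 0 := fun j hj => by
    change d j * fourierCoeff (χ ((j + n).toNat : ℤ) : L0) k = _
    rw [fourierCoeff_χ, Int.toNat_of_nonneg (hd j hj)]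
    simp only [mul_ite, mul_one, mul_zero]
    exact if_congr (by constructor <;> intro h <;> omega) rfl rfl
  rw [Finsupp.sum, Finset.sum_congr rfl h2, Finset.sum_ite_eq']
  split_ifs with h
  · rfl
  · exact (Finsupp.notMem_support_iff.1 h).symm

/-- If `A : H[X] → H[Y]` has a Toeplitz matrix, then `f ↦ ∑ₖ (∑ⱼ f̂(j) c (k - j)) χₖ` is bounded on
trigonometric polynomials. -/
theorem exists_laurent (hX : IsBanachFunctionSpace X) (hLX : EmbedsInL1 X)
    (hY : IsBanachFunctionSpace Y) (hYri : IsRearrangementInvariant Y)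
    (hB : HasNontrivialBoydIndices Y) (hF : HasFatouProperty Y)
    {A : hardy X →L[ℂ] hardy Y} {c : ℤ → ℂ}
    (hA : ∀ j k : ℕ, fourierCoeff ((A (hardyχ hX j) : Y.space) : L0) k = c ((k : ℤ) - (j : ℤ)))
    (d : ℤ →₀ ℂ) :
    ∃ g : 𝕋 → ℂ, AEStronglyMeasurable g m ∧ Y.fnrm g ≤ ‖A‖ₑ * X.fnrm (trigPoly d) ∧
      ∀ k, fourierCoeff g k = d.sum fun j z => z * c (k - j) := by
  have hLY : EmbedsInL1 Y := exists_lintegral_norm_le hY hYri hB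
  obtain ⟨N, hN⟩ : ∃ N : ℕ, ∀ j ∈ d.support, 0 ≤ j + N := by
    refine ⟨∑ j ∈ d.support, j.natAbs, fun j hj => ?_⟩
    have := Finset.single_le_sum (f := fun j : ℤ => j.natAbs) (fun _ _ => Nat.zero_le _) hj
    omega
  let ν : ℕ → ℤ := fun i => (N + i : ℕ)
  have hν : ∀ i, ∀ j ∈ d.support, 0 ≤ j + ν i := fun i j hj => by
    have := hN j hj
    simp only [ν]; omega
  -- Shift up, apply `A`, shift back: both shifts are isometric. The `k`-th coefficient is an entry
  -- combination with nonnegative row index `k + ν i` once `i ≥ |k|`, where the Toeplitz hypothesis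
  -- gives a value independent of `i`.
  let b : ℕ → 𝕋 → ℂ := fun i t => fourier (-ν i) t * ((A (shiftedPoly hX (ν i) d) : Y.space) : L0) t
  refine exists_of_bounded_fourierCoeff hY hYri hB hF (b := b)
    (ENNReal.mul_ne_top enorm_ne_top (hX.fnrm_continuous_lt_top _).ne)
    (fun i => (aestronglyMeasurable_continuousMap _).mul (AEEqFun.aestronglyMeasurable _))
    (fun i => ?_) fun k => ?_
  · rw [fnrm_fourier_mul hY _ (AEEqFun.aestronglyMeasurable _), fnrm_coe, ← enorm_def]
    refine (A.le_opENorm (shiftedPoly hX (ν i) d)).trans (le_of_eq ?_)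
    congr 1
    change ‖(shiftedPoly hX (ν i) d : X.space)‖ₑ = _
    rw [enorm_eq_fnrm _ (coeFn_shiftedPoly hX hLX (hν i)),
      fnrm_fourier_mul hX _ (aestronglyMeasurable_continuousMap _)]
  · filter_upwards [eventually_ge_atTop k.natAbs] with i hi
    rw [fourierCoeff_fourier_mul]
    obtain ⟨φ, hφ⟩ := exists_coeffCLM hLY (k - -ν i)
    have h1 := map_shiftedPoly hX ((φ.comp (hardy Y).subtypeL).comp A).toLinearMap (ν i) d
    simp only [ContinuousLinearMap.coe_coe, ContinuousLinearMap.comp_apply,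
      Submodule.subtypeL_apply, hφ] at h1
    rw [h1]
    refine Finset.sum_congr rfl fun j hj => ?_
    obtain ⟨l, hl⟩ : ∃ l : ℕ, k - -ν i = l := Int.eq_ofNat_of_zero_le (by simp only [ν]; omega)
    simp only
    rw [hl, hA, Int.toNat_of_nonneg (hν i j hj), ← hl]
    congr 2
    ring

theorem ofReal_opNorm (A : hardy X →L[ℂ] hardy Y) : ENNReal.ofReal ‖A‖ = ‖A‖ₑ := ofReal_norm A

/-- An operator `H[X] → H[Y]` with a Toeplitz matrix has a symbol in `M(X, Y)`. -/
theorem exists_symbol (hX : IsBanachFunctionSpace X) (hXri : IsRearrangementInvariant X)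
    (hXsep : TopologicalSpace.SeparableSpace X.space) (hLX : EmbedsInL1 X)
    (hY : IsBanachFunctionSpace Y) (hYri : IsRearrangementInvariant Y)
    (hB : HasNontrivialBoydIndices Y) (hF : HasFatouProperty Y)
    {A : hardy X →L[ℂ] hardy Y} {c : ℤ → ℂ}
    (hA : ∀ j k : ℕ, fourierCoeff ((A (hardyχ hX j) : Y.space) : L0) k = c ((k : ℤ) - (j : ℤ))) :
    ∃ a ∈ multipliers X Y, multiplierNorm X Y a ≤ ENNReal.ofReal ‖A‖ ∧
      a ∈ Y.space ∧ ∀ n, fourierCoeff (a : L0) n = c n := by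
  have hLY : EmbedsInL1 Y := exists_lintegral_norm_le hY hYri hB
  have hlaurent := exists_laurent hX hLX hY hYri hB hF hA
  -- The symbol is the image of the constant function `1` under the Laurent operator.
  obtain ⟨a₀, -, ha₀, hac₀⟩ := hlaurent (Finsupp.single 0 1)
  have ha₀t : Y.fnrm a₀ < ∞ := ha₀.trans_lt
    (ENNReal.mul_lt_top enorm_lt_top (hX.fnrm_continuous_lt_top _))
  let a : Y.space := Y.toSpace a₀ ha₀t
  have hac : ∀ n, fourierCoeff (a : L0) n = c n := fun n => by
    rw [fourierCoeff_congr_ae (coeFn_toSpace ha₀t), hac₀]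
    simp
  have htrig : ∀ d, Y.fnrm (fun t => (a : L0) t * (trigSpace hX d : L0) t) ≤
      ‖A‖ₑ * ‖trigSpace hX d‖ₑ := fun d => by
    obtain ⟨g, hgm, hg, hgc⟩ := hlaurent d
    have hgi : Integrable g m := hLY.integrable_of_fnrm (hg.trans_lt
      (ENNReal.mul_lt_top enorm_lt_top (hX.fnrm_continuous_lt_top _)))
    have h1 : g =ᵐ[m] fun t => trigPoly d t * (a : L0) t :=
      ae_eq_of_fourierCoeff hgi (integrable_trigPoly_mul (hLY.integrable a) d) fun k => by
        simp only [hgc, fourierCoeff_trigPoly_mul (hLY.integrable a), hac]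
    rw [enorm_trigSpace]
    refine le_trans (le_of_eq (fnrm_congr ?_)) hg
    filter_upwards [h1, coeFn_trigSpace hX d] with t h2 h3
    rw [h2, h3, mul_comm]
  have hgen : ∀ f : X.space, Y.fnrm (fun t => (a : L0) t * (f : L0) t) ≤ ‖A‖ₑ * ‖f‖ₑ := fun f => by
    refine ENNReal.le_of_forall_pos_le_add fun ε hε _ => ?_
    obtain ⟨u, hu, hlim⟩ := mem_closure_iff_seq_limit.1 (denseRange_trigSpace hX hXsep f)
    choose d hd using hu
    have hnorm : ∀ᶠ n in atTop, ‖A‖ₑ * ‖u n‖ₑ < ‖A‖ₑ * ‖f‖ₑ + ε := by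
      have h1 : Tendsto (fun n => ‖A‖ₑ * ‖u n‖ₑ) atTop (𝓝 (‖A‖ₑ * ‖f‖ₑ)) :=
        ENNReal.Tendsto.const_mul hlim.enorm (Or.inr enorm_ne_top)
      exact h1.eventually (gt_mem_nhds
        (ENNReal.lt_add_right (ENNReal.mul_ne_top enorm_ne_top enorm_ne_top) (by simpa using hε.ne')))
    -- The approximants satisfy the norm bound only from some index on, so the sequence is shifted
    -- by `N` before an a.e. convergent subsequence is taken.
    obtain ⟨N, hN⟩ := eventually_atTop.1 hnorm
    obtain ⟨ns, hns, hae⟩ := exists_seq_tendsto_ae_of_tendsto hX hXri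
      ((tendsto_add_atTop_iff_nat N).2 hlim)
    refine fnrm_le_of_liminf hY hF (f := fun n t => (a : L0) t * (u (ns n + N) : L0) t)
      ((AEEqFun.aestronglyMeasurable _).mul (AEEqFun.aestronglyMeasurable _))
      (fun n => (AEEqFun.aestronglyMeasurable _).mul (AEEqFun.aestronglyMeasurable _))
      (hae.mono fun t ht => ht.const_mul _) fun n => ?_
    refine le_trans ?_ (hN (ns n + N) (Nat.le_add_left _ _)).le
    rw [← hd]
    exact htrig _
  have hnrm : ∀ g ∈ X.space, Y.nrm ((a : L0) * g) ≤ ‖A‖ₑ * X.nrm g := fun g hg => by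
    rw [← fnrm_coe, fnrm_congr (AEEqFun.coeFn_mul (a : L0) g)]
    have h := hgen ⟨g, hg⟩
    rwa [enorm_def] at h
  refine ⟨a, fun g hg => ?_, iSup₂_le fun g hg => ?_, a.2, hac⟩
  · exact (hnrm g hg).trans_lt (ENNReal.mul_lt_top enorm_lt_top hg)
  · refine (hnrm g (hg.trans_lt ENNReal.one_lt_top)).trans ?_
    rw [ofReal_opNorm]
    exact mul_le_of_le_one_right' hg

theorem fourierCoeff_mul_χ (a : L0) (j k : ℤ) :
    fourierCoeff (a * χ j : L0) k = fourierCoeff (a : L0) (k - j) := by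
  rw [← fourierCoeff_fourier_mul]
  refine congrFun (fourierCoeff_congr_ae ?_) k
  filter_upwards [AEEqFun.coeFn_mul a (χ j), coeFn_χ j] with t h1 h2
  rw [h1, Pi.mul_apply, h2, mul_comm]

theorem IsToeplitz.fourierCoeff_eq (hX : IsBanachFunctionSpace X) {a : L0}
    {A : hardy X →L[ℂ] hardy Y} (h : IsToeplitz a A) (j k : ℕ) :
    fourierCoeff ((A (hardyχ hX j) : Y.space) : L0) k =
      fourierCoeff (a : L0) ((k : ℤ) - (j : ℤ)) := by
  rw [(h (hardyχ hX j)).2.2, if_pos (Int.natCast_nonneg k)]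
  exact fourierCoeff_mul_χ a j k

/-- Both `A` and `P ∘ M_a` are bounded on `H[X]` and agree on every `χⱼ`: the coefficients for `k ≥
0` match by hypothesis, those for `k < 0` vanish on both sides. -/
theorem isToeplitz_of_fourierCoeff_eq (hX : IsBanachFunctionSpace X)
    (hXri : IsRearrangementInvariant X) (hXsep : TopologicalSpace.SeparableSpace X.space)
    (hLX : EmbedsInL1 X) (hY : IsBanachFunctionSpace Y) (hYri : IsRearrangementInvariant Y)
    (hLY : EmbedsInL1 Y) {P : Y.space →L[ℂ] Y.space} (hP : IsRieszProjection P) {a : L0}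
    (ha : a ∈ multipliers X Y) {A : hardy X →L[ℂ] hardy Y}
    (h : ∀ j k : ℕ, fourierCoeff ((A (hardyχ hX j) : Y.space) : L0) k =
      fourierCoeff (a : L0) ((k : ℤ) - (j : ℤ))) : IsToeplitz a A := by
  let M := mulCLM hX hY hXri hYri ha
  have hzero : (hardy Y).subtypeL.comp A - (P.comp M).comp (hardy X).subtypeL = 0 := by
    refine eq_zero_of_hardyχ hX hXri hXsep hLX _ fun j => ?_
    refine sub_eq_zero.2 (hLY.ext fun k => ?_)
    change fourierCoeff ((A (hardyχ hX j) : Y.space) : L0) k =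
      fourierCoeff ((P (M (hardyχ hX j : X.space)) : Y.space) : L0) k
    rw [(hP _).2.2]
    split_ifs with hk
    · obtain ⟨l, rfl⟩ := Int.eq_ofNat_of_zero_le hk
      rw [h]
      exact (fourierCoeff_mul_χ a j l).symm
    · exact (A (hardyχ hX j)).2.2 k (not_le.1 hk)
  intro f
  have h1 : (A f : Y.space) = P (M (f : X.space)) :=
    sub_eq_zero.1 (DFunLike.congr_fun hzero f)
  rw [h1]
  exact hP (M f)

theorem enorm_mulCLM_le (hX : IsBanachFunctionSpace X) (hY : IsBanachFunctionSpace Y)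
    (hXri : IsRearrangementInvariant X) (hYri : IsRearrangementInvariant Y) {a : L0}
    (ha : a ∈ multipliers X Y) :
    ‖mulCLM hX hY hXri hYri ha‖ₑ ≤ multiplierNorm X Y a := by
  let M := mulCLM hX hY hXri hYri ha
  have hM : ∀ g : X.space, ‖M g‖ₑ = Y.nrm (a * g) := fun g => enorm_def _
  refine ContinuousLinearMap.opENorm_le_bound _ fun g => ?_
  rcases eq_or_ne g 0 with rfl | hg
  · rw [map_zero]; simp
  have hr : (‖g‖ : ℂ) ≠ 0 := by simpa using hg
  have h1 : ‖M ((‖g‖ : ℂ)⁻¹ • g)‖ₑ ≤ multiplierNorm X Y a := by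
    rw [hM]
    refine le_iSup₂_of_le (f := fun (g : L0) (_ : X.nrm g ≤ 1) => Y.nrm (a * g)) _ ?_ le_rfl
    rw [← enorm_def, ← ofReal_norm, norm_smul]
    simp [hg]
  have h2 : ‖M g‖ₑ = ‖(‖g‖ : ℂ)‖ₑ * ‖M ((‖g‖ : ℂ)⁻¹ • g)‖ₑ := by
    rw [← enorm_smul, ← map_smul, smul_inv_smul₀ hr]
  have h3 : ‖(‖g‖ : ℂ)‖ₑ = ‖g‖ₑ := by rw [← ofReal_norm, Complex.norm_real, norm_norm, ofReal_norm]
  change ‖M g‖ₑ ≤ _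
  rw [h2, h3, mul_comm]
  exact mul_le_mul_left h1 _

/-- The Toeplitz operator with symbol `a ∈ M(X, Y)`. -/
theorem exists_toeplitz (hX : IsBanachFunctionSpace X) (hY : IsBanachFunctionSpace Y)
    (hXri : IsRearrangementInvariant X) (hYri : IsRearrangementInvariant Y)
    {P : Y.space →L[ℂ] Y.space} (hP : IsRieszProjection P) {a : L0}
    (ha : a ∈ multipliers X Y) :
    ∃ T : hardy X →L[ℂ] hardy Y, IsToeplitz a T ∧
      ENNReal.ofReal ‖T‖ ≤ ENNReal.ofReal ‖P‖ * multiplierNorm X Y a := by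
  let M := mulCLM hX hY hXri hYri ha
  let T : hardy X →L[ℂ] hardy Y := ((P.comp M).comp (hardy X).subtypeL).codRestrict (hardy Y)
    fun f => ⟨(hP _).2.1, fun n hn => ((hP (M f)).2.2 n).trans (if_neg (not_le.2 hn))⟩
  refine ⟨T, fun f => hP (M f), ?_⟩
  rw [ofReal_opNorm, ofReal_norm]
  refine le_trans ?_ (mul_le_mul_right (enorm_mulCLM_le hX hY hXri hYri ha) _)
  refine ContinuousLinearMap.opENorm_le_bound _ fun f => ?_
  refine (P.le_opENorm (M f)).trans ?_
  rw [mul_assoc]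
  exact mul_le_mul_right (M.le_opENorm (f : X.space)) _

end BrownHalmos

end

/-! ### The general Brown–Halmos theorem -/

open BrownHalmos in
theorem theorem4p2 (X Y : FunctionSpace)
    (hX : IsBanachFunctionSpace X) (hY : IsBanachFunctionSpace Y)
    (hXri : IsRearrangementInvariant X) (hYri : IsRearrangementInvariant Y)
    (hXsep : TopologicalSpace.SeparableSpace X.space)
    (hYsep : TopologicalSpace.SeparableSpace Y.space)
    (hXY : X.space ≤ Y.space)
    (hYBoyd : HasNontrivialBoydIndices Y) (hYFatou : HasFatouProperty Y) :
    ∃ P : Y.space →L[ℂ] Y.space, IsRieszProjection P ∧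
      (∀ (A : hardy X →L[ℂ] hardy Y) (c : ℤ → ℂ),
        (∀ j k : ℕ, pairing ((A (hardyχ hX j) : Y.space) : L0) (χ k) = c ((k : ℤ) - (j : ℤ))) ↔
          ∃ a ∈ multipliers X Y, IsToeplitz a A ∧ ∀ n : ℤ, fourierCoeff a n = c n) ∧
      (∀ a ∈ multipliers X Y, ∃ T : hardy X →L[ℂ] hardy Y, IsToeplitz a T ∧
        multiplierNorm X Y a ≤ ENNReal.ofReal ‖T‖ ∧
        ENNReal.ofReal ‖T‖ ≤ ENNReal.ofReal ‖P‖ * multiplierNorm X Y a) := by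
  have hLY : EmbedsInL1 Y := exists_lintegral_norm_le hY hYri hYBoyd
  have hLX : EmbedsInL1 X := EmbedsInL1.of_le hX hY hXri hYri hXY hLY
  obtain ⟨P, hP⟩ := exists_rieszProjection hY hYri hYsep hYBoyd hYFatou
  refine ⟨P, hP, fun A c => ⟨fun h => ?_, ?_⟩, fun a ha => ?_⟩
  · simp only [pairing_χ] at h
    obtain ⟨a, ha, -, -, hac⟩ := exists_symbol hX hXri hXsep hLX hY hYri hYBoyd hYFatou h
    refine ⟨a, ha, ?_, hac⟩
    exact isToeplitz_of_fourierCoeff_eq hX hXri hXsep hLX hY hYri hLY hP ha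
      fun j k => by rw [h, hac]
  · rintro ⟨a, -, hT, hac⟩ j k
    rw [pairing_χ, hT.fourierCoeff_eq hX, hac]
  · obtain ⟨T, hT, hTP⟩ := exists_toeplitz hX hY hXri hYri hP ha
    refine ⟨T, hT, ?_, hTP⟩
    -- The symbol recovered from the matrix of `T` obeys the lower norm estimate. It has the Fourier
    -- coefficients of `a`, and `a = a · 1` lies in `Y ⊆ L¹`, so it is `a`.
    obtain ⟨a', -, hle, ha'Y, hac⟩ := exists_symbol hX hXri hXsep hLX hY hYri hYBoyd hYFatou
      (fun j k => hT.fourierCoeff_eq hX j k)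
    have haY : a ∈ Y.space := by
      have h1 : (1 : L0) ∈ X.space := hX.linfty_subset 1
        ⟨1, by filter_upwards [AEEqFun.coeFn_one (α := 𝕋) (μ := m) (β := ℂ)] with t ht; simp [ht]⟩
      simpa using ha 1 h1
    have h2 := hLY.ext (f := ⟨a', ha'Y⟩) (g := ⟨a, haY⟩) hac
    rwa [show a' = a from congrArg Subtype.val h2] at hle
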